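/- **Conventions.** Fix $n\ge 2$ and write $[n-1]=\{1,\dots,n-1\}$. All varieties are over $\mathbb C$. An identity between rational maps means that both sides (compositions included) are defined and agree on a dense Zariski-open set. For $1\le k\le n-1$ let $\mathbb X_k=\mathrm{Gr}(k,n)\times\mathbb C^\times$, with points $N|t$, where $\mathrm{Gr}(k,n)$ is the Grassmannian of $k$-dimensional subspaces of $\mathbb C^n$. For a set $I$ of integers let $P_I(N)$ be the Plücker coordinate of $N$ whose rows are the residues of $I$ modulo $n$ in $\{1,\dots,n\}$, taken in increasing order ($P_I(N)=0$ if there are not exactly $k$ residues). Let $[a,b]=\{m\in\mathbb Z: a\le m\le b\}$. **Geometric crystals.** A geometric crystal (of type $A^{(1)}_{n-1}$) is an irreducible variety $X$ with rational maps $\gamma:X\to(\mathbb C^\times)^n$ (components labelled modulo $n$), $\varphi_i,\varepsilon_i:X\to\mathbb C^\times$ and $e_i:\mathbb C^\times\times X\to X$, $(c,x)\mapsto e_i^c(x)$, for $i\in\mathbb Z/n\mathbb Z$, such that, as rational maps: $e_i^1=\mathrm{id}$ and $e_i^ce_i^{d}=e_i^{cd}$; $\gamma(e_i^c(x))$ is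 $\gamma(x)$ with the $i$-th component multiplied by $c$ and the $(i+1)$-th by $c^{-1}$; $\varphi_i(e_i^c(x))=c^{-1}\varphi_i(x)$; $\varepsilon_i(e_i^c(x))=c\,\varepsilon_i(x)$; $\varepsilon_i/\varphi_i=\gamma_i/\gamma_{i+1}$; and, if $n\ge3$, $e_i^{c}e_j^{d}=e_j^{d}e_i^{c}$ for distinct $i,j$ not adjacent modulo $n$, and $e_i^{c}e_j^{cd}e_i^{d}=e_j^{d}e_i^{cd}e_j^{c}$ for $i,j$ adjacent modulo $n$. A morphism is a rational map $h$ with $\gamma h=\gamma$, $\varphi_ih=\varphi_i$, $\varepsilon_ih=\varepsilon_i$ and $e_i^ch=he_i^c$ for all $i$; an isomorphism is a morphism of geometric crystals with an inverse morphism. On a product $X\times Y$ one uses the maps $$\gamma(x,y)=\gamma(x)\gamma(y),\quad \varphi_i(x,y)=\frac{\varphi_i(x)(\varepsilon_i(x)+\varphi_i(y))}{\varepsilon_i(x)},\quad \varepsilon_i(x,y)=\frac{\varepsilon_i(y)(\varepsilon_i(x)+\varphi_i(y))}{\varphi_i(y)},$$ $$e_i^c(x,y)=(e_i^{c_1}(x),e_i^{c_2}(y)),\quad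 c_1=\frac{c\,\varepsilon_i(x)+\varphi_i(y)}{\varepsilon_i(x)+\varphi_i(y)},\quad c_2=\frac{\varepsilon_i(x)+\varphi_i(y)}{\varepsilon_i(x)+c^{-1}\varphi_i(y)}.$$ On $\mathbb X_k$ the maps are as follows, all Plücker coordinates being those of $N$. For $1\le i\le n$, $\gamma_i(N|t)=t^{[i>k]}\,P_{[i-k+1,i]}/P_{[i-k,i-1]}$. For $0\le i\le n-1$, $$\varphi_i(N|t)=t^{-\delta_{i,0}}\frac{P_{[i-k+1,i-1]\cup\{i+1\}}}{P_{[i-k+1,i]}},\qquad \varepsilon_i(N|t)=t^{-\delta_{i,k}}\frac{P_{[i-k+1,i-1]\cup\{i+1\}}\,P_{[i-k+1,i]}}{P_{[i-k,i-1]}\,P_{[i-k+2,i+1]}},$$ and $e_i^c(N|t)=N'|t$, where $N'=\big(\mathrm{Id}+\tfrac{c-1}{\varphi_i(N|t)}E_{i,i+1}\big)\cdot N$ for $i\ne0$ and $N'=\big(\mathrm{Id}+\tfrac{(-1)^{k-1}}{t}\tfrac{c-1}{\varphi_0(N|t)}E_{n,1}\big)\cdot N$ for $i=0$. **The map $R$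 and the symmetries.** Let $g(N|t)$ be the $n\times n$ matrix with entries $$g(N|t)_{ij}=c_{ij}\,\frac{P_{[j-k+1,j-1]\cup\{i\}}(N)}{P_{[j-k,j-1]}(N)},\qquad c_{ij}=\begin{cases}1& j\le k\\ t& j>k,\ i\ge j\\ \lambda& j>k,\ i<j,\end{cases}$$ where $\lambda$ is an indeterminate, and $g(x,y)=g(x)g(y)$. For a matrix $A$ with entries in $\mathbb C[\lambda]$ let $\pi^k_z(A)=N|z$, where $N$ is the span of the first $k$ columns of $A|_{\lambda=(-1)^{k-1}z}$, and let $\mathrm{fl}(A)_{ij}=A_{n-j+1,n-i+1}$. - $PR(N|t)=N'|t$, where $N'$ is obtained from $N$ by shifting the rows down by one cyclically and multiplying the new first row by $(-1)^{k-1}t$; $PR(x,y)=(PR(x),PR(y))$. - $S(N|t)=\pi^k_t(\mathrm{fl}(g(N|t)))$ on $\mathbb X_k$; $S(x,y)=(S(y),S(x))$. - $D=S\circ\mu$, where $\mu:\mathbb X_k\to\mathbb X_{n-k}$ sends $N|t$ to $T(N^\perp)|t$, with $N^\perp$ the orthogonal complement for the bilinear form $\langle v_i,v_j\rangle=(-1)^{i+1}\delta_{ij}$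 and $T$ the reversal of the standard basis $v_1,\dots,v_n$, and $\mu$ acts componentwise on products. - The geometric $R$-matrix is the rational map $R=(\Psi_{k,\ell},\ S\circ\Psi_{\ell,k}\circ S):\mathbb X_\ell\times\mathbb X_k\to\mathbb X_k\times\mathbb X_\ell$, where $\Psi_{k,\ell}:\mathbb X_\ell\times\mathbb X_k\to\mathbb X_k$ is $\Psi_{k,\ell}(M|s,N|t)=\pi^k_t(g(M|s)g(N|t))$. **Theorem.** 1. For all $k_1,k_2\in[n-1]$, $R:\mathbb X_{k_1}\times\mathbb X_{k_2}\to\mathbb X_{k_2}\times\mathbb X_{k_1}$ is an isomorphism of geometric crystals. 2. For all $k_1,k_2\in[n-1]$, $R$ commutes with the symmetries: $R\circ PR=PR\circ R$, $R\circ S=S\circ R$ and $R\circ D=D\circ R$ as rational maps on $\mathbb X_{k_1}\times\mathbb X_{k_2}$. 3. $R$ satisfies the Yang–Baxter relation: for all $k_1,k_2,k_3\in[n-1]$, $R_1R_2R_1=R_2R_1R_2$ as rational maps $\mathbb X_{k_1}\times\mathbb X_{k_2}\times\mathbb X_{k_3}\to\mathbb X_{k_3}\times\mathbb X_{k_2}\times\mathbb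 X_{k_1}$, where $R_i$ acts as $R$ on factors $i,i+1$ and as the identity on the remaining factor. -/

import Mathlib

/- Rational maps and geometric crystals on products of Grassmannians and tori. -/

noncomputable section

namespace GeomR

/-! ## Zariski topology and rational maps

A variety is presented as a set of points together with a family of partially defined
`ℂ`-valued affine coordinate functions (on a torus: the usual coordinates; on a Grassmannian: the
ratios of Plücker coordinates; on a product: the coordinates of both factors).
The coordinates determine the Zariski topology and the regular functions. -/

/-- A family of partially defined affine coordinate functions on the set of points `V`. -/
class AlgCoord (V : Type) where
  coord : Set (V →. ℂ)

instance : AlgCoord ℂˣ where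
  coord := {u : ℂˣ →. ℂ | u = fun c : ℂˣ => Part.some (c : ℂ)}

instance (ι : Type) : AlgCoord (ι → ℂˣ) where
  coord := {u | ∃ i : ι, u = fun z => Part.some (z i : ℂ)}

instance {V W : Type} [AlgCoord V] [AlgCoord W] : AlgCoord (V × W) where
  coord := {u | (∃ a ∈ AlgCoord.coord (V := V), u = fun p => a p.1) ∨
    (∃ b ∈ AlgCoord.coord (V := W), u = fun p => b p.2)}

section Rational

variable {V W : Type} [AlgCoord V] [AlgCoord W]

/-- The joint values of finitely many coordinate functions, where all of them are defined. -/
def chart {m : ℕ} (s : Fin m → (AlgCoord.coord (V := V))) : V →. (Fin m → ℂ) :=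
  fun x => ⟨∀ j, ((s j).1 x).Dom, fun h j => ((s j).1 x).get (h j)⟩

/-- The basic open set on which the coordinates `s` are defined and the polynomial `q` in them does
not vanish. -/
def basicOpen {m : ℕ} (s : Fin m → (AlgCoord.coord (V := V))) (q : MvPolynomial (Fin m) ℂ) :
    Set V :=
  {x | ∃ v ∈ chart s x, MvPolynomial.eval v q ≠ 0}

/-- Zariski open sets. -/
def ZOpen (U : Set V) : Prop :=
  ∀ x ∈ U, ∃ (m : ℕ) (s : Fin m → (AlgCoord.coord (V := V))) (q : MvPolynomial (Fin m) ℂ),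
    x ∈ basicOpen s q ∧ basicOpen s q ⊆ U

/-- Zariski dense sets. -/
def ZDense (U : Set V) : Prop :=
  ∀ O : Set V, ZOpen O → O.Nonempty → (U ∩ O).Nonempty

variable (V) in
/-- Irreducibility in the Zariski topology. -/
def ZIrreducible : Prop :=
  Nonempty V ∧ ∀ U : Set V, ZOpen U → U.Nonempty → ZDense U

/-- A partial function to `ℂ` is regular at `x` if on a basic open neighbourhood of `x` it is
defined and equal to a quotient of polynomials in coordinate functions. -/
def RegularAt (f : V →. ℂ) (x : V) : Prop :=
  ∃ (m : ℕ) (s : Fin m → (AlgCoord.coord (V := V))) (p q : MvPolynomial (Fin m) ℂ),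
    x ∈ basicOpen s q ∧
    ∀ y, ∀ v ∈ chart s y, MvPolynomial.eval v q ≠ 0 →
      MvPolynomial.eval v p / MvPolynomial.eval v q ∈ f y

/-- A partial map is regular at `x` if it is defined at `x` and pulls back each coordinate function
defined at the image of `x` to a function that is regular at `x`. -/
def RegularMapAt (f : V →. W) (x : V) : Prop :=
  (f x).Dom ∧ ∀ u ∈ AlgCoord.coord (V := W), ∀ y ∈ f x, (u y).Dom → RegularAt (u.comp f) x

/-- A partial map represents a rational map if it is regular on a dense open set. -/
def IsRationalMap (f : V →. W) : Prop :=
  ∃ U : Set V, ZOpen U ∧ ZDense U ∧ ∀ x ∈ U, RegularMapAt f x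

/-- Equality as rational maps: both partial maps are defined on a common dense open set and agree
there. -/
def RatEq {Z : Type} (f g : V →. Z) : Prop :=
  ∃ U : Set V, ZOpen U ∧ ZDense U ∧ ∀ x ∈ U, ∃ y, y ∈ f x ∧ y ∈ g x

end Rational

/-! ## Geometric crystals of type `A_{n-1}^{(1)}` -/

/-- A complex number as an element of `ℂˣ`, when it is nonzero. -/
def toUnit (a : ℂ) : Part ℂˣ := ⟨a ≠ 0, fun h => Units.mk0 a h⟩

/-- The maps `γ, φ_i, ε_i, e_i` of a geometric crystal; components are labelled by `ℤ/nℤ`. -/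
structure CrystalMaps (n : ℕ) (V : Type) where
  γ : V →. (ZMod n → ℂˣ)
  φ : ZMod n → (V →. ℂˣ)
  ε : ZMod n → (V →. ℂˣ)
  e : ZMod n → (ℂˣ × V →. V)

/-- The simple coroot `α_i^∨(c)`: `c` in component `i`, `c⁻¹` in component `i+1`, `1` elsewhere. -/
def coroot {n : ℕ} (i : ZMod n) (c : ℂˣ) : ZMod n → ℂˣ :=
  Pi.mulSingle i c * Pi.mulSingle (i + 1) c⁻¹

/-- Geometric pre-crystals. All identities are identities of rational maps (of `x`, or of `(c, x)`,
or of `(c, d, x)`). -/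
structure IsGeomPreCrystal {n : ℕ} {V : Type} [AlgCoord V] (C : CrystalMaps n V) : Prop where
  irreducible : ZIrreducible V
  rational_γ : IsRationalMap C.γ
  rational_φ : ∀ i, IsRationalMap (C.φ i)
  rational_ε : ∀ i, IsRationalMap (C.ε i)
  rational_e : ∀ i, IsRationalMap (C.e i)
  e_one : ∀ i, RatEq (fun x : V => C.e i (1, x)) (PFun.id V)
  e_mul : ∀ i, RatEq (fun p : ℂˣ × ℂˣ × V => (C.e i (p.2.1, p.2.2)).bind fun x => C.e i (p.1, x))
    (fun p => C.e i (p.1 * p.2.1, p.2.2))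
  γ_e : ∀ i, RatEq (C.γ.comp (C.e i))
    (fun p : ℂˣ × V => (C.γ p.2).map fun z => coroot i p.1 * z)
  φ_e : ∀ i, RatEq ((C.φ i).comp (C.e i))
    (fun p : ℂˣ × V => (C.φ i p.2).map fun a => p.1⁻¹ * a)
  ε_e : ∀ i, RatEq ((C.ε i).comp (C.e i))
    (fun p : ℂˣ × V => (C.ε i p.2).map fun a => p.1 * a)
  ε_div_φ : ∀ i, RatEq (fun x : V => do
      let a ← C.ε i x
      let b ← C.φ i x
      return a / b)
    (fun x => (C.γ x).map fun z => z i / z (i + 1))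

/-- Geometric crystals: geometric pre-crystals satisfying the geometric Serre relations (which are
void when `n = 2`). -/
structure IsGeomCrystal {n : ℕ} {V : Type} [AlgCoord V] (C : CrystalMaps n V) : Prop
    extends IsGeomPreCrystal C where
  serre_comm : 3 ≤ n → ∀ i j : ZMod n, i ≠ j → i ≠ j + 1 → j ≠ i + 1 →
    RatEq (fun p : ℂˣ × ℂˣ × V => do
        let y ← C.e j (p.2.1, p.2.2)
        C.e i (p.1, y))
      (fun p => do
        let y ← C.e i (p.1, p.2.2)
        C.e j (p.2.1, y))
  serre_braid : 3 ≤ n → ∀ i j : ZMod n, (i = j + 1 ∨ j = i + 1) →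
    RatEq (fun p : ℂˣ × ℂˣ × V => do
        let y ← C.e i (p.2.1, p.2.2)
        let z ← C.e j (p.1 * p.2.1, y)
        C.e i (p.1, z))
      (fun p => do
        let y ← C.e j (p.1, p.2.2)
        let z ← C.e i (p.1 * p.2.1, y)
        C.e j (p.2.1, z))

/-- Morphisms of geometric (pre-)crystals: rational maps commuting with the `e_i` and preserving
`γ, φ_i, ε_i`. -/
structure IsCrystalMorphism {n : ℕ} {V W : Type} [AlgCoord V] [AlgCoord W]
    (C : CrystalMaps n V) (D : CrystalMaps n W) (h : V →. W) : Prop where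
  rational : IsRationalMap h
  γ_comp : RatEq (D.γ.comp h) C.γ
  φ_comp : ∀ i, RatEq ((D.φ i).comp h) (C.φ i)
  ε_comp : ∀ i, RatEq ((D.ε i).comp h) (C.ε i)
  e_comm : ∀ i, RatEq (fun p : ℂˣ × V => (h p.2).bind fun y => D.e i (p.1, y))
    (h.comp (C.e i))

/-- Isomorphisms of geometric crystals: morphisms between geometric crystals that have an inverse
morphism. -/
def IsCrystalIso {n : ℕ} {V W : Type} [AlgCoord V] [AlgCoord W]
    (C : CrystalMaps n V) (D : CrystalMaps n W) (h : V →. W) : Prop :=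
  IsGeomCrystal C ∧ IsGeomCrystal D ∧ IsCrystalMorphism C D h ∧
    ∃ h' : W →. V, IsCrystalMorphism D C h' ∧
      RatEq (h'.comp h) (PFun.id V) ∧ RatEq (h.comp h') (PFun.id W)

/-- The product of geometric (pre-)crystals. -/
def CrystalMaps.prod {n : ℕ} {V W : Type} (C : CrystalMaps n V) (D : CrystalMaps n W) :
    CrystalMaps n (V × W) where
  γ := fun p => do
    let z ← C.γ p.1
    let w ← D.γ p.2
    return z * w
  φ := fun i p => do
    let a ← C.φ i p.1
    let b ← C.ε i p.1
    let a' ← D.φ i p.2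
    let s ← toUnit ((b : ℂ) + a')
    return a * s / b
  ε := fun i p => do
    let b ← C.ε i p.1
    let a' ← D.φ i p.2
    let b' ← D.ε i p.2
    let s ← toUnit ((b : ℂ) + a')
    return b' * s / a'
  e := fun i cp => do
    let c := cp.1
    let b ← C.ε i cp.2.1
    let a' ← D.φ i cp.2.2
    let s ← toUnit ((b : ℂ) + a')
    let s₁ ← toUnit ((c : ℂ) * b + a')
    let s₂ ← toUnit ((b : ℂ) + (c : ℂ)⁻¹ * a')
    let x ← C.e i (s₁ / s, cp.2.1)
    let y ← D.e i (s / s₂, cp.2.2)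
    return (x, y)

/-! ## Grassmannians and Plücker coordinates -/

/-- The Grassmannian of `k`-dimensional subspaces of `ℂⁿ`. -/
def Gr (k n : ℕ) : Type :=
  {N : Submodule ℂ (Fin n → ℂ) // Module.finrank ℂ N = k}

/-- A subspace as a point of `Gr k n`; defined when its dimension is `k`. -/
def Gr.mk? {n : ℕ} (k : ℕ) (N : Submodule ℂ (Fin n → ℂ)) : Part (Gr k n) :=
  ⟨Module.finrank ℂ N = k, fun h => ⟨N, h⟩⟩

/-- An `n × k` matrix whose columns are a basis of the subspace `N`. -/
def Gr.rep {k n : ℕ} (N : Gr k n) : Matrix (Fin n) (Fin k) ℂ :=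
  Matrix.of fun i j => ((Module.finBasisOfFinrankEq ℂ N.1 N.2 j : N.1) : Fin n → ℂ) i

/-- The row (or column) of an `n`-periodic object labelled by the integer `m`: labels are taken
modulo `n`, with residues in `{1, …, n}`, and the label `i ∈ {1, …, n}` is the element `i - 1` of
`Fin n`. -/
def idx (n : ℕ) [NeZero n] (m : ℤ) : Fin n :=
  Fin.ofNat n ((m - 1) % (n : ℤ)).toNat

/-- The Plücker coordinate `P_I(N)` for a set of integers `I`: reduce `I` modulo `n`; if `k` residues
remain, take the maximal minor with these rows in increasing order, otherwise `0`.
It is meaningful up to a common scalar, and only used in ratios of degree `0`. -/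
def pl {k n : ℕ} [NeZero n] (N : Gr k n) (I : Finset ℤ) : ℂ :=
  if h : (I.image (idx n)).card = k then
    (N.rep.submatrix ((I.image (idx n)).orderEmbOfFin h) id).det
  else 0

/-- The affine coordinates of the Grassmannian: the ratios `P_I / P_J`, defined where `P_J ≠ 0`. -/
instance (k n : ℕ) [NeZero n] : AlgCoord (Gr k n) where
  coord := {u | ∃ I J : Finset ℤ, u = fun N => ⟨pl N J ≠ 0, fun _ => pl N I / pl N J⟩}

/-- The subspace `A · N`, defined when it has dimension `k` (for instance if `A` is invertible). -/
def act {k n : ℕ} (A : Matrix (Fin n) (Fin n) ℂ) (N : Gr k n) : Part (Gr k n) :=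
  Gr.mk? k (N.1.map A.mulVecLin)

/-- The variety `𝕏_k = Gr(k, n) × ℂˣ`, with points `N|t`. -/
abbrev XX (n k : ℕ) : Type := Gr k n × ℂˣ

/-! ## The geometric crystal on `𝕏_k` -/

/-- The quotient `a / b` as an element of `ℂˣ`, when `a` and `b` are nonzero. -/
def ratio (a b : ℂ) : Part ℂˣ :=
  ⟨a ≠ 0 ∧ b ≠ 0, fun h => Units.mk0 (a / b) (div_ne_zero h.1 h.2)⟩

/-- `γ_i(N|t)`, for `1 ≤ i ≤ n`. -/
def γEntry {n k : ℕ} [NeZero n] (i : ℤ) (x : XX n k) : Part ℂˣ :=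
  (ratio (pl x.1 (Finset.Icc (i - k + 1) i)) (pl x.1 (Finset.Icc (i - k) (i - 1)))).map
    fun a => (if i ≤ k then 1 else x.2) * a

/-- The representative in `{1, …, n}` of a residue class modulo `n`. -/
def repr1 {n : ℕ} (i : ZMod n) : ℤ := if i = 0 then n else i.val

/-- `φ_i(N|t)`, for a class `i` with representative in `{0, …, n-1}`. -/
def φEntry {n k : ℕ} [NeZero n] (i : ZMod n) (x : XX n k) : Part ℂˣ :=
  let m : ℤ := i.val
  (ratio (pl x.1 (insert (m + 1) (Finset.Icc (m - k + 1) (m - 1))))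
      (pl x.1 (Finset.Icc (m - k + 1) m))).map
    fun a => (if m = 0 then x.2⁻¹ else 1) * a

/-- `ε_i(N|t)`, for a class `i` with representative in `{0, …, n-1}`. -/
def εEntry {n k : ℕ} [NeZero n] (i : ZMod n) (x : XX n k) : Part ℂˣ :=
  let m : ℤ := i.val
  (ratio (pl x.1 (insert (m + 1) (Finset.Icc (m - k + 1) (m - 1))) *
        pl x.1 (Finset.Icc (m - k + 1) m))
      (pl x.1 (Finset.Icc (m - k) (m - 1)) * pl x.1 (Finset.Icc (m - k + 2) (m + 1)))).map
    fun a => (if m = k then x.2⁻¹ else 1) * a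

/-- The matrix `x_i(a) = Id + a E_{i,i+1}`, with `x_0(a) = Id + a E_{n,1}`. -/
def xMat {n : ℕ} [NeZero n] (i : ZMod n) (a : ℂ) : Matrix (Fin n) (Fin n) ℂ :=
  1 + Matrix.single (idx n i.val) (idx n (i.val + 1)) a

/-- The geometric crystal maps on `𝕏_k`. -/
def crystal (n k : ℕ) [NeZero n] : CrystalMaps n (XX n k) where
  γ := fun x => ⟨∀ i, (γEntry (repr1 i) x).Dom, fun h i => (γEntry (repr1 i) x).get (h i)⟩
  φ := φEntry
  ε := εEntry
  e := fun i cx => do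
    let a ← φEntry i cx.2
    let b : ℂ := ((cx.1 : ℂ) - 1) / a
    let N ← act (xMat i (if i = 0 then (-1) ^ (k - 1) / (cx.2.2 : ℂ) * b else b)) cx.2.1
    return (N, cx.2.2)

/-! ## The matrix `g` and the geometric `R`-matrix -/

/-- Folded matrices, with entries polynomials in the loop parameter `λ` (the polynomial variable). -/
abbrev Folded (n : ℕ) : Type := Matrix (Fin n) (Fin n) (Polynomial ℂ)

/-- The matrix `g(N|t)`; defined when all `P_{[j-k,j-1]}(N)` are nonzero. -/
def g {n k : ℕ} [NeZero n] : XX n k →. Folded n := fun x =>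
  ⟨∀ j ∈ Finset.Icc (1 : ℤ) n, pl x.1 (Finset.Icc (j - k) (j - 1)) ≠ 0, fun _ =>
    Matrix.of fun a b =>
      let i : ℤ := (a : ℕ) + 1
      let j : ℤ := (b : ℕ) + 1
      (if j ≤ k then 1 else if j ≤ i then Polynomial.C (x.2 : ℂ) else Polynomial.X) *
        Polynomial.C (pl x.1 (insert i (Finset.Icc (j - k + 1) (j - 1))) /
          pl x.1 (Finset.Icc (j - k) (j - 1)))⟩

/-- `g(x, y) = g(x) g(y)`. -/
def gProd {n l k : ℕ} [NeZero n] : XX n l × XX n k →. Folded n := fun p => do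
  let A ← g p.1
  let B ← g p.2
  return A * B

/-- `π^k_z(A) = N|z`, where `N` is the span of the first `k` columns of `A` evaluated at
`λ = (-1)^{k-1} z`; defined when these columns have full rank. -/
def proj {n : ℕ} (k : ℕ) (z : ℂˣ) (A : Folded n) : Part (XX n k) := do
  let N ← Gr.mk? k (Submodule.span ℂ {v : Fin n → ℂ | ∃ j : Fin n, (j : ℕ) < k ∧
    v = fun i => (A i j).eval ((-1) ^ (k - 1) * (z : ℂ))})
  return (N, z)

/-- Reflection of a matrix over the anti-diagonal. -/
def fl {n : ℕ} (A : Folded n) : Folded n := Matrix.of fun i j => A j.rev i.rev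

/-- The geometric Schützenberger involution on `𝕏_k`. -/
def S {n k : ℕ} [NeZero n] : XX n k →. XX n k := fun x =>
  (g x).bind fun A => proj k x.2 (fl A)

/-- The geometric Schützenberger involution on a product of two factors. -/
def S₂ {n l k : ℕ} [NeZero n] : XX n l × XX n k →. XX n k × XX n l := fun p => do
  let x ← S p.1
  let y ← S p.2
  return (y, x)

/-- `Ψ_{k,ℓ}(M|s, N|t) = π^k_t(g(M|s) g(N|t))`. -/
def Psi {n l k : ℕ} [NeZero n] : XX n l × XX n k →. XX n k := fun p =>
  (gProd p).bind (proj k p.2.2)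

/-- The geometric `R`-matrix `R = (Ψ_{k,ℓ}, S ∘ Ψ_{ℓ,k} ∘ S)`. -/
def R {n l k : ℕ} [NeZero n] : XX n l × XX n k →. XX n k × XX n l :=
  PFun.prodLift Psi (S.comp (Psi.comp S₂))

/-- `R` acting on the first two of three factors. -/
def R₁ {n a b c : ℕ} [NeZero n] :
    XX n a × XX n b × XX n c →. XX n b × XX n a × XX n c := fun p =>
  (R (p.1, p.2.1)).map fun q => (q.1, q.2, p.2.2)

/-- `R` acting on the last two of three factors. -/
def R₂ {n a b c : ℕ} [NeZero n] :
    XX n a × XX n b × XX n c →. XX n a × XX n c × XX n b := fun p =>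
  (R p.2).map fun q => (p.1, q)

/-! ## The symmetries `PR` and `D` -/

/-- The cyclic shift `PR` on `𝕏_k`: shift the rows down by one, and multiply the new first row by
`(-1)^{k-1} t`. -/
def PR {n k : ℕ} [NeZero n] : XX n k →. XX n k := fun x =>
  (act (Matrix.of fun i j => if j = i - 1 then
      (if i = 0 then (-1) ^ (k - 1) * (x.2 : ℂ) else 1) else 0) x.1).map fun N => (N, x.2)

/-- The cyclic shift on a product of two factors. -/
def PR₂ {n l k : ℕ} [NeZero n] : XX n l × XX n k →. XX n l × XX n k := PFun.prodMap PR PR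

/-- The duality `μ(N|t) = T_{w₀}(N^⊥)|t` from `𝕏_k` to `𝕏_{n-k}`: `N^⊥` is the orthogonal complement
for the form `⟨v_i, v_j⟩ = (-1)^{i+1} δ_{ij}`, and `T_{w₀}` reverses the standard basis. -/
def dual {n k : ℕ} : XX n k →. XX n (n - k) := fun x =>
  (Gr.mk? (n - k) (((Matrix.toBilin' (Matrix.diagonal fun i : Fin n =>
      (-1 : ℂ) ^ (i : ℕ))).orthogonal x.1.1).map (LinearMap.funLeft ℂ ℂ Fin.rev))).map
    fun N => (N, x.2)

/-- The duality map `D = S ∘ μ` on a product of two factors. -/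
def D₂ {n l k : ℕ} [NeZero n] : XX n l × XX n k →. XX n (n - k) × XX n (n - l) :=
  S₂.comp (PFun.prodMap dual dual)

end GeomR

end

open GeomR

/-! For a point `x = N|t` put `spec x = (-1)^(k-1) t`. Unfolded to an `n`-periodic matrix indexed by
integers, `g(x)` is lower triangular of bandwidth `n - k` with ones on its last diagonal
(`gMat_isMonicBand`), and at loop parameter `spec x` its columns span `N` (`range_gMat`), for
generic `N`. Conversely, these two properties determine `g(x)` (`gMat_eq_of_col_mem`). The dual
point yields a band matrix of width `k` whose product with `g(x)` is the scalar `λ - spec x`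
(`cofactor_mul`), so `g(x)` is invertible at every other value of the loop parameter.

It follows that, generically, `g(x) g(y) = g(y') g(x')` has exactly one solution in which `y'` and
`x'` carry the torus parameters of `y` and `x`. At `spec y` the left side has image `Ψ(x, y)`, which
forces `y'`; multiplying by the cofactor of `y'` and dividing by the central factor leaves a band
matrix of the width required of `g(x')` (`exists_refactor`). Reflection `fl` corresponds to `S` on
points and reverses products, so the second component of `R` is `x'` (`Refactor.psiS_eq`). Thus `R`
is refactorization (`Refactor.R_eq`), visibly an involution.

Symmetries. On matrices `PR` is conjugation by the cyclic shift, `S` is `fl`, and the duality is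
passage to the cofactor up to a sign twist and `fl`. Each preserves or reverses products, so it
carries refactorizations to refactorizations (`Refactor.pr`, `Refactor.schutz`, `Refactor.dual`).

Crystal structure. The functions `γ, φ, ε` are ratios of entries on the top two diagonals of `g(x)`,
and `e_i^c` multiplies `g(x)` on both sides by loop unipotents whose parameters come from the same
diagonals. The product rules give the same formulas for the matrix `g(x) g(y)` (`φ_prod_eq`,
`ε_prod_eq`, `eP_spec`). Since `R` preserves this matrix, it is a morphism. The axioms for `e_i` on
products reduce to relations between the left unipotent factors: right factors do not change ranges,
and the ranges determine the pair of points (`eq_of_range_gm`).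

Yang–Baxter. Both sides factor `g(x) g(y) g(z)` with the parameters in reverse order, and such a
factorization is unique (`eq_of_mul_eq`).

All identities are between rational maps. The spaces are irreducible because two points are always
joined by a rational curve (`RatConnected.zIrreducible`), so it suffices to verify each identity
under an open condition that holds somewhere (`ratEq_of`). -/

noncomputable section
namespace GeomR
open Filter
set_option linter.unusedSectionVars false
-- Zariski neighbourhoods, regular functions and regular maps.
section Zariski

variable {V W Z : Type} [AlgCoord V] [AlgCoord W] [AlgCoord Z]

theorem mem_chart {m : ℕ} {s : Fin m → (AlgCoord.coord (V := V))} {x : V} {v : Fin m → ℂ} :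
    v ∈ chart s x ↔ ∀ j, v j ∈ (s j).1 x := by
  constructor
  · rintro ⟨h, rfl⟩ j
    exact Part.get_mem (h j)
  · intro h
    exact ⟨fun j => (h j).1, funext fun j => (h j).2⟩

theorem chart_append {m₁ m₂ : ℕ} {s₁ : Fin m₁ → (AlgCoord.coord (V := V))}
    {s₂ : Fin m₂ → (AlgCoord.coord (V := V))} {x : V} {v : Fin (m₁ + m₂) → ℂ} :
    v ∈ chart (Fin.append s₁ s₂) x ↔
      (v ∘ Fin.castAdd m₂) ∈ chart s₁ x ∧ (v ∘ Fin.natAdd m₁) ∈ chart s₂ x := by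
  simp only [mem_chart]
  constructor
  · intro h
    refine ⟨fun j => ?_, fun j => ?_⟩
    · simpa using h (Fin.castAdd m₂ j)
    · simpa using h (Fin.natAdd m₁ j)
  · rintro ⟨h₁, h₂⟩ j
    refine Fin.addCases (fun i => ?_) (fun i => ?_) j
    · simpa using h₁ i
    · simpa using h₂ i

theorem mem_basicOpen {m : ℕ} {s : Fin m → (AlgCoord.coord (V := V))}
    {q : MvPolynomial (Fin m) ℂ} {x : V} :
    x ∈ basicOpen s q ↔ ∃ v ∈ chart s x, MvPolynomial.eval v q ≠ 0 := Iff.rfl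

theorem zOpen_basicOpen {m : ℕ} (s : Fin m → (AlgCoord.coord (V := V)))
    (q : MvPolynomial (Fin m) ℂ) : ZOpen (basicOpen s q) :=
  fun _ hx => ⟨m, s, q, hx, subset_rfl⟩

/-- Arguments that involve two regular functions take place on the concatenated list of coordinates,
where the two domains are intersected. -/
theorem basicOpen_append {m₁ m₂ : ℕ} {s₁ : Fin m₁ → (AlgCoord.coord (V := V))}
    {s₂ : Fin m₂ → (AlgCoord.coord (V := V))} {q₁ : MvPolynomial (Fin m₁) ℂ}
    {q₂ : MvPolynomial (Fin m₂) ℂ} :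
    basicOpen (Fin.append s₁ s₂) (MvPolynomial.rename (Fin.castAdd m₂) q₁ *
      MvPolynomial.rename (Fin.natAdd m₁) q₂) = basicOpen s₁ q₁ ∩ basicOpen s₂ q₂ := by
  ext x
  simp only [mem_basicOpen, Set.mem_inter_iff, map_mul, MvPolynomial.eval_rename, mul_ne_zero_iff]
  constructor
  · rintro ⟨v, hv, h₁, h₂⟩
    obtain ⟨hv₁, hv₂⟩ := chart_append.1 hv
    exact ⟨⟨_, hv₁, h₁⟩, ⟨_, hv₂, h₂⟩⟩
  · rintro ⟨⟨v₁, hv₁, h₁⟩, ⟨v₂, hv₂, h₂⟩⟩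
    have e₁ : Fin.append v₁ v₂ ∘ Fin.castAdd m₂ = v₁ := by ext; simp
    have e₂ : Fin.append v₁ v₂ ∘ Fin.natAdd m₁ = v₂ := by ext; simp
    refine ⟨Fin.append v₁ v₂, chart_append.2 ?_, ?_, ?_⟩
    · rw [e₁, e₂]; exact ⟨hv₁, hv₂⟩
    · rwa [e₁]
    · rwa [e₂]

theorem zOpen_univ : ZOpen (Set.univ : Set V) := fun x _ =>
  ⟨0, Fin.elim0, 1, ⟨Fin.elim0, mem_chart.2 fun j => j.elim0, by simp⟩, Set.subset_univ _⟩

theorem ZOpen.inter {U U' : Set V} (h : ZOpen U) (h' : ZOpen U') : ZOpen (U ∩ U') := by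
  rintro x ⟨hx, hx'⟩
  obtain ⟨m, s, q, h₁, h₂⟩ := h x hx
  obtain ⟨m', s', q', h₁', h₂'⟩ := h' x hx'
  refine ⟨_, Fin.append s s', MvPolynomial.rename (Fin.castAdd m') q *
      MvPolynomial.rename (Fin.natAdd m) q', ?_, ?_⟩
  · rw [basicOpen_append]
    exact ⟨h₁, h₁'⟩
  · rw [basicOpen_append]
    exact Set.inter_subset_inter h₂ h₂'

/-- The filter of Zariski neighbourhoods of a point. -/
def zNhds (x : V) : Filter V where
  sets := {U | ∃ O, ZOpen O ∧ x ∈ O ∧ O ⊆ U}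
  univ_sets := ⟨_, zOpen_univ, trivial, subset_rfl⟩
  sets_of_superset := fun ⟨O, h, hx, hO⟩ h' => ⟨O, h, hx, hO.trans h'⟩
  inter_sets := fun ⟨O, h, hx, hO⟩ ⟨O', h', hx', hO'⟩ =>
    ⟨O ∩ O', h.inter h', ⟨hx, hx'⟩, Set.inter_subset_inter hO hO'⟩

theorem eventually_zNhds {x : V} {P : V → Prop} :
    (∀ᶠ y in zNhds x, P y) ↔ ∃ O, ZOpen O ∧ x ∈ O ∧ ∀ y ∈ O, P y := Iff.rfl

theorem ZOpen.mem_zNhds {U : Set V} (h : ZOpen U) {x : V} (hx : x ∈ U) : U ∈ zNhds x :=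
  ⟨U, h, hx, subset_rfl⟩

theorem self_of_zNhds {x : V} {P : V → Prop} (h : ∀ᶠ y in zNhds x, P y) : P x := by
  obtain ⟨O, _, hx, hO⟩ := h
  exact hO hx

theorem zOpen_iff {U : Set V} : ZOpen U ↔ ∀ x ∈ U, U ∈ zNhds x := by
  refine ⟨fun h x hx => h.mem_zNhds hx, fun h x hx => ?_⟩
  obtain ⟨O, hO, hxO, hOU⟩ := h x hx
  obtain ⟨m, s, q, h₁, h₂⟩ := hO x hxO
  exact ⟨m, s, q, h₁, h₂.trans hOU⟩

/-- A complex-valued function that is a quotient of polynomials in coordinates near `x`. -/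
def Reg (F : V → ℂ) (x : V) : Prop :=
  ∃ (m : ℕ) (s : Fin m → (AlgCoord.coord (V := V))) (p q : MvPolynomial (Fin m) ℂ),
    x ∈ basicOpen s q ∧
    ∀ y, ∀ v ∈ chart s y, MvPolynomial.eval v q ≠ 0 →
      F y = MvPolynomial.eval v p / MvPolynomial.eval v q

theorem Reg.congr {F F' : V → ℂ} {x : V} (h : Reg F x) (h' : ∀ᶠ y in zNhds x, F y = F' y) :
    Reg F' x := by
  obtain ⟨m, s, p, q, hx, hF⟩ := h
  obtain ⟨O, hO, hxO, hOF⟩ := h'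
  obtain ⟨m', s', q', h₁, h₂⟩ := hO x hxO
  -- The common factor `q'` shrinks the domain to an open set on which the two functions agree.
  refine ⟨_, Fin.append s s', MvPolynomial.rename (Fin.castAdd m') p *
      MvPolynomial.rename (Fin.natAdd m) q', MvPolynomial.rename (Fin.castAdd m') q *
      MvPolynomial.rename (Fin.natAdd m) q', ?_, fun y v hv hq => ?_⟩
  · rw [basicOpen_append]; exact ⟨hx, h₁⟩
  · obtain ⟨hv₁, hv₂⟩ := chart_append.1 hv
    simp only [map_mul, MvPolynomial.eval_rename, mul_ne_zero_iff] at hq ⊢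
    rw [← hOF (h₂ ⟨_, hv₂, hq.2⟩), hF y _ hv₁ hq.1, mul_div_mul_right _ _ hq.2]

theorem reg_const (c : ℂ) (x : V) : Reg (fun _ => c) x :=
  ⟨0, Fin.elim0, MvPolynomial.C c, 1, ⟨Fin.elim0, mem_chart.2 fun j => j.elim0, by simp⟩,
    by simp⟩

theorem reg_coord {F : V → ℂ} {x : V} (u : V →. ℂ) (hu : u ∈ AlgCoord.coord (V := V))
    (hx : (u x).Dom) (hF : ∀ y, ∀ z ∈ u y, F y = z) : Reg F x := by
  refine ⟨1, fun _ => ⟨u, hu⟩, MvPolynomial.X 0, 1, ⟨fun _ => (u x).get hx, mem_chart.2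
    fun _ => Part.get_mem hx, by simp⟩, fun y v hv _ => ?_⟩
  simpa using hF y _ (mem_chart.1 hv 0)

theorem Reg.eventually_ne {F : V → ℂ} {x : V} (h : Reg F x) (hx : F x ≠ 0) :
    ∀ᶠ y in zNhds x, F y ≠ 0 := by
  obtain ⟨m, s, p, q, ⟨v, hv, hq⟩, hF⟩ := h
  refine ⟨basicOpen s (q * p), zOpen_basicOpen _ _, ⟨v, hv, ?_⟩, ?_⟩
  · have := hF x v hv hq
    rw [map_mul]
    refine mul_ne_zero hq fun h0 => hx ?_
    rw [this, h0, zero_div]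
  · rintro y ⟨w, hw, hqp⟩
    rw [map_mul, mul_ne_zero_iff] at hqp
    change F y ≠ 0
    rw [hF y w hw hqp.1]
    exact div_ne_zero hqp.2 hqp.1

theorem Reg.inv {F : V → ℂ} {x : V} (h : Reg F x) (hx : F x ≠ 0) : Reg (fun y => (F y)⁻¹) x := by
  obtain ⟨m, s, p, q, ⟨v, hv, hq⟩, hF⟩ := h
  -- The inverse of `p / q` is written `q² / (q p)`, so that a nonzero denominator also makes the
  -- expression `p / q` valid.
  refine ⟨m, s, q * q, q * p, ⟨v, hv, ?_⟩, fun y w hw hqp => ?_⟩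
  · have := hF x v hv hq
    rw [map_mul]
    refine mul_ne_zero hq fun h0 => hx ?_
    rw [this, h0, zero_div]
  · rw [map_mul, mul_ne_zero_iff] at hqp
    beta_reduce
    rw [hF y w hw hqp.1, map_mul, map_mul, mul_div_mul_left _ _ hqp.1, inv_div]

theorem Reg.add {F G : V → ℂ} {x : V} (hF : Reg F x) (hG : Reg G x) :
    Reg (fun y => F y + G y) x := by
  obtain ⟨m, s, p, q, hx, hF⟩ := hF
  obtain ⟨m', s', p', q', hx', hG⟩ := hG
  refine ⟨_, Fin.append s s', MvPolynomial.rename (Fin.castAdd m') p *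
      MvPolynomial.rename (Fin.natAdd m) q' + MvPolynomial.rename (Fin.castAdd m') q *
      MvPolynomial.rename (Fin.natAdd m) p', MvPolynomial.rename (Fin.castAdd m') q *
      MvPolynomial.rename (Fin.natAdd m) q', ?_, fun y v hv hq => ?_⟩
  · rw [basicOpen_append]; exact ⟨hx, hx'⟩
  · obtain ⟨hv₁, hv₂⟩ := chart_append.1 hv
    simp only [map_add, map_mul, MvPolynomial.eval_rename, mul_ne_zero_iff] at hq ⊢
    rw [hF y _ hv₁ hq.1, hG y _ hv₂ hq.2, div_add_div _ _ hq.1 hq.2]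

theorem Reg.mul {F G : V → ℂ} {x : V} (hF : Reg F x) (hG : Reg G x) :
    Reg (fun y => F y * G y) x := by
  obtain ⟨m, s, p, q, hx, hF⟩ := hF
  obtain ⟨m', s', p', q', hx', hG⟩ := hG
  refine ⟨_, Fin.append s s', MvPolynomial.rename (Fin.castAdd m') p *
      MvPolynomial.rename (Fin.natAdd m) p', MvPolynomial.rename (Fin.castAdd m') q *
      MvPolynomial.rename (Fin.natAdd m) q', ?_, fun y v hv hq => ?_⟩
  · rw [basicOpen_append]; exact ⟨hx, hx'⟩
  · obtain ⟨hv₁, hv₂⟩ := chart_append.1 hv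
    simp only [map_mul, MvPolynomial.eval_rename, mul_ne_zero_iff] at hq ⊢
    rw [hF y _ hv₁ hq.1, hG y _ hv₂ hq.2, div_mul_div_comm]

theorem Reg.div {F G : V → ℂ} {x : V} (hF : Reg F x) (hG : Reg G x) (h : G x ≠ 0) :
    Reg (fun y => F y / G y) x := by
  simpa only [div_eq_mul_inv] using hF.mul (hG.inv h)

theorem Reg.sub {F G : V → ℂ} {x : V} (hF : Reg F x) (hG : Reg G x) :
    Reg (fun y => F y - G y) x := by
  simpa only [sub_eq_add_neg, neg_one_mul] using hF.add ((reg_const (-1) x).mul hG)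

theorem Reg.sum {ι : Type*} (s : Finset ι) {F : ι → V → ℂ} {x : V} (h : ∀ i ∈ s, Reg (F i) x) :
    Reg (fun y => ∑ i ∈ s, F i y) x := by
  classical
  induction s using Finset.induction_on with
  | empty => simpa using reg_const 0 x
  | insert a s ha ih =>
    simp only [Finset.sum_insert ha]
    exact (h a (by simp)).add (ih fun i hi => h i (by simp [hi]))

theorem Reg.prod {ι : Type*} (s : Finset ι) {F : ι → V → ℂ} {x : V} (h : ∀ i ∈ s, Reg (F i) x) :
    Reg (fun y => ∏ i ∈ s, F i y) x := by
  classical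
  induction s using Finset.induction_on with
  | empty => simpa using reg_const 1 x
  | insert a s ha ih =>
    simp only [Finset.prod_insert ha]
    exact (h a (by simp)).mul (ih fun i hi => h i (by simp [hi]))

theorem Reg.det {m : ℕ} {B : V → Matrix (Fin m) (Fin m) ℂ} {x : V}
    (h : ∀ i j, Reg (fun y => B y i j) x) : Reg (fun y => (B y).det) x := by
  simp only [Matrix.det_apply, Units.smul_def, zsmul_eq_mul]
  exact Reg.sum _ fun σ _ => (reg_const _ x).mul (Reg.prod _ fun i _ => h _ _)

theorem Reg.mvPolynomial {m : ℕ} {H : Fin m → V → ℂ} {x : V} (h : ∀ j, Reg (H j) x)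
    (p : MvPolynomial (Fin m) ℂ) : Reg (fun y => MvPolynomial.eval (fun j => H j y) p) x := by
  induction p using MvPolynomial.induction_on with
  | C a => simpa using reg_const a x
  | add p q hp hq => simpa using hp.add hq
  | mul_X p i hp => simpa using hp.mul (h i)

/-- A map that pulls coordinates defined near the image of `x` back to regular functions. -/
def RegMap (F : V → W) (x : V) : Prop :=
  ∀ u ∈ AlgCoord.coord (V := W), (u (F x)).Dom →
    ∃ H : V → ℂ, Reg H x ∧ ∀ᶠ y in zNhds x, H y ∈ u (F y)

theorem RegMap.exists_reg_chart {F : V → W} {x : V} (h : RegMap F x) {m : ℕ}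
    {s : Fin m → (AlgCoord.coord (V := W))} {v : Fin m → ℂ} (hv : v ∈ chart s (F x)) :
    ∃ H : Fin m → V → ℂ, (∀ j, Reg (H j) x) ∧ (fun j => H j x) = v ∧
      ∀ᶠ y in zNhds x, (fun j => H j y) ∈ chart s (F y) := by
  rw [mem_chart] at hv
  choose H hH hH' using fun j => h (s j).1 (s j).2 (Part.dom_iff_mem.2 ⟨_, hv j⟩)
  refine ⟨H, hH, funext fun j => Part.mem_unique (self_of_zNhds (P := fun y => H j y ∈ (s j).1 (F y)) (hH' j)) (hv j), ?_⟩
  filter_upwards [eventually_all.2 hH'] with y hy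
  exact mem_chart.2 hy

theorem RegMap.tendsto {F : V → W} {x : V} (h : RegMap F x) :
    Tendsto F (zNhds x) (zNhds (F x)) := by
  rintro U ⟨O, hO, hx, hOU⟩
  obtain ⟨m, s, q, ⟨v, hv, hq⟩, h₂⟩ := hO _ hx
  obtain ⟨H, hH, rfl, hc⟩ := h.exists_reg_chart hv
  have : ∀ᶠ y in zNhds x, F y ∈ U := by
    filter_upwards [hc, (Reg.mvPolynomial hH q).eventually_ne hq] with y h1 h2
    exact hOU (h₂ ⟨_, h1, h2⟩)
  exact this

theorem Reg.comp {G : W → ℂ} {F : V → W} {x : V} (hG : Reg G (F x)) (hF : RegMap F x) :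
    Reg (fun y => G (F y)) x := by
  obtain ⟨m, s, p, q, ⟨v, hv, hq⟩, hG⟩ := hG
  obtain ⟨H, hH, rfl, hc⟩ := hF.exists_reg_chart hv
  refine ((Reg.mvPolynomial hH p).div (Reg.mvPolynomial hH q) hq).congr ?_
  filter_upwards [hc, (Reg.mvPolynomial hH q).eventually_ne hq] with y h1 h2
  exact (hG _ _ h1 h2).symm

theorem RegMap.comp {G : W → Z} {F : V → W} {x : V} (hG : RegMap G (F x)) (hF : RegMap F x) :
    RegMap (fun y => G (F y)) x := by
  intro u hu hx
  obtain ⟨H, hH, hH'⟩ := hG u hu hx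
  exact ⟨fun y => H (F y), hH.comp hF, hF.tendsto.eventually hH'⟩

theorem regMap_id (x : V) : RegMap (fun y : V => y) x := by
  classical
  intro u hu hx
  refine ⟨fun y => if h : (u y).Dom then (u y).get h else 0, ?_, ?_⟩
  · refine reg_coord u hu hx fun y z hz => ?_
    rw [dif_pos (Part.dom_iff_mem.2 ⟨z, hz⟩)]
    exact Part.get_eq_of_mem hz _
  · have : basicOpen (V := V) (fun _ : Fin 1 => ⟨u, hu⟩) 1 ∈ zNhds x :=
      (zOpen_basicOpen _ _).mem_zNhds
        ⟨fun _ => (u x).get hx, mem_chart.2 fun _ => Part.get_mem hx, by simp⟩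
    filter_upwards [this] with y hy
    obtain ⟨v, hv, -⟩ := hy
    have hd : (u y).Dom := Part.dom_iff_mem.2 ⟨_, mem_chart.1 hv 0⟩
    rw [dif_pos hd]
    exact Part.get_mem hd

theorem RegMap.prodMk {F : V → W} {G : V → Z} {x : V} (hF : RegMap F x) (hG : RegMap G x) :
    RegMap (fun y => (F y, G y)) x := by
  rintro u (⟨a, ha, rfl⟩ | ⟨b, hb, rfl⟩) hx
  · exact hF a ha hx
  · exact hG b hb hx

theorem regMap_fst (x : V × W) : RegMap (fun y : V × W => y.1) x := fun u hu hx =>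
  regMap_id x (fun p => u p.1) (Or.inl ⟨u, hu, rfl⟩) hx

theorem regMap_snd (x : V × W) : RegMap (fun y : V × W => y.2) x := fun u hu hx =>
  regMap_id x (fun p => u p.2) (Or.inr ⟨u, hu, rfl⟩) hx

theorem RegMap.fst {F : V → W × Z} {x : V} (h : RegMap F x) : RegMap (fun y => (F y).1) x :=
  (regMap_fst (F x)).comp h

theorem RegMap.snd {F : V → W × Z} {x : V} (h : RegMap F x) : RegMap (fun y => (F y).2) x :=
  (regMap_snd (F x)).comp h

theorem reg_unit (x : ℂˣ) : Reg (fun c : ℂˣ => (c : ℂ)) x :=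
  reg_coord (fun c : ℂˣ => Part.some (c : ℂ)) rfl trivial fun _ _ hz => (Part.mem_some_iff.1 hz).symm

theorem RegMap.unit {F : V → ℂˣ} {x : V} (h : RegMap F x) : Reg (fun y => (F y : ℂ)) x :=
  (reg_unit (F x)).comp h

theorem regMap_unit {F : V → ℂˣ} {x : V} (h : Reg (fun y => (F y : ℂ)) x) : RegMap F x := by
  rintro u rfl _
  exact ⟨_, h, Eventually.of_forall fun y => Part.mem_some _⟩

theorem regMap_pi {ι : Type} {F : V → ι → ℂˣ} {x : V} (h : ∀ i, Reg (fun y => (F y i : ℂ)) x) :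
    RegMap F x := by
  rintro u ⟨i, rfl⟩ _
  exact ⟨_, h i, Eventually.of_forall fun y => Part.mem_some _⟩

/-- Passage from total maps, for which regular functions can be added and composed freely, back to
partial maps: only the values near `x` matter. -/
theorem RegMap.regularMapAt {F : V → W} {f : V →. W} {x : V} (h : RegMap F x)
    (hf : ∀ᶠ y in zNhds x, f y = Part.some (F y)) : RegularMapAt f x := by
  refine ⟨by rw [self_of_zNhds hf]; trivial, fun u hu y hy hd => ?_⟩
  rw [self_of_zNhds hf, Part.mem_some_iff] at hy
  subst hy
  obtain ⟨H, ⟨m, s, p, q, hx, hH⟩, hH'⟩ := h u hu hd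
  obtain ⟨O, hO, hxO, hO'⟩ := eventually_zNhds.1 (hf.and hH')
  obtain ⟨m', s', q', h₁, h₂⟩ := hO x hxO
  refine ⟨_, Fin.append s s', MvPolynomial.rename (Fin.castAdd m') p *
      MvPolynomial.rename (Fin.natAdd m) q', MvPolynomial.rename (Fin.castAdd m') q *
      MvPolynomial.rename (Fin.natAdd m) q', ?_, fun y v hv hq => ?_⟩
  · rw [basicOpen_append]; exact ⟨hx, h₁⟩
  · obtain ⟨hv₁, hv₂⟩ := chart_append.1 hv
    simp only [map_mul, MvPolynomial.eval_rename, mul_ne_zero_iff] at hq ⊢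
    obtain ⟨h3, h4⟩ := hO' y (h₂ ⟨_, hv₂, hq.2⟩)
    rw [mul_div_mul_right _ _ hq.2, ← hH y _ hv₁ hq.1]
    rw [PFun.comp_apply, h3]
    exact Part.mem_bind_iff.2 ⟨_, Part.mem_some _, h4⟩

/-- Predicates that cut out Zariski open sets. -/
def ZOpenPred (P : V → Prop) : Prop := ∀ x, P x → ∀ᶠ y in zNhds x, P y

theorem ZOpenPred.zOpen {P : V → Prop} (h : ZOpenPred P) : ZOpen {x | P x} :=
  zOpen_iff.2 fun x hx => h x hx

theorem ZOpenPred.and {P Q : V → Prop} (hP : ZOpenPred P) (hQ : ∀ x, P x → Q x →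
    ∀ᶠ y in zNhds x, Q y) : ZOpenPred fun x => P x ∧ Q x :=
  fun x hx => (hP x hx.1).and (hQ x hx.1 hx.2)

theorem ZOpenPred.comp {P : W → Prop} (hP : ZOpenPred P) {F : V → W} {x : V} (hF : RegMap F x)
    (h : P (F x)) : ∀ᶠ y in zNhds x, P (F y) := hF.tendsto.eventually (hP _ h)

theorem isRationalMap_of (hV : ZIrreducible V) {f : V →. W} (F : V → W) (P : V → Prop)
    (hP : ZOpenPred P) (hne : ∃ x, P x) (hF : ∀ x, P x → RegMap F x)
    (hf : ∀ x, P x → f x = Part.some (F x)) : IsRationalMap f :=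
  ⟨{x | P x}, hP.zOpen, hV.2 _ hP.zOpen hne, fun x hx => (hF x hx).regularMapAt
    ((hP x hx).mono hf)⟩

/-- Irreducibility makes a nonempty open set dense, so an identity of rational maps reduces to
pointwise equality under an open condition together with one point where that condition holds. -/
theorem ratEq_of (hV : ZIrreducible V) {T : Type} {f g : V →. T} (P : V → Prop)
    (hP : ZOpenPred P) (hne : ∃ x, P x) (h : ∀ x, P x → ∃ y, f x = Part.some y ∧ g x = Part.some y) :
    RatEq f g :=
  ⟨{x | P x}, hP.zOpen, hV.2 _ hP.zOpen hne, fun x hx => by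
    obtain ⟨y, h1, h2⟩ := h x hx
    exact ⟨y, by rw [h1]; exact Part.mem_some _, by rw [h2]; exact Part.mem_some _⟩⟩

theorem ZIrreducible.exists_and (hV : ZIrreducible V) {P Q : V → Prop} (hP : ZOpenPred P)
    (hQ : ZOpenPred Q) (h1 : ∃ x, P x) (h2 : ∃ x, Q x) : ∃ x, P x ∧ Q x :=
  hV.2 _ hP.zOpen h1 _ hQ.zOpen h2

theorem ZOpenPred.forall {ι : Type*} [Finite ι] {P : ι → V → Prop} (hP : ∀ i, ZOpenPred (P i)) :
    ZOpenPred fun x => ∀ i, P i x :=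
  fun x hx => eventually_all.2 fun i => hP i x (hx i)

theorem ZIrreducible.exists_forall (hV : ZIrreducible V) {ι : Type*} [Finite ι] {P : ι → V → Prop}
    (hP : ∀ i, ZOpenPred (P i)) (h : ∀ i, ∃ x, P i x) : ∃ x, ∀ i, P i x := by
  classical
  cases nonempty_fintype ι
  suffices H : ∀ s : Finset ι, ∃ x, ∀ i ∈ s, P i x by
    obtain ⟨x, hx⟩ := H Finset.univ
    exact ⟨x, fun i => hx i (Finset.mem_univ i)⟩
  intro s
  induction s using Finset.induction_on with
  | empty => obtain ⟨x⟩ := hV.1; exact ⟨x, by simp⟩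
  | insert a s ha ih =>
    obtain ⟨x, h1, h2⟩ := hV.exists_and (Q := fun x => ∀ i ∈ s, P i x) (hP a)
      (fun x hx => (Finset.eventually_all s).2 fun i hi => hP i x (hx i hi)) (h a) ih
    exact ⟨x, by simpa using ⟨h1, h2⟩⟩

end Zariski

/-! ### Irreducibility by means of rational curves. -/

section Irreducible

/-- The affine line. -/
instance : AlgCoord ℂ where
  coord := {fun c : ℂ => Part.some c}

theorem reg_line (x : ℂ) : Reg (fun c : ℂ => c) x :=
  reg_coord (fun c : ℂ => Part.some c) rfl trivial fun _ _ hz => (Part.mem_some_iff.1 hz).symm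

/-- The line has a single coordinate function, so every polynomial in a list of coordinates
collapses to a polynomial in one variable. -/
theorem exists_polynomial_of_zNhds {x : ℂ} {U : Set ℂ} (h : U ∈ zNhds x) :
    ∃ r : Polynomial ℂ, r ≠ 0 ∧ ∀ c, r.eval c ≠ 0 → c ∈ U := by
  obtain ⟨O, hO, hx, hOU⟩ := h
  obtain ⟨m, s, q, h₁, h₂⟩ := hO x hx
  have hs : ∀ c, chart s c = Part.some fun _ => c := by
    intro c
    refine Part.eq_some_iff.2 (mem_chart.2 fun j => ?_)
    have : (s j).1 = fun c : ℂ => Part.some c := (s j).2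
    rw [this]
    exact Part.mem_some _
  have hr : ∀ (q : MvPolynomial (Fin m) ℂ) (c : ℂ),
      (MvPolynomial.aeval (fun _ => Polynomial.X) q : Polynomial ℂ).eval c =
      MvPolynomial.eval (fun _ => c) q := by
    intro q c
    induction q using MvPolynomial.induction_on with
    | C a => simp
    | add p q hp hq => simp_all
    | mul_X p i hp => simp_all
  have key : ∀ c, c ∈ basicOpen s q ↔
      (MvPolynomial.aeval (fun _ => Polynomial.X) q : Polynomial ℂ).eval c ≠ 0 := by
    intro c
    rw [mem_basicOpen, hs, hr]
    simp
  exact ⟨_, fun h0 => (key x).1 h₁ (by rw [h0]; simp), fun c hc => hOU (h₂ ((key c).2 hc))⟩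

variable {V W : Type} [AlgCoord V] [AlgCoord W]

variable (V) in
/-- Any two points are joined by a rational curve. -/
def RatConnected : Prop :=
  Nonempty V ∧ ∀ x y : V, ∃ F : ℂ → V, F 0 = x ∧ F 1 = y ∧ RegMap F 0 ∧ RegMap F 1

/-- Along a curve from a point of one open set to a point of the other, each set is left for only
finitely many parameters, hence some parameter lands in both. -/
theorem RatConnected.zIrreducible (h : RatConnected V) : ZIrreducible V := by
  refine ⟨h.1, ?_⟩
  rintro U hU ⟨x, hx⟩ O hO ⟨y, hy⟩
  obtain ⟨F, rfl, rfl, h0, h1⟩ := h.2 x y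
  obtain ⟨r, hr, hr'⟩ := exists_polynomial_of_zNhds (h0.tendsto (hU.mem_zNhds hx))
  obtain ⟨r₂, hr₂, hr₂'⟩ := exists_polynomial_of_zNhds (h1.tendsto (hO.mem_zNhds hy))
  obtain ⟨c, hc⟩ : ∃ c, (r * r₂).eval c ≠ 0 := by
    by_contra! hc
    exact mul_ne_zero hr hr₂ (Polynomial.funext fun c => by simpa using hc c)
  rw [Polynomial.eval_mul, mul_ne_zero_iff] at hc
  exact ⟨F c, hr' c hc.1, hr₂' c hc.2⟩

theorem RatConnected.prod (h : RatConnected V) (h' : RatConnected W) : RatConnected (V × W) := by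
  refine ⟨⟨(h.1.some, h'.1.some)⟩, ?_⟩
  rintro ⟨x, x'⟩ ⟨y, y'⟩
  obtain ⟨F, rfl, rfl, h0, h1⟩ := h.2 x y
  obtain ⟨F', rfl, rfl, h0', h1'⟩ := h'.2 x' y'
  exact ⟨fun c => (F c, F' c), rfl, rfl, h0.prodMk h0', h1.prodMk h1'⟩

theorem ratConnected_units : RatConnected ℂˣ := by
  refine ⟨⟨1⟩, fun x y => ?_⟩
  let L : ℂ → ℂ := fun c => (1 - c) * x + c * y
  have hL : ∀ c, Reg L c := fun c =>
    (((reg_const 1 c).sub (reg_line c)).mul (reg_const _ c)).add ((reg_line c).mul (reg_const _ c))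
  -- The segment may pass through `0`; the default value used there is immaterial, since regularity
  -- is required only at the two ends.
  let F : ℂ → ℂˣ := fun c => if h : L c ≠ 0 then Units.mk0 (L c) h else x
  have hF : ∀ c, L c ≠ 0 → (F c : ℂ) = L c := fun c h => by simp [F, h]
  have h0 : L 0 = x := by simp [L]
  have h1 : L 1 = y := by simp [L]
  have h0' : L 0 ≠ 0 := by rw [h0]; exact x.ne_zero
  have h1' : L 1 ≠ 0 := by rw [h1]; exact y.ne_zero
  refine ⟨F, Units.ext ((hF 0 h0').trans h0), Units.ext ((hF 1 h1').trans h1),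
    regMap_unit ?_, regMap_unit ?_⟩
  · exact (hL 0).congr (((hL 0).eventually_ne h0').mono fun c h => (hF c h).symm)
  · exact (hL 1).congr (((hL 1).eventually_ne h1').mono fun c h => (hF c h).symm)

end Irreducible

/-! ### Plücker coordinates and matrices of bases. -/

section Plucker

theorem coe_idx (n : ℕ) [NeZero n] (m : ℤ) : ((idx n m : ℕ) : ℤ) = (m - 1) % n := by
  have hn : (0 : ℤ) < n := by exact_mod_cast Nat.pos_of_ne_zero (NeZero.ne n)
  have h1 := Int.emod_nonneg (m - 1) hn.ne'
  have h2 := Int.emod_lt_of_pos (m - 1) hn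
  rw [idx, Fin.val_ofNat, Nat.mod_eq_of_lt (by omega)]
  omega

theorem idx_eq_iff {n : ℕ} [NeZero n] {m m' : ℤ} : idx n m = idx n m' ↔ (n : ℤ) ∣ m - m' := by
  rw [Fin.ext_iff, ← Int.natCast_inj, coe_idx, coe_idx]
  rw [← Int.emod_emod_of_dvd _ (dvd_refl (n : ℤ)), Int.emod_emod, Int.emod_eq_emod_iff_emod_sub_eq_zero,
    ← Int.dvd_iff_emod_eq_zero]
  congr! 1
  ring

theorem idx_eq_of {n : ℕ} [NeZero n] {m : ℤ} {i : Fin n} (h : m = i + 1) : idx n m = i := by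
  rw [Fin.ext_iff, ← Int.natCast_inj, coe_idx, h]
  rw [add_sub_cancel_right]
  exact Int.emod_eq_of_lt (by omega) (by omega)

@[simp] theorem idx_coe {n : ℕ} [NeZero n] (i : Fin n) : idx n ((i : ℕ) + 1) = i := idx_eq_of rfl

theorem idx_add_mul {n : ℕ} [NeZero n] (m p : ℤ) : idx n (m + n * p) = idx n m :=
  idx_eq_iff.2 ⟨p, by ring⟩

variable {k n : ℕ} [NeZero n]

theorem pl_congr (N : Gr k n) {I J : Finset ℤ} (h : I.image (idx n) = J.image (idx n)) :
    pl N I = pl N J := by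
  unfold pl
  simp only [h]

theorem pl_eq_zero (N : Gr k n) {I : Finset ℤ} (h : (I.image (idx n)).card ≠ k) : pl N I = 0 :=
  dif_neg h

theorem pl_of_strictMono (N : Gr k n) {I : Finset ℤ} {f : Fin k → Fin n} (hf : StrictMono f)
    (h : Finset.univ.image f = I.image (idx n)) : pl N I = (N.rep.submatrix f id).det := by
  have hc : (I.image (idx n)).card = k := by
    rw [← h, Finset.card_image_of_injective _ hf.injective, Finset.card_univ, Fintype.card_fin]
  rw [pl, dif_pos hc]
  congr 2
  exact (Finset.orderEmbOfFin_unique hc (fun x => h ▸ Finset.mem_image_of_mem _ (Finset.mem_univ x))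
    hf).symm

theorem range_rep (N : Gr k n) : LinearMap.range N.rep.mulVecLin = N.1 := by
  rw [Matrix.range_mulVecLin]
  have : N.rep.col = N.1.subtype ∘ Module.finBasisOfFinrankEq ℂ N.1 N.2 := by
    ext j i; rfl
  rw [this, Set.range_comp, Submodule.span_image, Module.Basis.span_eq, Submodule.map_top,
    Submodule.range_subtype]

theorem rep_mulVec_injective (N : Gr k n) : Function.Injective N.rep.mulVec := by
  rw [Matrix.mulVec_injective_iff]
  have : N.rep.col = N.1.subtype ∘ Module.finBasisOfFinrankEq ℂ N.1 N.2 := by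
    ext j i; rfl
  rw [this]
  exact (Module.finBasisOfFinrankEq ℂ N.1 N.2).linearIndependent.map' _ (Submodule.ker_subtype _)

theorem exists_eq_mul_of_col_mem {l m : ℕ} {B : Matrix (Fin n) (Fin m) ℂ}
    {C : Matrix (Fin n) (Fin l) ℂ} (h : ∀ j, C.col j ∈ LinearMap.range B.mulVecLin) :
    ∃ T : Matrix (Fin m) (Fin l) ℂ, C = B * T := by
  choose T hT using h
  refine ⟨Matrix.of fun i j => T j i, ?_⟩
  ext i j
  exact (congrFun (hT j) i).symm

theorem col_mem_range {m : ℕ} (B : Matrix (Fin n) (Fin m) ℂ) (j : Fin m) :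
    B.col j ∈ LinearMap.range B.mulVecLin := by
  rw [Matrix.range_mulVecLin]
  exact Submodule.subset_span ⟨j, rfl⟩

theorem exists_rep_mul (N : Gr k n) {B : Matrix (Fin n) (Fin k) ℂ}
    (h : N.1 = LinearMap.range B.mulVecLin) : ∃ T : Matrix (Fin k) (Fin k) ℂ, T.det ≠ 0 ∧
      B = N.rep * T := by
  obtain ⟨T, hT⟩ := exists_eq_mul_of_col_mem (B := N.rep) (C := B) fun j => by
    rw [range_rep, h]; exact col_mem_range B j
  obtain ⟨T', hT'⟩ := exists_eq_mul_of_col_mem (B := B) (C := N.rep) fun j => by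
    rw [← h, ← range_rep]; exact col_mem_range N.rep j
  refine ⟨T, ?_, hT⟩
  have h1 : N.rep * (T * T') = N.rep * (1 : Matrix (Fin k) (Fin k) ℂ) := by rw [← Matrix.mul_assoc, ← hT, ← hT', Matrix.mul_one]
  have h2 : T * T' = 1 := by
    ext i j
    have : N.rep.mulVec ((T * T').col j) = N.rep.mulVec ((1 : Matrix (Fin k) (Fin k) ℂ).col j) := by
      ext i
      exact congrFun (congrFun h1 i) j
    exact congrFun (rep_mulVec_injective N this) i
  have h3 : T.det * T'.det = 1 := by rw [← Matrix.det_mul, h2, Matrix.det_one]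
  exact left_ne_zero_of_mul_eq_one h3

/-- Two bases of `N` differ by an invertible matrix, whose determinant multiplies all maximal
minors. Ratios of Plücker coordinates can therefore be computed from any matrix whose columns form a
basis of `N`. -/
theorem exists_det_submatrix (N : Gr k n) {B : Matrix (Fin n) (Fin k) ℂ}
    (h : N.1 = LinearMap.range B.mulVecLin) : ∃ c : ℂ, c ≠ 0 ∧
      ∀ f : Fin k → Fin n, (B.submatrix f id).det = (N.rep.submatrix f id).det * c := by
  obtain ⟨T, hT, rfl⟩ := exists_rep_mul N h
  refine ⟨T.det, hT, fun f => ?_⟩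
  rw [← Matrix.det_mul]
  rfl

theorem finrank_range_of_det_ne_zero {B : Matrix (Fin n) (Fin k) ℂ} {f : Fin k → Fin n}
    (h : (B.submatrix f id).det ≠ 0) : Module.finrank ℂ (LinearMap.range B.mulVecLin) = k := by
  rw [LinearMap.finrank_range_of_inj, Module.finrank_fin_fun]
  intro v w hvw
  refine Matrix.mulVec_injective_of_isUnit ((Matrix.isUnit_iff_isUnit_det _).2
    (isUnit_iff_ne_zero.2 h)) ?_
  ext i
  exact congrFun hvw (f i)

theorem exists_det_rep_ne_zero (N : Gr k n) : ∃ f : Fin k → Fin n,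
    (N.rep.submatrix f id).det ≠ 0 := by
  have h := (Matrix.mulVec_injective_iff.1 (rep_mulVec_injective N))
  have hr : N.rep.rank = k := by
    rw [Matrix.rank, range_rep, N.2]
  obtain ⟨f, hf⟩ : ∃ f : Fin k → Fin n, LinearIndependent ℂ (N.rep.submatrix f id).row := by
    have h2 : Module.finrank ℂ (Submodule.span ℂ (Set.range N.rep.row)) = k := by
      rw [← Matrix.rank_eq_finrank_span_row, hr]
    obtain ⟨f, hf, -, hfl⟩ := Submodule.exists_fun_fin_finrank_span_eq ℂ (Set.range N.rep.row)
    choose g hg using hf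
    refine ⟨fun i => g (Fin.cast h2.symm i), ?_⟩
    have := hfl.comp (Fin.cast h2.symm) (Fin.cast_injective _)
    have he : (N.rep.submatrix (fun i => g (Fin.cast h2.symm i)) id).row =
        f ∘ Fin.cast h2.symm := by
      ext i j
      exact congrFun (hg (Fin.cast h2.symm i)) j
    rw [he]
    exact this
  exact ⟨f, (Matrix.isUnit_iff_isUnit_det _).1
    (Matrix.linearIndependent_rows_iff_isUnit.1 hf) |>.ne_zero⟩

/-- Sorting the rows of a maximal minor gives a Plücker coordinate up to sign. -/
theorem exists_det_submatrix_eq_pl (f : Fin k → Fin n) :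
    ∃ (c : ℂ) (I : Finset ℤ), (Function.Injective f → c ≠ 0 ∧
      I.image (idx n) = Finset.univ.image f) ∧
      ∀ N : Gr k n, (N.rep.submatrix f id).det = c * pl N I := by
  by_cases hf : Function.Injective f
  · have hI : ((Finset.univ.image f).image fun i : Fin n => ((i : ℕ) : ℤ) + 1).image (idx n) =
        Finset.univ.image f := by
      rw [Finset.image_image]
      have : (idx n ∘ fun i : Fin n => ((i : ℕ) : ℤ) + 1) = id := by
        ext i
        simp
      rw [this, Finset.image_id]
    refine ⟨((Equiv.Perm.sign (Tuple.sort f) : ℤ) : ℂ), _, fun _ => ⟨?_, hI⟩, fun N => ?_⟩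
    · exact_mod_cast (Equiv.Perm.sign (Tuple.sort f)).ne_zero
    · have hs : StrictMono (f ∘ Tuple.sort f) :=
        (Tuple.monotone_sort f).strictMono_of_injective (hf.comp (Equiv.injective _))
      rw [pl_of_strictMono N hs]
      · have : N.rep.submatrix (f ∘ Tuple.sort f) id =
            (N.rep.submatrix f id).submatrix (Tuple.sort f) id := rfl
        rw [this, Matrix.det_permute, ← mul_assoc, ← Int.cast_mul, ← Units.val_mul,
          Int.units_mul_self]
        simp
      · rw [hI, ← Finset.image_image]
        congr 1
        exact Finset.image_univ_equiv _
  · refine ⟨0, ∅, fun h => absurd h hf, fun N => ?_⟩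
    obtain ⟨i, j, hij, hne⟩ : ∃ i j, f i = f j ∧ i ≠ j := by
      simpa [Function.Injective] using hf
    rw [Matrix.det_zero_of_row_eq hne, zero_mul]
    ext l
    simp [hij]

theorem pl_ne_zero_iff_det (N : Gr k n) {I : Finset ℤ} {f : Fin k → Fin n}
    (hf : Function.Injective f) (h : I.image (idx n) = Finset.univ.image f) :
    pl N I ≠ 0 ↔ (N.rep.submatrix f id).det ≠ 0 := by
  obtain ⟨c, J, hJ, hN⟩ := exists_det_submatrix_eq_pl (k := k) f
  obtain ⟨hc, hJ⟩ := hJ hf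
  rw [hN, pl_congr N (h.trans hJ.symm)]
  simp [hc]

/-- The vector of minors in which row `q` of the minor with rows `f` runs over all rows. -/
theorem det_update_mem (N : Gr k n) (f : Fin k → Fin n) (q : Fin k) :
    (fun i => (N.rep.submatrix (Function.update f q i) id).det) ∈ N.1 := by
  rw [← range_rep]
  -- Cramer's rule: the minor with row `q` replaced by row `i` is row `i` of the basis matrix times
  -- column `q` of the adjugate.
  refine ⟨(N.rep.submatrix f id).adjugate.col q, ?_⟩
  ext i
  have : N.rep.submatrix (Function.update f q i) id =
      (N.rep.submatrix f id).updateRow q (N.rep i) := by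
    ext a b
    by_cases h : a = q
    · subst h; simp
    · simp [h]
  rw [this, ← Matrix.cramer_transpose_apply, Matrix.cramer_eq_adjugate_mulVec,
    ← Matrix.adjugate_transpose]
  simp [Matrix.mulVec, dotProduct, mul_comm]

theorem det_update_of_ne (N : Gr k n) (f : Fin k → Fin n) {q p : Fin k} (h : p ≠ q) :
    (N.rep.submatrix (Function.update f q (f p)) id).det = 0 :=
  Matrix.det_zero_of_row_eq h (by ext j; simp [h])

/-- On a subspace whose minor with rows `f` does not vanish, vectors vanishing on `f` are zero. -/
theorem eq_zero_of_det_ne_zero {N : Gr k n} {f : Fin k → Fin n}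
    (h : (N.rep.submatrix f id).det ≠ 0) {v : Fin n → ℂ} (hv : v ∈ N.1) (h0 : ∀ p, v (f p) = 0) :
    v = 0 := by
  rw [← range_rep] at hv
  obtain ⟨c, rfl⟩ := hv
  have : c = 0 := by
    refine Matrix.mulVec_injective_of_isUnit ((Matrix.isUnit_iff_isUnit_det _).2
      (isUnit_iff_ne_zero.2 h)) ?_
    rw [Matrix.mulVec_zero]
    ext p
    exact h0 p
  rw [this, map_zero]

/-- A kernel vector of a singular minor would produce a nonzero vector of `N` vanishing on the rows
`f`. -/
theorem det_ne_zero_of_eq_zero {N : Gr k n} {f : Fin k → Fin n}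
    (h : ∀ v ∈ N.1, (∀ p, v (f p) = 0) → v = 0) : (N.rep.submatrix f id).det ≠ 0 := by
  intro h0
  obtain ⟨c, hc, hc'⟩ := Matrix.exists_mulVec_eq_zero_iff.2 h0
  refine hc (rep_mulVec_injective N ?_)
  rw [Matrix.mulVec_zero]
  refine h _ ?_ fun p => congrFun hc' p
  rw [← range_rep]
  exact ⟨c, rfl⟩

end Plucker

/-! ### Regular maps into Grassmannians. -/

section RegularGr

variable {k n : ℕ} [NeZero n] {V : Type} [AlgCoord V]

/-- A subspace as a point of the Grassmannian, with a default value if the dimension is wrong. -/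
def Gr.mkD (N₀ : Gr k n) (N : Submodule ℂ (Fin n → ℂ)) : Gr k n :=
  haveI := Classical.propDecidable
  if h : Module.finrank ℂ N = k then ⟨N, h⟩ else N₀

theorem Gr.coe_mkD (N₀ : Gr k n) {N : Submodule ℂ (Fin n → ℂ)} (h : Module.finrank ℂ N = k) :
    (Gr.mkD N₀ N).1 = N := by
  simp [Gr.mkD, h]

theorem Gr.mk?_eq (N₀ : Gr k n) {N : Submodule ℂ (Fin n → ℂ)} (h : Module.finrank ℂ N = k) :
    Gr.mk? k N = Part.some (Gr.mkD N₀ N) := by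
  exact Part.eq_some_iff.2 ⟨h, Subtype.ext (Gr.coe_mkD N₀ h).symm⟩

theorem reg_pl_div_pl (I J : Finset ℤ) {N : Gr k n} (h : pl N J ≠ 0) :
    Reg (fun N : Gr k n => pl N I / pl N J) N :=
  reg_coord (fun N => ⟨pl N J ≠ 0, fun _ => pl N I / pl N J⟩) ⟨I, J, rfl⟩ h
    (by rintro y z ⟨_, rfl⟩; rfl)

theorem zOpenPred_pl_ne_zero (J : Finset ℤ) : ZOpenPred fun N : Gr k n => pl N J ≠ 0 := by
  intro N hN
  refine ((reg_pl_div_pl J J hN).eventually_ne (div_self hN ▸ one_ne_zero)).mono fun M hM h => hM ?_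
  rw [h, zero_div]

/-- The chosen basis `rep` need not vary regularly. Normalizing it so that the rows `f` form the
identity matrix turns every entry into a ratio of two Plücker coordinates, up to a constant. -/
theorem exists_local_matrix (N : Gr k n) : ∃ B : Gr k n → Matrix (Fin n) (Fin k) ℂ,
    (∀ i j, Reg (fun M => B M i j) N) ∧
      ∀ᶠ M in zNhds N, M.1 = LinearMap.range (B M).mulVecLin := by
  obtain ⟨f, hf⟩ := exists_det_rep_ne_zero N
  obtain ⟨c, J, hJ, hc⟩ := exists_det_submatrix_eq_pl (k := k) f
  have hne : ∀ M : Gr k n, (M.rep.submatrix f id).det ≠ 0 ↔ c ≠ 0 ∧ pl M J ≠ 0 := fun M => by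
    rw [hc, mul_ne_zero_iff]
  have hN := (hne N).1 hf
  refine ⟨fun M => M.rep * (M.rep.submatrix f id)⁻¹, fun i j => ?_, ?_⟩
  · obtain ⟨c', I, -, hI⟩ := exists_det_submatrix_eq_pl (k := k) (Function.update f j i)
    refine ((reg_const (c' / c) N).mul (reg_pl_div_pl I J hN.2)).congr (Eventually.of_forall fun M => ?_)
    have : (M.rep * (M.rep.submatrix f id)⁻¹) i j =
        (M.rep.submatrix (Function.update f j i) id).det / (M.rep.submatrix f id).det := by
      have h1 : M.rep.submatrix (Function.update f j i) id =
          (M.rep.submatrix f id).updateRow j (M.rep i) := by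
        ext a b
        by_cases h : a = j
        · subst h; simp
        · simp [h]
      rw [h1, ← Matrix.cramer_transpose_apply, Matrix.cramer_eq_adjugate_mulVec,
        ← Matrix.adjugate_transpose, Matrix.inv_def, Ring.inverse_eq_inv', Matrix.mul_smul]
      simp [Matrix.mulVec, dotProduct, mul_comm, Matrix.mul_apply, div_eq_mul_inv]
    change _ = (M.rep * (M.rep.submatrix f id)⁻¹) i j
    rw [this, hc, hI, mul_div_mul_comm]
  · filter_upwards [zOpenPred_pl_ne_zero J N hN.2] with M hM
    have hu : IsUnit (M.rep.submatrix f id).det := isUnit_iff_ne_zero.2 ((hne M).2 ⟨hN.1, hM⟩)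
    have hu' : IsUnit (M.rep.submatrix f id)⁻¹ := by
      rw [Matrix.isUnit_nonsing_inv_iff]
      exact (Matrix.isUnit_iff_isUnit_det _).2 hu
    rw [Matrix.mulVecLin_mul, LinearMap.range_comp_of_range_eq_top, range_rep]
    rw [LinearMap.range_eq_top]
    exact Matrix.mulVec_surjective_iff_isUnit.2 hu'

theorem RegMap.exists_local_matrix {F : V → Gr k n} {x : V} (h : RegMap F x) :
    ∃ B : V → Matrix (Fin n) (Fin k) ℂ, (∀ i j, Reg (fun y => B y i j) x) ∧
      ∀ᶠ y in zNhds x, (F y).1 = LinearMap.range (B y).mulVecLin := by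
  obtain ⟨B, hB, hB'⟩ := GeomR.exists_local_matrix (F x)
  exact ⟨fun y => B (F y), fun i j => (hB i j).comp h, h.tendsto.eventually hB'⟩

/-- Minors of a regular matrix are regular, and the scalar relating them to the minors of `rep`
cancels in ratios. -/
theorem regMap_gr {F : V → Gr k n} {x : V} {B : V → Matrix (Fin n) (Fin k) ℂ}
    (hB : ∀ i j, Reg (fun y => B y i j) x)
    (hF : ∀ᶠ y in zNhds x, (F y).1 = LinearMap.range (B y).mulVecLin) : RegMap F x := by
  rintro u ⟨I, J, rfl⟩ (hx : pl (F x) J ≠ 0)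
  have hFx := self_of_zNhds hF
  have hdet : ∀ f : Fin k → Fin n, Reg (fun y => ((B y).submatrix f id).det) x := fun f =>
    Reg.det fun i j => hB _ _
  have hJ : (J.image (idx n)).card = k := by
    by_contra h
    exact hx (pl_eq_zero _ h)
  have hpl : ∀ y (I : Finset ℤ) (hI : (I.image (idx n)).card = k),
      pl (F y) I = ((F y).rep.submatrix ((I.image (idx n)).orderEmbOfFin hI) id).det :=
    fun y I hI => dif_pos hI
  have hJx : ((B x).submatrix ((J.image (idx n)).orderEmbOfFin hJ) id).det ≠ 0 := by
    obtain ⟨c, hc, hc'⟩ := exists_det_submatrix _ hFx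
    rw [hc', ← hpl x J hJ]
    exact mul_ne_zero hx hc
  have hev := (hdet _).eventually_ne hJx
  by_cases hI : (I.image (idx n)).card = k
  · refine ⟨_, (hdet ((I.image (idx n)).orderEmbOfFin hI)).div (hdet _) hJx, ?_⟩
    filter_upwards [hev, hF] with y hy hFy
    obtain ⟨c, hc, hc'⟩ := exists_det_submatrix _ hFy
    rw [hc', ← hpl y J hJ] at hy
    refine ⟨left_ne_zero_of_mul hy, ?_⟩
    rw [hc', hc', ← hpl y J hJ, ← hpl y I hI, mul_div_mul_right _ _ hc]
  · refine ⟨_, reg_const 0 x, ?_⟩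
    filter_upwards [hev, hF] with y hy hFy
    obtain ⟨c, hc, hc'⟩ := exists_det_submatrix _ hFy
    rw [hc', ← hpl y J hJ] at hy
    refine ⟨left_ne_zero_of_mul hy, ?_⟩
    change pl (F y) I / _ = 0
    rw [pl_eq_zero _ hI, zero_div]

theorem eventually_finrank_range {x : V} {B : V → Matrix (Fin n) (Fin k) ℂ}
    (hB : ∀ i j, Reg (fun y => B y i j) x)
    (hx : Module.finrank ℂ (LinearMap.range (B x).mulVecLin) = k) :
    ∀ᶠ y in zNhds x, Module.finrank ℂ (LinearMap.range (B y).mulVecLin) = k := by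
  obtain ⟨f, hf⟩ := exists_det_rep_ne_zero (⟨_, hx⟩ : Gr k n)
  obtain ⟨c, hc, hc'⟩ := exists_det_submatrix (⟨_, hx⟩ : Gr k n) rfl
  have : ((B x).submatrix f id).det ≠ 0 := by rw [hc']; exact mul_ne_zero hf hc
  exact (Reg.eventually_ne (Reg.det fun i j => hB (f i) j) this).mono
    fun y hy => finrank_range_of_det_ne_zero hy

theorem regMap_mkD {N₀ : V → Gr k n} {x : V} {B : V → Matrix (Fin n) (Fin k) ℂ}
    (hB : ∀ i j, Reg (fun y => B y i j) x)
    (hx : Module.finrank ℂ (LinearMap.range (B x).mulVecLin) = k) :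
    RegMap (fun y => Gr.mkD (N₀ y) (LinearMap.range (B y).mulVecLin)) x :=
  regMap_gr hB ((eventually_finrank_range hB hx).mono fun _ hy => Gr.coe_mkD _ hy)

theorem exists_pl_ne_zero {I : Finset ℤ} (h : (I.image (idx n)).card = k) :
    ∃ N : Gr k n, pl N I ≠ 0 := by
  let B : Matrix (Fin n) (Fin k) ℂ :=
    (1 : Matrix (Fin n) (Fin n) ℂ).submatrix id ((I.image (idx n)).orderEmbOfFin h)
  have hB : (B.submatrix ((I.image (idx n)).orderEmbOfFin h) id).det = 1 := by
    rw [Matrix.submatrix_submatrix]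
    simp [Matrix.submatrix_one _ ((I.image (idx n)).orderEmbOfFin h).injective]
  have hr := finrank_range_of_det_ne_zero (hB ▸ one_ne_zero)
  refine ⟨⟨_, hr⟩, fun h0 => ?_⟩
  obtain ⟨c, hc, hc'⟩ := exists_det_submatrix (⟨_, hr⟩ : Gr k n) rfl
  have h1 := (dif_pos h).symm.trans h0
  rw [hc', h1, zero_mul] at hB
  exact zero_ne_one hB

/-- Linear interpolation between two bases; it need only have full rank near the two ends. -/
theorem ratConnected_gr (hk : k ≤ n) : RatConnected (Gr k n) := by
  refine ⟨?_, fun x y => ?_⟩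
  · obtain ⟨s, hs⟩ := Finset.exists_subset_card_eq (s := (Finset.univ : Finset (Fin n))) (n := k)
      (by simpa using hk)
    obtain ⟨N, -⟩ := exists_pl_ne_zero (n := n) (k := k) (I := s.image fun i : Fin n => ((i : ℕ) : ℤ) + 1) (by
      rw [Finset.image_image]
      have : (idx n ∘ fun i : Fin n => ((i : ℕ) : ℤ) + 1) = id := by
        ext i
        simp
      rw [this, Finset.image_id, hs.2])
    exact ⟨N⟩
  · let B : ℂ → Matrix (Fin n) (Fin k) ℂ := fun c => Matrix.of fun i j =>
      (1 - c) * x.rep i j + c * y.rep i j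
    have hB : ∀ c i j, Reg (fun c => B c i j) c := fun c i j =>
      (((reg_const 1 c).sub (reg_line c)).mul (reg_const _ c)).add
        ((reg_line c).mul (reg_const _ c))
    have h0 : B 0 = x.rep := by ext; simp [B]
    have h1 : B 1 = y.rep := by ext; simp [B]
    have h0' : Module.finrank ℂ (LinearMap.range (B 0).mulVecLin) = k := by
      rw [h0, range_rep, x.2]
    have h1' : Module.finrank ℂ (LinearMap.range (B 1).mulVecLin) = k := by
      rw [h1, range_rep, y.2]
    refine ⟨fun c => Gr.mkD x (LinearMap.range (B c).mulVecLin), Subtype.ext ?_, Subtype.ext ?_,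
      regMap_mkD (hB 0) h0', regMap_mkD (hB 1) h1'⟩
    · rw [Gr.coe_mkD _ h0', h0, range_rep]
    · rw [Gr.coe_mkD _ h1', h1, range_rep]

end RegularGr

/-! ### Periodic band matrices. -/

section Band

variable {n : ℕ} [NeZero n]

/-- Evaluation of the loop parameter. -/
def ev (z : ℂ) : Folded n →+* Matrix (Fin n) (Fin n) ℂ := (Polynomial.evalRingHom z).mapMatrix

@[simp] theorem ev_apply (z : ℂ) (A : Folded n) (a b : Fin n) : ev z A a b = (A a b).eval z := rfl

theorem folded_ext {A B : Folded n} (S : Set ℂ) (hS : S.Finite)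
    (h : ∀ z, z ∉ S → ev z A = ev z B) : A = B := by
  ext1 a b
  refine Polynomial.eq_of_infinite_eval_eq _ _ (hS.infinite_compl.mono fun z hz => ?_)
  exact congrFun (congrFun (h z hz) a) b

/-- The matrix `A`, unfolded to a periodic matrix with rows and columns labelled by integers, is
lower triangular of bandwidth `d`, with ones on the last diagonal. -/
def IsMonicBand (d : ℕ) (A : Folded n) : Prop :=
  ∀ (a b : Fin n) (p : ℕ),
    ((A a b).coeff p ≠ 0 → 0 ≤ (a : ℤ) - b + n * p ∧ (a : ℤ) - b + n * p ≤ d) ∧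
    ((a : ℤ) - b + n * p = d → (A a b).coeff p = 1)

/-- The entries of the unfolded matrix. -/
def unf (A : Folded n) (i j : ℤ) : ℂ :=
  if (j - 1) / n ≤ (i - 1) / n then
    (A (idx n i) (idx n j)).coeff ((i - 1) / n - (j - 1) / n).toNat else 0

theorem natCast_pos_of_neZero (n : ℕ) [NeZero n] : (0 : ℤ) < n := by
  exact_mod_cast Nat.pos_of_ne_zero (NeZero.ne n)

theorem exists_fin_add_mul (i : ℤ) : ∃ (a : Fin n) (s : ℤ), i = a + 1 + n * s := by
  refine ⟨idx n i, (i - 1) / n, ?_⟩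
  rw [coe_idx]
  have := Int.emod_add_mul_ediv (i - 1) n
  linarith

theorem unf_fin (A : Folded n) (a b : Fin n) (s r : ℤ) :
    unf A (a + 1 + n * s) (b + 1 + n * r) = if r ≤ s then (A a b).coeff (s - r).toNat else 0 := by
  have hn := natCast_pos_of_neZero n
  have h : ∀ (a : Fin n) (s : ℤ), ((a : ℤ) + 1 + n * s - 1) / n = s := fun a s => by
    rw [show (a : ℤ) + 1 + n * s - 1 = a + n * s by ring, Int.add_mul_ediv_left _ _ hn.ne',
      Int.ediv_eq_zero_of_lt (by omega) (by omega), zero_add]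
  rw [unf, h, h, idx_add_mul, idx_add_mul, idx_coe, idx_coe]

theorem unf_add_mul (A : Folded n) (i j m : ℤ) : unf A (i + n * m) (j + n * m) = unf A i j := by
  obtain ⟨a, s, rfl⟩ := exists_fin_add_mul (n := n) i
  obtain ⟨b, r, rfl⟩ := exists_fin_add_mul (n := n) j
  rw [add_assoc _ ((n : ℤ) * s), add_assoc _ ((n : ℤ) * r), ← mul_add, ← mul_add, unf_fin, unf_fin]
  simp

theorem unf_coeff (A : Folded n) (a b : Fin n) (p : ℕ) :
    unf A (a + 1 + n * p) (b + 1) = (A a b).coeff p := by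
  have := unf_fin A a b p 0
  simpa using this

theorem folded_ext_unf {A B : Folded n} (h : ∀ i j, unf A i j = unf B i j) : A = B := by
  ext a b p
  rw [← unf_coeff, ← unf_coeff, h]

/-- Lower triangularity of the unfolded matrix. -/
def IsLower (A : Folded n) : Prop := ∀ i j, i < j → unf A i j = 0

theorem isLower_iff {A : Folded n} : IsLower A ↔ ∀ a b : Fin n, a < b → (A a b).coeff 0 = 0 := by
  constructor
  · intro h a b hab
    have := h (a + 1 + n * (0 : ℕ)) (b + 1) (by simp; omega)
    rwa [unf_coeff] at this
  · intro h i j hij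
    obtain ⟨a, s, rfl⟩ := exists_fin_add_mul (n := n) i
    obtain ⟨b, r, rfl⟩ := exists_fin_add_mul (n := n) j
    rw [unf_fin]
    split_ifs with hrs
    · rcases hrs.eq_or_lt with rfl | hlt
      · rw [sub_self]
        exact h a b (by rw [Fin.lt_def]; omega)
      · exfalso
        have : (n : ℤ) * (r + 1) ≤ n * s := by
          have := natCast_pos_of_neZero n
          gcongr; omega
        rw [mul_add] at this
        omega
    · rfl

/-- The sum over the inner index in `Fin n` and the Cauchy sum over powers of the loop variable
combine into one sum over integers, which triangularity cuts down to the interval from `j` to `i`.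
-/
theorem unf_mul {A B : Folded n} (hA : IsLower A) (hB : IsLower B) (i j : ℤ) :
    unf (A * B) i j = ∑ l ∈ Finset.Icc j i, unf A i l * unf B l j := by
  have hn := natCast_pos_of_neZero n
  obtain ⟨a, s, rfl⟩ := exists_fin_add_mul (n := n) i
  obtain ⟨b, r, rfl⟩ := exists_fin_add_mul (n := n) j
  rcases lt_or_ge s r with hsr | hsr
  · rw [unf_fin, if_neg (not_le.2 hsr), Finset.Icc_eq_empty, Finset.sum_empty]
    have : (n : ℤ) * (s + 1) ≤ n * r := by gcongr; omega
    rw [mul_add] at this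
    omega
  · rw [unf_fin, if_pos hsr, Matrix.mul_apply, Polynomial.finsetSum_coeff]
    simp_rw [Polynomial.coeff_mul]
    rw [← Finset.sum_product']
    have hsub : Finset.Icc ((b : ℤ) + 1 + n * r) (a + 1 + n * s) ⊆
        Finset.Icc (1 + n * r) (n + n * s) := by
      apply Finset.Icc_subset_Icc <;> omega
    -- The interval is enlarged to whole periods; triangularity makes the added terms vanish.
    rw [Finset.sum_subset hsub]
    · refine Finset.sum_nbij' (fun x => (x.1 : ℤ) + 1 + n * (r + x.2.2))
        (fun l => (idx n l, ((s - (l - 1) / n).toNat, ((l - 1) / n - r).toNat))) ?_ ?_ ?_ ?_ ?_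
      · rintro ⟨c, q, t⟩ h
        simp only [Finset.mem_product, Finset.mem_univ, Finset.HasAntidiagonal.mem_antidiagonal, true_and] at h
        simp only [Finset.mem_Icc]
        have h1 : (n : ℤ) * r ≤ n * (r + t) := by gcongr; omega
        have h2 : (n : ℤ) * (r + t) ≤ n * s := by gcongr; omega
        omega
      · intro l hl
        simp only [Finset.mem_Icc] at hl
        have h1 : r ≤ (l - 1) / n := by
          rw [Int.le_ediv_iff_mul_le hn]; linarith
        have h2 : (l - 1) / n < s + 1 := by
          rw [Int.ediv_lt_iff_lt_mul hn]; linarith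
        simp only [Finset.mem_product, Finset.mem_univ, Finset.HasAntidiagonal.mem_antidiagonal, true_and]
        omega
      · rintro ⟨c, q, t⟩ h
        simp only [Finset.mem_product, Finset.mem_univ, Finset.HasAntidiagonal.mem_antidiagonal, true_and] at h
        have h1 : ((c : ℤ) + 1 + n * (r + t) - 1) / n = r + t := by
          rw [show (c : ℤ) + 1 + n * (r + t) - 1 = c + n * (r + t) by ring,
            Int.add_mul_ediv_left _ _ hn.ne', Int.ediv_eq_zero_of_lt (by omega) (by omega), zero_add]
        simp only [h1, idx_add_mul, idx_coe, Prod.mk.injEq, true_and]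
        omega
      · intro l hl
        simp only [Finset.mem_Icc] at hl
        have h1 : r ≤ (l - 1) / n := by
          rw [Int.le_ediv_iff_mul_le hn]; linarith
        have := Int.emod_add_mul_ediv (l - 1) n
        simp only [coe_idx]
        rw [Int.toNat_of_nonneg (by omega), add_sub_cancel]
        linarith
      · rintro ⟨c, q, t⟩ h
        simp only [Finset.mem_product, Finset.mem_univ, Finset.HasAntidiagonal.mem_antidiagonal, true_and] at h
        dsimp only
        rw [unf_fin, unf_fin, if_pos (by omega), if_pos (by omega)]
        congr 3 <;> omega
    · intro l _ hl'
      simp only [Finset.mem_Icc, not_and_or, not_le] at hl'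
      rcases hl' with h | h
      · rw [hB _ _ h, mul_zero]
      · rw [hA _ _ h, zero_mul]

theorem IsLower.mul {A B : Folded n} (hA : IsLower A) (hB : IsLower B) : IsLower (A * B) := by
  intro i j hij
  rw [unf_mul hA hB, Finset.Icc_eq_empty (by omega), Finset.sum_empty]

theorem isMonicBand_iff {d : ℕ} {A : Folded n} : IsMonicBand d A ↔
    ∀ i j, (unf A i j ≠ 0 → j ≤ i ∧ i ≤ j + d) ∧ (i = j + d → unf A i j = 1) := by
  constructor
  · intro h i j
    obtain ⟨a, s, rfl⟩ := exists_fin_add_mul (n := n) i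
    obtain ⟨b, r, rfl⟩ := exists_fin_add_mul (n := n) j
    rw [unf_fin]
    split_ifs with hrs
    · obtain ⟨p, rfl⟩ : ∃ p : ℕ, s = r + p := ⟨(s - r).toNat, by omega⟩
      have := h a b p
      rw [show r + (p : ℤ) - r = p by ring, Int.toNat_natCast, mul_add]
      refine ⟨fun h0 => ?_, fun h0 => this.2 ?_⟩
      · have := this.1 h0
        omega
      · omega
    · refine ⟨fun h0 => absurd rfl h0, fun h0 => ?_⟩
      exfalso
      have : (n : ℤ) * (s + 1) ≤ n * r := by
        have := natCast_pos_of_neZero n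
        gcongr; omega
      rw [mul_add] at this
      omega
  · intro h a b p
    rw [← unf_coeff]
    have := h (a + 1 + n * p) (b + 1)
    refine ⟨fun h0 => ?_, fun h0 => this.2 ?_⟩
    · have := this.1 h0
      omega
    · omega

theorem IsMonicBand.isLower {d : ℕ} {A : Folded n} (h : IsMonicBand d A) : IsLower A := by
  intro i j hij
  by_contra h0
  have := ((isMonicBand_iff.1 h i j).1 h0).1
  omega

theorem IsMonicBand.mul {d e : ℕ} {A B : Folded n} (hA : IsMonicBand d A) (hB : IsMonicBand e B) :
    IsMonicBand (d + e) (A * B) := by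
  refine isMonicBand_iff.2 fun i j => ?_
  rw [unf_mul hA.isLower hB.isLower]
  rw [isMonicBand_iff] at hA hB
  constructor
  · intro h
    obtain ⟨l, hl, h0⟩ := Finset.exists_ne_zero_of_sum_ne_zero h
    have h1 := (hA i l).1 (left_ne_zero_of_mul h0)
    have h2 := (hB l j).1 (right_ne_zero_of_mul h0)
    push_cast
    omega
  · intro h
    push_cast at h
    -- The last diagonal of the product is reached only from the last diagonals of both factors.
    rw [Finset.sum_eq_single (j + e)]
    · rw [(hA _ _).2 (by omega), (hB _ _).2 rfl, one_mul]
    · intro l _ hl'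
      by_contra h0
      have h1 := (hA i l).1 (left_ne_zero_of_mul h0)
      have h2 := (hB l j).1 (right_ne_zero_of_mul h0)
      omega
    · intro h0
      exact absurd (Finset.mem_Icc.2 ⟨by omega, by omega⟩) h0

theorem isMonicBand_zero {A : Folded n} (h : IsMonicBand 0 A) : A = 1 := by
  have hn := natCast_pos_of_neZero n
  ext a b p
  obtain ⟨h1, h2⟩ := h a b p
  by_cases hp : p = 0
  · subst hp
    by_cases hab : a = b
    · subst hab
      rw [h2 (by simp)]
      simp
    · have : (A a b).coeff 0 = 0 := by
        by_contra h0
        have := h1 h0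
        have := Fin.val_ne_of_ne hab
        simp at *
        omega
      rw [this, Matrix.one_apply_ne hab, Polynomial.coeff_zero]
  · have : (A a b).coeff p = 0 := by
      by_contra h0
      have := h1 h0
      have : (n : ℤ) * 1 ≤ n * p := by gcongr; omega
      simp at *
      omega
    rw [this, Matrix.one_apply]
    split_ifs <;> simp [Polynomial.coeff_one, hp]

/-- Division by the central element `X - ζ`. -/
theorem IsMonicBand.of_smul {d : ℕ} {ζ : ℂ} {F E : Folded n} (hζ : ζ ≠ 0)
    (hF : IsMonicBand (n + d) F) (h : F = (Polynomial.X - Polynomial.C ζ) • E) :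
    IsMonicBand d E := by
  have hn := natCast_pos_of_neZero n
  have h0 : ∀ a b, (F a b).coeff 0 = -ζ * (E a b).coeff 0 := fun a b => by
    rw [h, Matrix.smul_apply, smul_eq_mul, Polynomial.mul_coeff_zero]
    simp
  have h1 : ∀ a b p, (F a b).coeff (p + 1) = (E a b).coeff p - ζ * (E a b).coeff (p + 1) :=
    fun a b p => by
      rw [h, Matrix.smul_apply, smul_eq_mul, sub_mul, Polynomial.coeff_sub, Polynomial.coeff_X_mul,
        Polynomial.coeff_C_mul]
  -- In top degree the term with `ζ` is absent: the leading coefficient of an entry of `E` appears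
  -- in `F` one degree higher, that is, `n` diagonals lower.
  have hup : ∀ a b p, (E a b).coeff p ≠ 0 → (a : ℤ) - b + n * p ≤ d := by
    intro a b p hp
    have h2 := h1 a b (E a b).natDegree
    rw [Polynomial.coeff_eq_zero_of_natDegree_lt (Nat.lt_succ_self _), mul_zero, sub_zero] at h2
    have h3 := ((hF a b ((E a b).natDegree + 1)).1 (by
      rw [h2, Polynomial.coeff_natDegree, Polynomial.leadingCoeff_ne_zero]
      rintro h4
      simp [h4] at hp)).2
    have h4 : (n : ℤ) * p ≤ n * (E a b).natDegree := by
      gcongr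
      exact Polynomial.le_natDegree_of_ne_zero hp
    push_cast at h3
    rw [mul_add] at h3
    omega
  refine fun a b p => ⟨fun hp => ⟨?_, hup a b p hp⟩, fun hp => ?_⟩
  · rcases p with _ | p
    -- Triangularity concerns constant terms only, and these are proportional to those of `F`
    -- because `ζ ≠ 0`.
    · exact ((hF a b 0).1 (by rw [h0]; exact mul_ne_zero (neg_ne_zero.2 hζ) hp)).1
    · push_cast
      rw [mul_add]
      have : (n : ℤ) * 0 ≤ n * p := by gcongr; omega
      omega
  -- On the last diagonal the next coefficient of `E` already lies outside the band, so the
  -- normalization of `F` passes to `E`.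
  · have h2 : (E a b).coeff (p + 1) = 0 := by
      by_contra h3
      have := hup a b _ h3
      push_cast at this
      rw [mul_add] at this
      omega
    have h3 := (hF a b (p + 1)).2 (by push_cast; rw [mul_add]; omega)
    rwa [h1, h2, mul_zero, sub_zero] at h3

theorem exists_eq_smul_of_ev_eq_zero {ζ : ℂ} {F : Folded n} (h : ev ζ F = 0) :
    ∃ E : Folded n, F = (Polynomial.X - Polynomial.C ζ) • E := by
  have : ∀ a b, Polynomial.X - Polynomial.C ζ ∣ F a b := fun a b =>
    Polynomial.dvd_iff_isRoot.2 (congrFun (congrFun h a) b)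
  choose E hE using this
  exact ⟨Matrix.of E, by ext1 a b; exact hE a b⟩

theorem smul_left_cancel_folded {ζ : ℂ} {E F : Folded n}
    (h : (Polynomial.X - Polynomial.C ζ) • E = (Polynomial.X - Polynomial.C ζ) • F) : E = F := by
  ext1 a b
  exact mul_left_cancel₀ (Polynomial.X_sub_C_ne_zero ζ) (congrFun (congrFun h a) b)

theorem IsMonicBand.apply_eq {d : ℕ} (hd : d < n) {A : Folded n} (h : IsMonicBand d A)
    (a b : Fin n) : A a b = if b ≤ a then Polynomial.C ((A a b).coeff 0) else
      Polynomial.X * Polynomial.C ((A a b).coeff 1) := by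
  have hn := natCast_pos_of_neZero n
  ext p
  have h1 := (h a b p).1
  by_cases hab : b ≤ a
  · rw [if_pos hab, Polynomial.coeff_C]
    rw [Fin.le_def] at hab
    split_ifs with hp
    · rw [hp]
    · by_contra h0
      have := h1 h0
      have : (n : ℤ) * 1 ≤ n * p := by gcongr; omega
      omega
  · rw [if_neg hab]
    rw [Fin.le_def] at hab
    rcases p with _ | _ | p
    · rw [Polynomial.coeff_X_mul_zero]
      by_contra h0
      have := h1 h0
      simp at this
      omega
    · rw [Polynomial.coeff_X_mul, Polynomial.coeff_C_zero]
    · rw [Polynomial.coeff_X_mul, Polynomial.coeff_C_succ]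
      by_contra h0
      have := h1 h0
      have : (n : ℤ) * 0 ≤ n * p := by gcongr; omega
      push_cast at *
      rw [mul_add, mul_add] at *
      omega

theorem IsMonicBand.ev_eq {d : ℕ} (hd : d < n) {A : Folded n} (h : IsMonicBand d A)
    (z : ℂ) (a b : Fin n) : ev z A a b = if b ≤ a then (A a b).coeff 0 else
      z * (A a b).coeff 1 := by
  rw [ev_apply]
  conv_lhs => rw [h.apply_eq hd]
  split_ifs
  · simp
  · rw [Polynomial.eval_mul, Polynomial.eval_X, Polynomial.eval_C]

/-- Bandwidth below `n` leaves room for one monomial per entry: a constant on and below the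
diagonal, a multiple of the loop variable above it. One nonzero value of the parameter therefore
determines the matrix. -/
theorem IsMonicBand.ext_ev {d : ℕ} (hd : d < n) {A B : Folded n} (hA : IsMonicBand d A)
    (hB : IsMonicBand d B) {z : ℂ} (hz : z ≠ 0) (h : ev z A = ev z B) : A = B := by
  ext1 a b
  have h1 := congrFun (congrFun h a) b
  rw [hA.ev_eq hd, hB.ev_eq hd] at h1
  rw [hA.apply_eq hd, hB.apply_eq hd]
  split_ifs at h1 ⊢ with hab
  · rw [h1]
  · rw [mul_left_cancel₀ hz h1]

/-- The entries of a column of `ev z A` in the `k` rows cyclically preceding the diagonal. -/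
theorem IsMonicBand.ev_window {k : ℕ} (hkn : k < n) {A : Folded n}
    (h : IsMonicBand (n - k) A) (z : ℂ) (b : Fin n) {r : ℕ} (hr : r < k) {j : ℤ}
    (hj : idx n j = b) : ev z A (idx n (j - k + r)) b =
      if r = 0 then (if k ≤ (b : ℕ) then z else 1) else 0 := by
  subst hj
  have hn := natCast_pos_of_neZero n
  obtain ⟨b, s, rfl⟩ := exists_fin_add_mul (n := n) j
  rw [idx_add_mul, idx_coe]
  have hd : n - k < n := by omega
  obtain ⟨a, ha, hab⟩ : ∃ a : Fin n, idx n ((b : ℤ) + 1 + n * s - k + r) = a ∧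
      ((a : ℤ) = b - k + r ∨ (a : ℤ) = b - k + r + n ∧ (b : ℤ) - k + r < 0) := by
    rcases lt_or_ge ((b : ℤ) - k + r) 0 with h0 | h0
    · refine ⟨⟨((b : ℤ) - k + r + n).toNat, by omega⟩, ?_, Or.inr ⟨?_, h0⟩⟩
      · rw [show (b : ℤ) + 1 + n * s - k + r = (b - k + r + n + 1) + n * (s - 1) by ring, idx_add_mul]
        apply idx_eq_of
        simp only
        omega
      · simp only
        omega
    · refine ⟨⟨((b : ℤ) - k + r).toNat, by omega⟩, ?_, Or.inl ?_⟩
      · rw [show (b : ℤ) + 1 + n * s - k + r = (b - k + r + 1) + n * s by ring, idx_add_mul]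
        apply idx_eq_of
        simp only
        omega
      · simp only
        omega
  rw [ha, h.ev_eq hd]
  simp only [Fin.le_def]
  obtain ⟨h0, h0'⟩ := h a b 0
  obtain ⟨h1, h1'⟩ := h a b 1
  rw [Nat.cast_sub hkn.le] at *
  by_cases hr0 : r = 0
  · subst hr0
    rw [if_pos rfl]
    split_ifs with h3 h4 h4
    · omega
    · exact h0' (by push_cast at *; omega)
    · rw [h1' (by push_cast at *; omega), mul_one]
    · omega
  · rw [if_neg hr0]
    split_ifs with h3
    · by_contra h4
      have := h0 h4
      push_cast at *
      omega
    · by_contra h4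
      have := h1 (right_ne_zero_of_mul h4)
      push_cast at *
      omega

/-- This minor is triangular: entries below its diagonal fall outside the band, and its diagonal
consists of entries of the last diagonal of the band, equal to `1` or `z`. -/
theorem IsMonicBand.det_window_ne_zero {k : ℕ} (hkn : k < n) {A : Folded n}
    (h : IsMonicBand (n - k) A) {z : ℂ} (hz : z ≠ 0) (j : ℤ) :
    ((ev z A).submatrix (fun r : Fin k => idx n (j - k + (r : ℕ)))
      (fun s : Fin k => idx n (j + (s : ℕ)))).det ≠ 0 := by
  have key : ∀ r s : Fin k, s ≤ r → (ev z A) (idx n (j - k + (r : ℕ))) (idx n (j + (s : ℕ))) =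
      if (r : ℕ) - s = 0 then (if k ≤ ((idx n (j + (s : ℕ)) : Fin n) : ℕ) then z else 1) else 0 := by
    intro r s hsr
    rw [← h.ev_window hkn z _ (by omega : (r : ℕ) - s < k) rfl]
    rw [Fin.le_def] at hsr
    have h1 : j - (k : ℤ) + (r : ℕ) = j + (s : ℕ) - k + ((r - s : ℕ) : ℤ) := by
      push_cast [hsr]
      ring
    rw [h1]
  rw [Matrix.det_of_isUpperTriangular]
  · refine Finset.prod_ne_zero_iff.2 fun r _ => ?_
    rw [Matrix.submatrix_apply, key r r le_rfl]
    rw [if_pos (by omega)]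
    split_ifs
    · exact hz
    · exact one_ne_zero
  · intro r s hrs
    rw [Matrix.submatrix_apply, key r s hrs.le, if_neg]
    simp only [id_eq, Fin.lt_def] at hrs
    omega

end Band

/-! ### The matrix `g(N|t)` and its characterization. -/

section GMat

variable {k n : ℕ} [NeZero n]

/-- The `k` rows cyclically preceding row `j`. -/
def win (n k : ℕ) [NeZero n] (j : ℤ) : Fin k → Fin n := fun r => idx n (j - k + (r : ℕ))

theorem win_injective (hk : k ≤ n) (j : ℤ) : Function.Injective (win n k j) := by
  intro r s h
  rw [win, win, idx_eq_iff] at h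
  obtain ⟨c, hc⟩ := h
  have h1 : ((r : ℕ) : ℤ) - (s : ℕ) = n * c := by linarith
  have hn := natCast_pos_of_neZero n
  have h2 : c = 0 := by
    by_contra h0
    rcases lt_or_gt_of_ne h0 with h0 | h0
    · have : (n : ℤ) * c ≤ n * (-1) := by gcongr; omega
      omega
    · have : (n : ℤ) * 1 ≤ n * c := by gcongr; omega
      omega
  rw [h2] at h1
  ext
  omega

theorem image_win (j : ℤ) :
    (Finset.Icc (j - k) (j - 1)).image (idx n) = Finset.univ.image (win n k j) := by
  ext a
  simp only [Finset.mem_image, Finset.mem_Icc, Finset.mem_univ, true_and, win]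
  constructor
  · rintro ⟨m, hm, rfl⟩
    exact ⟨⟨(m - (j - k)).toNat, by omega⟩, by congr 1; simp only; omega⟩
  · rintro ⟨r, rfl⟩
    exact ⟨_, by omega, rfl⟩

/-- The Plücker coordinates of all cyclic intervals are nonzero. -/
def IsGeneric (N : Gr k n) : Prop :=
  ∀ j ∈ Finset.Icc (1 : ℤ) n, pl N (Finset.Icc (j - k) (j - 1)) ≠ 0

/-- Windows depend on `j` only modulo `n`, and listing their rows cyclically instead of in
increasing order changes a minor by a sign only. -/
theorem isGeneric_iff (hk : k ≤ n) {N : Gr k n} :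
    IsGeneric N ↔ ∀ j : ℤ, (N.rep.submatrix (win n k j) id).det ≠ 0 := by
  have key : ∀ j : ℤ, pl N (Finset.Icc (j - k) (j - 1)) ≠ 0 ↔
      (N.rep.submatrix (win n k j) id).det ≠ 0 := fun j =>
    pl_ne_zero_iff_det N (win_injective hk j) (image_win j)
  refine ⟨fun h j => ?_, fun h j _ => (key j).2 (h j)⟩
  obtain ⟨a, s, rfl⟩ := exists_fin_add_mul (n := n) j
  have : win n k (a + 1 + n * s) = win n k (a + 1) := by
    ext r : 1
    rw [win, win, ← idx_add_mul (a + 1 - k + (r : ℕ) : ℤ) s]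
    congr 1
    ring
  rw [this]
  exact (key _).1 (h _ (Finset.mem_Icc.2 (by omega)))

theorem IsGeneric.pl_ne_zero (hk : k ≤ n) {N : Gr k n} (h : IsGeneric N) (j : ℤ) :
    pl N (Finset.Icc (j - k) (j - 1)) ≠ 0 :=
  (pl_ne_zero_iff_det N (win_injective hk j) (image_win j)).2 ((isGeneric_iff hk).1 h j)

theorem IsGeneric.eq_zero (hk : k ≤ n) {N : Gr k n} (h : IsGeneric N) (j : ℤ) {v : Fin n → ℂ}
    (hv : v ∈ N.1) (h0 : ∀ r : Fin k, v (idx n (j - k + (r : ℕ))) = 0) : v = 0 :=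
  eq_zero_of_det_ne_zero ((isGeneric_iff hk).1 h j) hv h0

/-- The matrix `g(N|t)`, without regard to its domain of definition. -/
def gMat (x : XX n k) : Folded n :=
  Matrix.of fun a b =>
    let i : ℤ := (a : ℕ) + 1
    let j : ℤ := (b : ℕ) + 1
    (if j ≤ k then 1 else if j ≤ i then Polynomial.C (x.2 : ℂ) else Polynomial.X) *
      Polynomial.C (pl x.1 (insert i (Finset.Icc (j - k + 1) (j - 1))) /
        pl x.1 (Finset.Icc (j - k) (j - 1)))

theorem g_eq {x : XX n k} (h : IsGeneric x.1) : g x = Part.some (gMat x) :=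
  Part.eq_some_iff.2 ⟨h, rfl⟩

/-- The value of the loop parameter at which `g(N|t)` has image `N`. -/
def spec (x : XX n k) : ℂ := (-1) ^ (k - 1) * (x.2 : ℂ)

theorem spec_ne_zero (x : XX n k) : spec x ≠ 0 :=
  mul_ne_zero (pow_ne_zero _ (by norm_num)) x.2.ne_zero

theorem pl_insert_eq_zero (N : Gr k n) {s : Finset ℤ} {i m : ℤ} (hm : m ∈ s)
    (him : idx n i = idx n m) (hs : s.card < k) : pl N (insert i s) = 0 := by
  refine pl_eq_zero N (ne_of_lt (lt_of_le_of_lt ?_ hs))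
  rw [Finset.image_insert, him, Finset.insert_eq_of_mem (Finset.mem_image_of_mem _ hm)]
  exact Finset.card_image_le

theorem insert_Icc_left (hk : 1 ≤ k) (j : ℤ) :
    insert (j - k) (Finset.Icc (j - k + 1) (j - 1)) = Finset.Icc (j - k) (j - 1) := by
  ext m
  simp only [Finset.mem_insert, Finset.mem_Icc]
  omega

theorem insert_Icc_right (hk : 1 ≤ k) (j : ℤ) :
    insert j (Finset.Icc (j - k + 1) (j - 1)) = Finset.Icc (j - k + 1) j := by
  ext m
  simp only [Finset.mem_insert, Finset.mem_Icc]
  omega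

theorem idx_sub_natCast (m : ℤ) : idx n (m - n) = idx n m := by
  have := idx_add_mul (n := n) m (-1)
  rwa [mul_neg_one] at this

theorem card_Icc_lt (hk : 1 ≤ k) (j : ℤ) : (Finset.Icc (j - k + 1) (j - 1)).card < k := by
  rw [Int.card_Icc]; omega

/-- Outside the band the row index repeats an element of the interval modulo `n`, so the Plücker
coordinate vanishes. On the last diagonal the row is congruent to `j - k`, and numerator and
denominator coincide. -/
theorem gMat_isMonicBand (hk : 1 ≤ k) (hkn : k < n) {x : XX n k} (hx : IsGeneric x.1) :
    IsMonicBand (n - k) (gMat x) := by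
  intro a b p
  set j : ℤ := (b : ℕ) + 1 with hj
  set i : ℤ := (a : ℕ) + 1 with hi
  set P := pl x.1 (insert i (Finset.Icc (j - k + 1) (j - 1))) / pl x.1 (Finset.Icc (j - k) (j - 1))
    with hP
  have hP0 : ∀ m ∈ Finset.Icc (j - k + 1) (j - 1), idx n i = idx n m → P = 0 := by
    intro m hm him
    rw [hP, pl_insert_eq_zero _ hm him (card_Icc_lt hk j), zero_div]
  have hP1 : idx n i = idx n (j - k) → P = 1 := by
    intro h
    rw [hP, pl_congr x.1 (J := Finset.Icc (j - k) (j - 1)) ?_, div_self (hx.pl_ne_zero hkn.le j)]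
    rw [Finset.image_insert, h, ← Finset.image_insert, insert_Icc_left hk]
  have hco : (gMat x a b).coeff p = (if j ≤ k then (if p = 0 then P else 0) else if j ≤ i then
      (if p = 0 then x.2 * P else 0) else (if p = 1 then P else 0)) := by
    change ((if j ≤ k then 1 else if j ≤ i then Polynomial.C (x.2 : ℂ) else Polynomial.X) *
      Polynomial.C P).coeff p = _
    split_ifs <;> simp_all [Polynomial.coeff_C, Polynomial.coeff_X, eq_comm]
  rw [hco]
  have hab : (a : ℤ) - b = i - j := by omega
  rw [hab]
  have hp2 : 2 ≤ p → (n : ℤ) * 2 ≤ n * p := fun h => by gcongr; exact_mod_cast h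
  have hcast : ((n - k : ℕ) : ℤ) = n - k := by omega
  rw [hcast]
  have hp : p = 0 ∨ p = 1 ∨ 2 ≤ p := by omega
  split_ifs with h1 h2 h2 h3 h3
  · subst h2
    simp only [Nat.cast_zero, mul_zero, add_zero]
    refine ⟨fun h => ?_, fun h => hP1 ?_⟩
    · constructor <;> by_contra h3
      · exact h (hP0 i (Finset.mem_Icc.2 (by omega)) rfl)
      · exact h (hP0 (i - n) (Finset.mem_Icc.2 (by omega)) (idx_sub_natCast i).symm)
    · rw [← idx_sub_natCast i]
      congr 1
      omega
  · refine ⟨fun h => absurd rfl h, fun h => ?_⟩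
    rcases hp with rfl | rfl | hp
    · omega
    · push_cast at h
      omega
    · have := hp2 hp
      omega
  · subst h3
    simp only [Nat.cast_zero, mul_zero, add_zero]
    exact ⟨fun h => by omega, fun h => by omega⟩
  · refine ⟨fun h => absurd rfl h, fun h => ?_⟩
    rcases hp with rfl | rfl | hp
    · omega
    · push_cast at h
      omega
    · have := hp2 hp
      omega
  · subst h3
    simp only [Nat.cast_one, mul_one]
    refine ⟨fun h => ?_, fun h => hP1 ?_⟩
    · refine ⟨by omega, ?_⟩
      by_contra h3
      exact h (hP0 i (Finset.mem_Icc.2 (by omega)) rfl)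
    · congr 1
      omega
  · refine ⟨fun h => absurd rfl h, fun h => ?_⟩
    rcases hp with rfl | rfl | hp
    · simp at h
      omega
    · omega
    · have := hp2 hp
      omega

theorem pl_eq_det_of_strictMono (N : Gr k n) {I : Finset ℤ} {f : Fin k → Fin n} (hf : StrictMono f)
    (h : ∀ p, ∃ m ∈ I, idx n m = f p) (hI : I.card ≤ k) : pl N I = (N.rep.submatrix f id).det := by
  refine pl_of_strictMono N hf (Finset.eq_of_subset_of_card_le ?_ ?_)
  · intro a ha
    obtain ⟨p, -, rfl⟩ := Finset.mem_image.1 ha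
    obtain ⟨m, hm, h⟩ := h p
    exact Finset.mem_image.2 ⟨m, hm, h⟩
  · rw [Finset.card_image_of_injective _ hf.injective, Finset.card_univ, Fintype.card_fin]
    exact Finset.card_image_le.trans hI

theorem card_insert_Icc_le (hk : 1 ≤ k) (i j : ℤ) :
    (insert i (Finset.Icc (j - k + 1) (j - 1))).card ≤ k :=
  (Finset.card_insert_le _ _).trans (card_Icc_lt hk j)

theorem gMat_col_mem_of_lt (hk : 1 ≤ k) (hkn : k < n) (x : XX n k) (b : Fin n) (hb : (b : ℕ) < k) :
    (ev (spec x) (gMat x)).col b ∈ x.1.1 := by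
  obtain ⟨j, hj⟩ : ∃ j : ℤ, j = (b : ℕ) + 1 := ⟨_, rfl⟩
  -- The residues of `[j-k, j-1]` in increasing order form two blocks, because the interval wraps
  -- around. Position `q` holds the residue of `j - k`, which is to be replaced by the row `a`.
  let f : Fin k → Fin n := fun p => if (p : ℕ) < b then ⟨p, by omega⟩ else ⟨p + (n - k), by omega⟩
  let q : Fin k := ⟨b, hb⟩
  have hf : ∀ p : Fin k, ((f p : Fin n) : ℕ) = if (p : ℕ) < b then (p : ℕ) else p + (n - k) := by
    intro p
    simp only [f]
    split_ifs <;> rfl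
  have key : ∀ a : Fin n, pl x.1 (insert ((a : ℕ) + 1 : ℤ) (Finset.Icc (j - k + 1) (j - 1))) =
      (x.1.rep.submatrix (Function.update f q a) id).det := by
    intro a
    -- In this range row `a` is already in sorted place, so no sign occurs; otherwise it repeats a
    -- row and both sides vanish.
    by_cases ha : (b : ℕ) ≤ a ∧ (a : ℕ) ≤ b + (n - k)
    · refine pl_eq_det_of_strictMono _ ?_ ?_ (card_insert_Icc_le hk _ _)
      · intro p p' hpp
        rw [Fin.lt_def] at hpp ⊢
        simp only [Function.update_apply]
        split_ifs with h1 h2 h2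
        · omega
        · have h4 := hf p'
          rw [h1] at hpp
          simp only [q] at hpp
          rw [if_neg (by omega)] at h4
          omega
        · have h4 := hf p
          rw [h2] at hpp
          simp only [q] at hpp
          rw [if_pos (by omega)] at h4
          omega
        · rw [hf, hf]
          split_ifs <;> omega
      · intro p
        rcases lt_trichotomy (p : ℕ) b with h | h | h
        · refine ⟨p + 1, Finset.mem_insert_of_mem (Finset.mem_Icc.2 (by omega)), idx_eq_of ?_⟩
          rw [Function.update_of_ne (by rintro rfl; simp [q] at h), hf, if_pos h]
        · refine ⟨a + 1, Finset.mem_insert_self _ _, idx_eq_of ?_⟩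
          rw [show p = q from Fin.ext h, Function.update_self]
        · refine ⟨p + 1 - k, Finset.mem_insert_of_mem (Finset.mem_Icc.2 (by omega)), ?_⟩
          rw [← idx_add_mul _ 1]
          refine idx_eq_of ?_
          rw [Function.update_of_ne (by rintro rfl; simp [q] at h), hf, if_neg (by omega)]
          push_cast [hkn.le]
          ring
    · rw [not_and_or, not_le, not_le] at ha
      rcases ha with ha | ha
      · rw [pl_insert_eq_zero _ (m := a + 1) (Finset.mem_Icc.2 (by omega)) rfl (card_Icc_lt hk _)]
        have h1 : f ⟨a, by omega⟩ = a := by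
          ext
          rw [hf, if_pos ha]
        rw [← h1, det_update_of_ne]
        simp [q, Fin.ext_iff, ha.ne]
      · rw [pl_insert_eq_zero _ (m := a + 1 - n) (Finset.mem_Icc.2 (by omega))
          (idx_sub_natCast _).symm (card_Icc_lt hk _)]
        have h1 : f ⟨a - (n - k), by omega⟩ = a := by
          ext
          rw [hf, if_neg (by simp only; omega)]
          simp only
          omega
        rw [← h1, det_update_of_ne]
        simp only [q, ne_eq, Fin.ext_iff]
        omega
  have : (ev (spec x) (gMat x)).col b = (pl x.1 (Finset.Icc (j - k) (j - 1)))⁻¹ •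
      fun a => (x.1.rep.submatrix (Function.update f q a) id).det := by
    ext a
    rw [Matrix.col_apply, ev_apply, gMat, Matrix.of_apply]
    simp only [← hj]
    rw [if_pos (by omega), one_mul, Polynomial.eval_C, key a]
    simp [div_eq_inv_mul]
  rw [this]
  exact Submodule.smul_mem _ _ (det_update_mem x.1 f q)

/-- In these columns the replaced row comes first when it lies above the diagonal and last
otherwise. Sorting costs the sign `(-1)^(k-1)`, which is exactly the discrepancy between the factors
`λ = spec x` above the diagonal and `t` on and below it. -/
theorem gMat_col_mem_of_le (hk : 1 ≤ k) (hkn : k < n) (x : XX n k) (b : Fin n) (hb : k ≤ (b : ℕ)) :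
    (ev (spec x) (gMat x)).col b ∈ x.1.1 := by
  obtain ⟨k, rfl⟩ : ∃ k', k = k' + 1 := ⟨k - 1, by omega⟩
  obtain ⟨j, hj⟩ : ∃ j : ℤ, j = (b : ℕ) + 1 := ⟨_, rfl⟩
  let f : Fin (k + 1) → Fin n := fun p => ⟨b - (k + 1) + p, by omega⟩
  have key : ∀ a : Fin n, a < b →
      pl x.1 (insert ((a : ℕ) + 1 : ℤ) (Finset.Icc (j - (k + 1 : ℕ) + 1) (j - 1))) =
      (x.1.rep.submatrix (Function.update f 0 a) id).det := by
    intro a hab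
    rw [Fin.lt_def] at hab
    by_cases ha : (a : ℕ) ≤ b - (k + 1)
    · refine pl_eq_det_of_strictMono _ ?_ ?_ (card_insert_Icc_le hk _ _)
      · intro p p' hpp
        rw [Fin.lt_def] at hpp ⊢
        simp only [Function.update_apply, Fin.ext_iff, Fin.val_zero]
        split_ifs with h1 h2 h2 <;> (try simp only [f]) <;> omega
      · intro p
        by_cases h : p = 0
        · subst h
          refine ⟨a + 1, Finset.mem_insert_self _ _, idx_eq_of ?_⟩
          rw [Function.update_self]
        · have h' : (p : ℕ) ≠ 0 := fun h0 => h (Fin.ext h0)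
          refine ⟨b - (k + 1) + p + 1, Finset.mem_insert_of_mem (Finset.mem_Icc.2 ?_), idx_eq_of ?_⟩
          · push_cast
            omega
          · rw [Function.update_of_ne h]
            simp only [f]
            omega
    · rw [pl_insert_eq_zero _ (m := a + 1) (Finset.mem_Icc.2 (by push_cast; omega)) rfl
        (card_Icc_lt hk _)]
      have h1 : f ⟨a - (b - (k + 1)), by omega⟩ = a := by
        ext
        simp only [f]
        omega
      rw [← h1, det_update_of_ne]
      simp only [ne_eq, Fin.ext_iff, Fin.val_zero]
      omega
  have key' : ∀ a : Fin n, b ≤ a →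
      pl x.1 (insert ((a : ℕ) + 1 : ℤ) (Finset.Icc (j - (k + 1 : ℕ) + 1) (j - 1))) =
      (-1) ^ k * (x.1.rep.submatrix (Function.update f 0 a) id).det := by
    intro a hab
    rw [Fin.le_def] at hab
    -- Moving the new row from first to last place is a cycle of length `k + 1`, of sign `(-1)^k`;
    -- here `k + 1` is the dimension of the subspace.
    have hs : (x.1.rep.submatrix (Function.update f 0 a ∘ finRotate (k + 1)) id).det =
        (-1) ^ k * (x.1.rep.submatrix (Function.update f 0 a) id).det := by
      have := Matrix.det_permute (finRotate (k + 1))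
        (x.1.rep.submatrix (Function.update f 0 a) id)
      rw [sign_finRotate] at this
      simpa using this
    rw [← hs]
    have hr : ∀ p : Fin (k + 1), (((Function.update f 0 a ∘ finRotate (k + 1)) p : Fin n) : ℕ) =
        if (p : ℕ) = k then (a : ℕ) else b - (k + 1) + (p + 1) := by
      intro p
      rw [Function.comp_apply]
      by_cases h : p = Fin.last k
      · subst h
        simp
      · have h' : (p : ℕ) < k := Fin.val_lt_last h
        rw [if_neg (by omega), finRotate_of_lt h', Function.update_of_ne]
        rw [ne_eq, Fin.ext_iff]
        simp
    refine pl_eq_det_of_strictMono _ ?_ ?_ (card_insert_Icc_le hk _ _)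
    · intro p p' hpp
      rw [Fin.lt_def] at hpp ⊢
      rw [hr, hr]
      split_ifs <;> omega
    · intro p
      by_cases h : (p : ℕ) = k
      · refine ⟨a + 1, Finset.mem_insert_self _ _, idx_eq_of ?_⟩
        rw [hr, if_pos h]
      · refine ⟨b - (k + 1) + (p + 1) + 1, Finset.mem_insert_of_mem (Finset.mem_Icc.2 ?_),
          idx_eq_of ?_⟩
        · push_cast
          omega
        · rw [hr, if_neg h]
          omega
  have : (ev (spec x) (gMat x)).col b = (spec x * (pl x.1 (Finset.Icc (j - (k + 1 : ℕ)) (j - 1)))⁻¹) •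
      fun a => (x.1.rep.submatrix (Function.update f 0 a) id).det := by
    ext a
    rw [Matrix.col_apply, ev_apply, gMat, Matrix.of_apply]
    simp only [← hj]
    rw [if_neg (by omega)]
    by_cases hab : b ≤ a
    · rw [if_pos (by rw [Fin.le_def] at hab; omega), key' a hab]
      simp [spec, div_eq_mul_inv]
      ring
    · rw [if_neg (by rw [Fin.le_def] at hab; omega), key a (not_le.1 hab)]
      simp [div_eq_mul_inv]
      ring
  rw [this]
  exact Submodule.smul_mem _ _ (det_update_mem x.1 f 0)

theorem gMat_col_mem (hk : 1 ≤ k) (hkn : k < n) (x : XX n k) (b : Fin n) :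
    (ev (spec x) (gMat x)).col b ∈ x.1.1 :=
  (lt_or_ge (b : ℕ) k).elim (gMat_col_mem_of_lt hk hkn x b) (gMat_col_mem_of_le hk hkn x b)

/-- The first `k` columns of a matrix. -/
def firstCols (k : ℕ) (M : Matrix (Fin n) (Fin n) ℂ) : Matrix (Fin n) (Fin k) ℂ :=
  M.submatrix id fun s => idx n (1 + (s : ℕ))

theorem firstCols_mul (M M' : Matrix (Fin n) (Fin n) ℂ) :
    firstCols k (M * M') = M * firstCols k M' := rfl

theorem finrank_firstCols (hkn : k < n) {A : Folded n} (h : IsMonicBand (n - k) A) {z : ℂ}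
    (hz : z ≠ 0) : Module.finrank ℂ (LinearMap.range (firstCols k (ev z A)).mulVecLin) = k :=
  finrank_range_of_det_ne_zero (h.det_window_ne_zero hkn hz 1)

theorem proj_eq (hkn : k ≤ n) (N₀ : Gr k n) (z : ℂˣ) {A : Folded n}
    (h : Module.finrank ℂ (LinearMap.range
      (firstCols k (ev ((-1) ^ (k - 1) * (z : ℂ)) A)).mulVecLin) = k) :
    proj k z A = Part.some (Gr.mkD N₀ (LinearMap.range
      (firstCols k (ev ((-1) ^ (k - 1) * (z : ℂ)) A)).mulVecLin), z) := by
  have : Submodule.span ℂ {v : Fin n → ℂ | ∃ j : Fin n, (j : ℕ) < k ∧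
      v = fun i => (A i j).eval ((-1) ^ (k - 1) * (z : ℂ))} =
      LinearMap.range (firstCols k (ev ((-1) ^ (k - 1) * (z : ℂ)) A)).mulVecLin := by
    rw [Matrix.range_mulVecLin]
    congr 1
    ext v
    constructor
    · rintro ⟨j, hj, rfl⟩
      refine ⟨⟨j, hj⟩, ?_⟩
      ext i
      simp only [firstCols, Matrix.col_apply, Matrix.submatrix_apply, id, ev_apply]
      rw [add_comm, idx_coe]
    · rintro ⟨s, rfl⟩
      refine ⟨⟨s, by omega⟩, s.2, ?_⟩
      ext i
      simp only [firstCols, Matrix.col_apply, Matrix.submatrix_apply, id, ev_apply]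
      rw [idx_eq_of (i := ⟨s, by omega⟩) (by simp only; ring)]
  rw [proj, this, Gr.mk?_eq N₀ h]
  exact Part.bind_some _ _

theorem range_le_of_col_mem {m : ℕ} {B : Matrix (Fin n) (Fin m) ℂ} {N : Submodule ℂ (Fin n → ℂ)}
    (h : ∀ b, B.col b ∈ N) : LinearMap.range B.mulVecLin ≤ N := by
  rw [Matrix.range_mulVecLin, Submodule.span_le]
  rintro _ ⟨b, rfl⟩
  exact h b

theorem range_firstCols_eq (hkn : k < n) {A : Folded n} (h : IsMonicBand (n - k) A) {z : ℂ}
    (hz : z ≠ 0) {N : Gr k n} (hN : ∀ b, (ev z A).col b ∈ N.1) :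
    LinearMap.range (firstCols k (ev z A)).mulVecLin = N.1 :=
  Submodule.eq_of_le_of_finrank_eq (range_le_of_col_mem fun _ => hN _)
    ((finrank_firstCols hkn h hz).trans N.2.symm)

theorem range_ev_eq (hkn : k < n) {A : Folded n} (h : IsMonicBand (n - k) A) {z : ℂ}
    (hz : z ≠ 0) {N : Gr k n} (hN : ∀ b, (ev z A).col b ∈ N.1) :
    LinearMap.range (ev z A).mulVecLin = N.1 := by
  refine le_antisymm (range_le_of_col_mem hN) ?_
  rw [← range_firstCols_eq hkn h hz hN]
  exact range_le_of_col_mem fun b => col_mem_range _ _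

/-- Columns `j, …, j + k - 1` are combinations of a basis of `N`, so their nonzero window minor is a
multiple of the corresponding minor of `N`. -/
theorem isGeneric_of_col_mem (hkn : k < n) {A : Folded n} (h : IsMonicBand (n - k) A) {z : ℂ}
    (hz : z ≠ 0) {N : Gr k n} (hN : ∀ b, (ev z A).col b ∈ N.1) : IsGeneric N := by
  refine (isGeneric_iff hkn.le).2 fun j h0 => h.det_window_ne_zero hkn hz j ?_
  obtain ⟨T, hT⟩ := exists_eq_mul_of_col_mem (B := N.rep)
    (C := (ev z A).submatrix id fun s : Fin k => idx n (j + (s : ℕ))) fun s => by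
      rw [range_rep]; exact hN _
  have : (ev z A).submatrix (fun r : Fin k => idx n (j - k + (r : ℕ)))
      (fun s : Fin k => idx n (j + (s : ℕ))) = N.rep.submatrix (win n k j) id * T := by
    ext r s
    exact congrFun (congrFun hT (win n k j r)) s
  rw [this, Matrix.det_mul, h0, zero_mul]

/-- The band shape prescribes column `b` on the `k` rows cyclically preceding the diagonal. The
difference of the two columns is then a vector of `N` vanishing on a window, hence zero by
genericity. -/
theorem eq_of_col_mem (hk : 1 ≤ k) (hkn : k < n) {A B : Folded n} (hA : IsMonicBand (n - k) A)
    (hB : IsMonicBand (n - k) B) {z : ℂ} (hz : z ≠ 0) {N : Gr k n}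
    (hAN : ∀ b, (ev z A).col b ∈ N.1) (hBN : ∀ b, (ev z B).col b ∈ N.1) : A = B := by
  have hN := isGeneric_of_col_mem hkn hA hz hAN
  refine hA.ext_ev (by omega) hB hz ?_
  ext a b
  have := hN.eq_zero hkn.le (b + 1) (v := (ev z A).col b - (ev z B).col b)
    (Submodule.sub_mem _ (hAN b) (hBN b)) fun r => by
      rw [Pi.sub_apply, Matrix.col_apply, Matrix.col_apply,
        hA.ev_window hkn z b r.2 (idx_coe b), hB.ev_window hkn z b r.2 (idx_coe b), sub_self]
  exact sub_eq_zero.1 (congrFun this a)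

/-- A monic band matrix with image `N` at the special value is `g(N|t)`. -/
theorem gMat_eq_of_col_mem (hk : 1 ≤ k) (hkn : k < n) {A : Folded n} (hA : IsMonicBand (n - k) A)
    {x : XX n k} (hN : ∀ b, (ev (spec x) A).col b ∈ x.1.1) : IsGeneric x.1 ∧ gMat x = A := by
  have h := isGeneric_of_col_mem hkn hA (spec_ne_zero x) hN
  exact ⟨h, eq_of_col_mem hk hkn (gMat_isMonicBand hk hkn h) hA (spec_ne_zero x)
    (gMat_col_mem hk hkn x) hN⟩

theorem range_gMat (hk : 1 ≤ k) (hkn : k < n) {x : XX n k} (hx : IsGeneric x.1) :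
    LinearMap.range (ev (spec x) (gMat x)).mulVecLin = x.1.1 :=
  range_ev_eq hkn (gMat_isMonicBand hk hkn hx) (spec_ne_zero x) (gMat_col_mem hk hkn x)

theorem range_firstCols_gMat (hk : 1 ≤ k) (hkn : k < n) {x : XX n k} (hx : IsGeneric x.1) :
    LinearMap.range (firstCols k (ev (spec x) (gMat x))).mulVecLin = x.1.1 :=
  range_firstCols_eq hkn (gMat_isMonicBand hk hkn hx) (spec_ne_zero x) (gMat_col_mem hk hkn x)

theorem gMat_injective (hk : 1 ≤ k) (hkn : k < n) {x y : XX n k} (hx : IsGeneric x.1)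
    (hy : IsGeneric y.1) (ht : x.2 = y.2) (h : gMat x = gMat y) : x = y := by
  refine Prod.ext (Subtype.ext ?_) ht
  rw [← range_gMat hk hkn hx, ← range_gMat hk hkn hy, h, spec, spec, ht]

end GMat

/-! ### Reflection, duality and refactorization. -/

section Symmetries

variable {k l n : ℕ} [NeZero n]

theorem fl_fl (A : Folded n) : fl (fl A) = A := by
  ext1 a b
  simp [fl]

theorem fl_mul (A B : Folded n) : fl (A * B) = fl B * fl A := by
  ext1 a b
  simp only [fl, Matrix.of_apply, Matrix.mul_apply]
  rw [← Equiv.sum_comp Fin.revPerm]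
  exact Finset.sum_congr rfl fun c _ => mul_comm _ _

theorem IsMonicBand.fl {d : ℕ} {A : Folded n} (h : IsMonicBand d A) : IsMonicBand d (fl A) := by
  intro a b p
  have := h b.rev a.rev p
  have h1 : ((b.rev : ℕ) : ℤ) - (a.rev : ℕ) = (a : ℕ) - (b : ℕ) := by
    rw [Fin.val_rev, Fin.val_rev]
    omega
  rw [h1] at this
  exact this

theorem ev_fl (z : ℂ) (A : Folded n) :
    ev z (fl A) = (ev z A).transpose.submatrix Fin.revPerm Fin.revPerm :=
  rfl

/-- The Schützenberger involution, without regard to its domain of definition. -/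
def schutz (x : XX n k) : XX n k :=
  (Gr.mkD x.1 (LinearMap.range (firstCols k (ev (spec x) (fl (gMat x)))).mulVecLin), x.2)

theorem S_eq (hk : 1 ≤ k) (hkn : k < n) {x : XX n k} (hx : IsGeneric x.1) :
    S x = Part.some (schutz x) := by
  rw [S, g_eq hx, Part.bind_some]
  exact proj_eq hkn.le x.1 x.2
    (finrank_firstCols hkn (gMat_isMonicBand hk hkn hx).fl (spec_ne_zero x))

/-- Reflection is a transposition with both orders reversed, so at `spec x` it keeps the rank `k`.
All columns then lie in the span of the first `k`, and the characterization of `g` applies. -/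
theorem schutz_spec (hk : 1 ≤ k) (hkn : k < n) {x : XX n k} (hx : IsGeneric x.1) :
    IsGeneric (schutz x).1 ∧ gMat (schutz x) = fl (gMat x) := by
  have hb := (gMat_isMonicBand hk hkn hx).fl
  have hf := finrank_firstCols hkn hb (spec_ne_zero x)
  refine gMat_eq_of_col_mem hk hkn hb fun b => ?_
  have h1 : (schutz x).1.1 = LinearMap.range (ev (spec x) (fl (gMat x))).mulVecLin := by
    refine (Gr.coe_mkD x.1 hf).trans (Submodule.eq_of_le_of_finrank_eq
      (range_le_of_col_mem fun b => col_mem_range _ _) (hf.trans ?_))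
    change _ = Matrix.rank _
    rw [ev_fl, Matrix.rank_submatrix, Matrix.rank_transpose]
    rw [Matrix.rank, range_gMat hk hkn hx, x.1.2]
  rw [h1]
  exact col_mem_range _ b

theorem schutz_schutz (hk : 1 ≤ k) (hkn : k < n) {x : XX n k} (hx : IsGeneric x.1) :
    schutz (schutz x) = x := by
  have h1 := schutz_spec hk hkn hx
  have h2 := schutz_spec hk hkn h1.1
  exact gMat_injective hk hkn h2.1 hx rfl (by rw [h2.2, h1.2, fl_fl])

/-- The sign twist of folded matrices. -/
def tw (d : ℕ) (A : Folded n) : Folded n := Matrix.of fun a b =>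
  Polynomial.C ((-1) ^ (d + a + b)) * (A a b).comp (Polynomial.C ((-1) ^ n) * Polynomial.X)

theorem ev_tw (d : ℕ) (A : Folded n) (z : ℂ) (a b : Fin n) :
    ev z (tw d A) a b = (-1) ^ (d + a + b : ℕ) * ev ((-1) ^ n * z) A a b := by
  simp [tw]

/-- In the unfolded matrix the twist multiplies each entry by `(-1)^d` times a sign that depends on
the parity of row minus column, and such signs are multiplicative. -/
theorem tw_mul (d e : ℕ) (A B : Folded n) : tw (d + e) (A * B) = tw d A * tw e B := by
  refine folded_ext ∅ Set.finite_empty fun z _ => ?_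
  ext a b
  rw [ev_tw, map_mul, map_mul, Matrix.mul_apply, Matrix.mul_apply, Finset.mul_sum]
  refine Finset.sum_congr rfl fun c _ => ?_
  rw [ev_tw, ev_tw]
  have : ((-1 : ℂ)) ^ (d + a + c : ℕ) * (-1) ^ (e + c + b : ℕ) = (-1) ^ (d + e + a + b : ℕ) := by
    rw [← pow_add, show (d + a + c + (e + c + b) : ℕ) = (d + e + a + b) + 2 * c by ring, pow_add,
      pow_mul]
    simp
  rw [← this]
  ring

theorem tw_tw (d : ℕ) (A : Folded n) : tw d (tw d A) = A := by
  refine folded_ext ∅ Set.finite_empty fun z _ => ?_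
  ext a b
  rw [ev_tw, ev_tw, ← mul_assoc, ← mul_assoc, ← mul_pow, ← mul_pow]
  simp

/-- The offset `d` in the sign restores the ones on diagonal `d`. -/
theorem IsMonicBand.tw {d : ℕ} {A : Folded n} (h : IsMonicBand d A) : IsMonicBand d (tw d A) := by
  intro a b p
  have hc : (GeomR.tw d A a b).coeff p = (-1) ^ (d + a + b + n * p : ℕ) * (A a b).coeff p := by
    rw [GeomR.tw, Matrix.of_apply, Polynomial.coeff_C_mul, Polynomial.comp_C_mul_X_coeff, ← pow_mul]
    ring
  rw [hc]
  refine ⟨fun h0 => (h a b p).1 (right_ne_zero_of_mul h0), fun h0 => ?_⟩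
  rw [(h a b p).2 h0, mul_one]
  refine Even.neg_one_pow ⟨d + b, ?_⟩
  zify
  linarith

theorem mem_dual_iff (N : Submodule ℂ (Fin n → ℂ)) (v : Fin n → ℂ) :
    v ∈ (Matrix.toBilin' (Matrix.diagonal fun i : Fin n => (-1 : ℂ) ^ (i : ℕ))).orthogonal N ↔
      ∀ u ∈ N, ∑ i : Fin n, (-1) ^ (i : ℕ) * v i * u i = 0 := by
  rw [LinearMap.BilinForm.mem_orthogonal_iff]
  refine forall₂_congr fun u _ => ?_
  rw [Matrix.toBilin'_apply']
  simp only [Matrix.mulVec_diagonal, dotProduct]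
  refine Eq.congr_left (Finset.sum_congr rfl fun i _ => ?_)
  ring

theorem finrank_dual (N : Gr k n) : Module.finrank ℂ
    (((Matrix.toBilin' (Matrix.diagonal fun i : Fin n => (-1 : ℂ) ^ (i : ℕ))).orthogonal N.1).map
      (LinearMap.funLeft ℂ ℂ (Fin.rev : Fin n → Fin n)) : Submodule ℂ (Fin n → ℂ)) = n - k := by
  have h := LinearEquiv.finrank_map_eq (LinearEquiv.funCongrLeft ℂ ℂ (Fin.revPerm (n := n)))
    ((Matrix.toBilin' (Matrix.diagonal fun i : Fin n => (-1 : ℂ) ^ (i : ℕ))).orthogonal N.1)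
  refine h.trans ?_
  rw [LinearMap.BilinForm.finrank_orthogonal, N.2, Module.finrank_fin_fun]
  refine Matrix.Nondegenerate.toBilin' (Matrix.nondegenerate_of_det_ne_zero ?_)
  rw [Matrix.det_diagonal]
  exact Finset.prod_ne_zero_iff.2 fun i _ => pow_ne_zero _ (by norm_num)

/-- The duality map `μ`. -/
def dualPt (x : XX n k) : XX n (n - k) := (⟨_, finrank_dual x.1⟩, x.2)

theorem dual_eq (x : XX n k) : dual x = Part.some (dualPt x) := by
  rw [dual, Gr.mk?_eq (dualPt x).1 (finrank_dual x.1)]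
  refine Part.eq_some_iff.2 (Part.mem_map_iff _ |>.2 ⟨_, Part.mem_some _, ?_⟩)
  exact Prod.ext (Subtype.ext (Gr.coe_mkD _ (finrank_dual x.1))) rfl

theorem spec_dualPt (hk : 1 ≤ k) (hkn : k < n) (x : XX n k) :
    spec (dualPt x) = (-1) ^ n * spec x := by
  change (-1) ^ (n - k - 1) * (x.2 : ℂ) = (-1) ^ n * ((-1) ^ (k - 1) * (x.2 : ℂ))
  rw [← mul_assoc, ← pow_add]
  congr 1
  rw [show n + (k - 1) = n - k - 1 + 2 * k by omega, pow_add, pow_mul]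
  simp

theorem mem_dualPt_iff (x : XX n k) (v : Fin n → ℂ) : v ∈ (dualPt x).1.1 ↔
    ∀ u ∈ x.1.1, ∑ i : Fin n, (-1) ^ (i : ℕ) * v i.rev * u i = 0 := by
  change v ∈ Submodule.map _ _ ↔ _
  rw [Submodule.mem_map]
  constructor
  · rintro ⟨w, hw, rfl⟩
    simpa [LinearMap.funLeft] using (mem_dual_iff _ _).1 hw
  · intro h
    refine ⟨fun i => v i.rev, (mem_dual_iff _ _).2 h, ?_⟩
    ext i
    simp [LinearMap.funLeft]

/-- The reversal of a cyclic interval is complementary to a cyclic interval. -/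
theorem win_or_rev_win (hkn : k < n) (j : ℤ) (i : Fin n) :
    (∃ r, i = win n k (n + 2 - j) r) ∨ ∃ r, i.rev = win n (n - k) j r := by
  have hn := natCast_pos_of_neZero n
  obtain ⟨δ, c, h0, h1, h2⟩ : ∃ δ c : ℤ, 0 ≤ δ ∧ δ < n ∧ (i : ℤ) + 1 - (n + 2 - j - k) = δ + n * c :=
    ⟨((i : ℤ) + 1 - (n + 2 - j - k)) % n, ((i : ℤ) + 1 - (n + 2 - j - k)) / n,
      Int.emod_nonneg _ hn.ne', Int.emod_lt_of_pos _ hn, (Int.emod_add_mul_ediv _ _).symm⟩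
  rcases lt_or_ge δ k with h | h
  · refine Or.inl ⟨⟨δ.toNat, by omega⟩, ?_⟩
    rw [win, ← idx_add_mul _ c]
    refine (idx_eq_of ?_).symm
    simp only
    rw [Int.toNat_of_nonneg h0]
    linarith
  · refine Or.inr ⟨⟨(n - 1 - δ).toNat, by omega⟩, ?_⟩
    rw [win, ← idx_add_mul _ (-c)]
    refine (idx_eq_of ?_).symm
    simp only
    rw [Int.toNat_of_nonneg (by omega), Fin.val_rev, Nat.cast_sub hkn.le, Nat.cast_sub (by omega)]
    push_cast
    linarith

/-- A vector of the dual vanishing on a window of `n - k` rows is, after reversal, supported on the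
complementary window of `k` rows. There it annihilates an invertible minor of `N`, so it is zero. -/
theorem dualPt_isGeneric (hkn : k < n) {x : XX n k} (hx : IsGeneric x.1) :
    IsGeneric (dualPt x).1 := by
  refine (isGeneric_iff (Nat.sub_le n k)).2 fun j => det_ne_zero_of_eq_zero fun v hv h0 => ?_
  rw [mem_dualPt_iff] at hv
  have hz : (fun r => (-1 : ℂ) ^ ((win n k (n + 2 - j) r : Fin n) : ℕ) *
      v (win n k (n + 2 - j) r).rev) = 0 := by
    refine Matrix.eq_zero_of_vecMul_eq_zero ((isGeneric_iff hkn.le).1 hx (n + 2 - j)) ?_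
    ext c
    have h1 := hv (x.1.rep.col c) (by rw [← range_rep]; exact col_mem_range _ c)
    rw [← Finset.sum_subset (Finset.subset_univ (Finset.univ.image (win n k (n + 2 - j)))),
      Finset.sum_image (fun a _ b _ h => win_injective hkn.le _ h)] at h1
    · exact h1
    · intro i _ hi
      rcases win_or_rev_win hkn j i with ⟨r, hr⟩ | ⟨r, hr⟩
      · exact absurd (Finset.mem_image.2 ⟨r, Finset.mem_univ _, hr.symm⟩) hi
      · rw [hr, h0, mul_zero, zero_mul]
  ext i
  rw [Pi.zero_apply]
  rcases win_or_rev_win hkn j i.rev with ⟨r, hr⟩ | ⟨r, hr⟩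
  · have := congrFun hz r
    rw [← hr, Fin.rev_rev] at this
    exact (mul_eq_zero.1 this).resolve_left (pow_ne_zero _ (by norm_num))
  · rw [Fin.rev_rev] at hr
    rw [hr, h0]

/-- The complementary factor of `g(N|t)`, obtained from the dual point. -/
def cofactor (x : XX n k) : Folded n := tw k (fl (gMat (dualPt x)))

theorem cofactor_isMonicBand (hk : 1 ≤ k) (hkn : k < n) {x : XX n k} (hx : IsGeneric x.1) :
    IsMonicBand k (cofactor x) := by
  have h := (gMat_isMonicBand (by omega) (by omega) (dualPt_isGeneric hkn hx)).fl
  rw [show n - (n - k) = k by omega] at h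
  exact h.tw

/-- At the special value the rows of the cofactor are, up to signs, reversed columns of `g` of the
dual point, which are orthogonal to `N` by the definition of the dual. -/
theorem ev_cofactor_mul (hk : 1 ≤ k) (hkn : k < n) (x : XX n k) {v : Fin n → ℂ}
    (hv : v ∈ x.1.1) : (ev (spec x) (cofactor x)).mulVec v = 0 := by
  ext a
  have h := gMat_col_mem (by omega) (by omega) (dualPt x) a.rev
  have h1 := (mem_dualPt_iff x _).1 h v hv
  simp only [Matrix.mulVec, dotProduct, cofactor, ev_tw, ← spec_dualPt hk hkn]
  rw [Pi.zero_apply, ← mul_zero ((-1 : ℂ) ^ (k + a : ℕ)), ← h1, Finset.mul_sum]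
  refine Finset.sum_congr rfl fun b _ => ?_
  rw [pow_add _ (k + (a : ℕ)) (b : ℕ)]
  simp [fl]
  ring

/-- The product vanishes at `spec x` and has bandwidth `k + (n - k) = n`. Division by `X - spec x`
lowers the bandwidth to `0`, and the only monic band matrix of width `0` is the identity. -/
theorem cofactor_mul (hk : 1 ≤ k) (hkn : k < n) {x : XX n k} (hx : IsGeneric x.1) :
    cofactor x * gMat x = (Polynomial.X - Polynomial.C (spec x)) • 1 := by
  have h0 : ev (spec x) (cofactor x * gMat x) = 0 := by
    ext a b
    rw [map_mul]
    exact congrFun (ev_cofactor_mul hk hkn x (gMat_col_mem hk hkn x b)) a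
  obtain ⟨E, hE⟩ := exists_eq_smul_of_ev_eq_zero h0
  have hm := (cofactor_isMonicBand hk hkn hx).mul (gMat_isMonicBand hk hkn hx)
  rw [show k + (n - k) = n + 0 by omega] at hm
  rw [hE, isMonicBand_zero (hm.of_smul (spec_ne_zero x) hE)]

theorem ev_smul (z : ℂ) (p : Polynomial ℂ) (A : Folded n) : ev z (p • A) = p.eval z • ev z A := by
  ext a b
  simp

/-- Off the special value a one-sided inverse is two-sided, and a polynomial identity extends from
there. -/
theorem mul_cofactor (hk : 1 ≤ k) (hkn : k < n) {x : XX n k} (hx : IsGeneric x.1) :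
    gMat x * cofactor x = (Polynomial.X - Polynomial.C (spec x)) • 1 := by
  refine folded_ext {spec x} (Set.finite_singleton _) fun z hz => ?_
  have hz' : z - spec x ≠ 0 := sub_ne_zero.2 hz
  have h := congrArg (ev z) (cofactor_mul hk hkn hx)
  rw [ev_smul, map_one, map_mul] at h ⊢
  simp only [Polynomial.eval_sub, Polynomial.eval_X, Polynomial.eval_C] at h ⊢
  have h2 : ((z - spec x)⁻¹ • ev z (cofactor x)) * ev z (gMat x) = 1 := by
    rw [Matrix.smul_mul, h, smul_smul, inv_mul_cancel₀ hz', one_smul]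
  have h3 := mul_eq_one_comm.1 h2
  rw [Matrix.mul_smul, inv_smul_eq_iff₀ hz'] at h3
  exact h3

theorem isUnit_ev_gMat (hk : 1 ≤ k) (hkn : k < n) {x : XX n k} (hx : IsGeneric x.1) {z : ℂ}
    (hz : z ≠ spec x) : IsUnit (ev z (gMat x)) := by
  have hz' : z - spec x ≠ 0 := sub_ne_zero.2 hz
  have h := congrArg (ev z) (cofactor_mul hk hkn hx)
  rw [ev_smul, map_one, map_mul] at h
  simp only [Polynomial.eval_sub, Polynomial.eval_X, Polynomial.eval_C] at h
  have h2 : ((z - spec x)⁻¹ • ev z (cofactor x)) * ev z (gMat x) = 1 := by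
    rw [Matrix.smul_mul, h, smul_smul, inv_mul_cancel₀ hz', one_smul]
  exact IsUnit.of_mul_eq_one_right _ h2

theorem finrank_map_of_isUnit {P : Matrix (Fin n) (Fin n) ℂ} (hP : IsUnit P)
    (N : Submodule ℂ (Fin n → ℂ)) : Module.finrank ℂ (N.map P.mulVecLin) = Module.finrank ℂ N :=
  (LinearEquiv.finrank_eq (Submodule.equivMapOfInjective _
    (Matrix.mulVec_injective_of_isUnit hP) N)).symm

/-- Refactorization of a product whose image at the second special value is generic. -/
theorem exists_refactor (hl : 1 ≤ l) (hln : l < n) (hk : 1 ≤ k) (hkn : k < n) {x : XX n l}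
    {y y' : XX n k} (hx : IsGeneric x.1) (hy : IsGeneric y.1) (hy' : IsGeneric y'.1)
    (ht : y'.2 = y.2) (hne : spec x ≠ spec y)
    (hcol : ∀ b, (ev (spec y) (gMat x * gMat y)).col b ∈ y'.1.1) :
    ∃ x' : XX n l, x'.2 = x.2 ∧ IsGeneric x'.1 ∧ gMat x * gMat y = gMat y' * gMat x' := by
  have hs : spec y' = spec y := by rw [spec, spec, ht]
  -- The image of the product at this value lies in `y'`, which the cofactor of `y'` annihilates.
  have h0 : ev (spec y') (cofactor y' * (gMat x * gMat y)) = 0 := by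
    ext a b
    rw [map_mul]
    exact congrFun (ev_cofactor_mul hk hkn y' (hs ▸ hcol b)) a
  obtain ⟨E, hE⟩ := exists_eq_smul_of_ev_eq_zero h0
  have hm := (cofactor_isMonicBand hk hkn hy').mul
    ((gMat_isMonicBand hl hln hx).mul (gMat_isMonicBand hk hkn hy))
  -- Dividing by `X - spec y'` removes `n` from the bandwidth and leaves the width of a matrix `g`
  -- on `𝕏_l`.
  rw [show k + (n - l + (n - k)) = n + (n - l) by omega] at hm
  have hEm := hm.of_smul (spec_ne_zero y') hE
  have hfac : gMat x * gMat y = gMat y' * E := by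
    refine smul_left_cancel_folded (ζ := spec y') ?_
    rw [← Matrix.mul_smul (gMat y'), ← hE, ← Matrix.mul_assoc (gMat y'),
      mul_cofactor hk hkn hy', Matrix.smul_mul, Matrix.one_mul]
  have hu : IsUnit (ev (spec x) (gMat y')) := isUnit_ev_gMat hk hkn hy' (hs ▸ hne)
  have hu' : IsUnit (ev (spec x) (gMat y'))⁻¹ := by rwa [Matrix.isUnit_nonsing_inv_iff]
  -- At `spec x` the quotient `E` is `g(y')⁻¹ g(x) g(y)`, so its columns lie in the image of the
  -- subspace of `x` under `g(y')⁻¹`.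
  let x' : XX n l := (⟨x.1.1.map (ev (spec x) (gMat y'))⁻¹.mulVecLin, by
    rw [finrank_map_of_isUnit hu', x.1.2]⟩, x.2)
  obtain ⟨h1, h2⟩ := gMat_eq_of_col_mem hl hln hEm (x := x') fun b => by
    refine ⟨(ev (spec x) (gMat x * gMat y)).col b, ?_, ?_⟩
    · rw [map_mul]
      have := range_gMat hl hln hx
      rw [← this]
      exact ⟨(ev (spec x) (gMat y)).col b, rfl⟩
    · have h3 : (ev (spec x) (gMat y'))⁻¹ * ev (spec x) (gMat x * gMat y) = ev (spec x) E := by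
        rw [hfac, map_mul, ← Matrix.mul_assoc, Matrix.nonsing_inv_mul _
          ((Matrix.isUnit_iff_isUnit_det _).1 hu), Matrix.one_mul]
      change _ = (ev (spec x) E).col b
      rw [← h3]
      rfl
  exact ⟨x', rfl, h1, by rw [hfac, h2]⟩

/-- `(y', x')` is obtained from `(x, y)` by refactoring `g(x) g(y)` as `g(y') g(x')`. -/
structure Refactor (x : XX n l) (y : XX n k) (y' : XX n k) (x' : XX n l) : Prop where
  gen₁ : IsGeneric x.1
  gen₂ : IsGeneric y.1
  gen₁' : IsGeneric y'.1
  gen₂' : IsGeneric x'.1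
  snd₁ : x'.2 = x.2
  snd₂ : y'.2 = y.2
  ne : spec x ≠ spec y
  eq : gMat x * gMat y = gMat y' * gMat x'

theorem spec_congr {x y : XX n k} (h : x.2 = y.2) : spec x = spec y := by rw [spec, spec, h]

theorem Refactor.symm {x : XX n l} {y y' : XX n k} {x' : XX n l} (h : Refactor x y y' x') :
    Refactor y' x' x y :=
  ⟨h.gen₁', h.gen₂', h.gen₁, h.gen₂, h.snd₂.symm, h.snd₁.symm,
    by rw [spec_congr h.snd₁, spec_congr h.snd₂]; exact h.ne.symm, h.eq.symm⟩

theorem Refactor.schutz (hl : 1 ≤ l) (hln : l < n) (hk : 1 ≤ k) (hkn : k < n) {x : XX n l}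
    {y y' : XX n k} {x' : XX n l} (h : Refactor x y y' x') :
    Refactor (schutz y) (schutz x) (schutz x') (schutz y') := by
  have h1 := schutz_spec hl hln h.gen₁
  have h2 := schutz_spec hk hkn h.gen₂
  have h1' := schutz_spec hk hkn h.gen₁'
  have h2' := schutz_spec hl hln h.gen₂'
  exact ⟨h2.1, h1.1, h2'.1, h1'.1, h.snd₂, h.snd₁, h.ne.symm, by
    rw [h1.2, h2.2, h1'.2, h2'.2, ← fl_mul, ← fl_mul, h.eq]⟩

/-- Inverting the relation gives the reversed relation between cofactors, up to central factors that
cancel. Undoing `tw` and `fl`, which reverses once more, yields the relation for the dual points. -/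
theorem Refactor.dual (hl : 1 ≤ l) (hln : l < n) (hk : 1 ≤ k) (hkn : k < n) {x : XX n l}
    {y y' : XX n k} {x' : XX n l} (h : Refactor x y y' x') :
    Refactor (dualPt x) (dualPt y) (dualPt y') (dualPt x') := by
  refine ⟨dualPt_isGeneric hln h.gen₁, dualPt_isGeneric hkn h.gen₂, dualPt_isGeneric hkn h.gen₁',
    dualPt_isGeneric hln h.gen₂', h.snd₁, h.snd₂, ?_, ?_⟩
  · rw [spec_dualPt hl hln, spec_dualPt hk hkn]
    exact fun h0 => h.ne (mul_left_cancel₀ (pow_ne_zero _ (by norm_num)) h0)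
  · have e1 : cofactor y * cofactor x * (gMat x * gMat y) =
        cofactor x' * cofactor y' * (gMat y' * gMat x') := by
      rw [mul_assoc, ← mul_assoc (cofactor x), cofactor_mul hl hln h.gen₁, mul_assoc,
        ← mul_assoc (cofactor y'), cofactor_mul hk hkn h.gen₁', smul_mul_assoc, smul_mul_assoc,
        one_mul, one_mul, mul_smul_comm, mul_smul_comm, cofactor_mul hk hkn h.gen₂,
        cofactor_mul hl hln h.gen₂', spec_congr h.snd₁, spec_congr h.snd₂, smul_comm]
    have e2 : cofactor y * cofactor x = cofactor x' * cofactor y' := by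
      -- Multiplied on the right by the cofactors, both sides acquire the central factor `(X - spec
      -- x)(X - spec y)`, which can be cancelled.
      have e3 := congrArg (fun M => M * (cofactor y * cofactor x)) e1
      simp only [← h.eq] at e3
      have e4 : gMat x * gMat y * (cofactor y * cofactor x) =
          (Polynomial.X - Polynomial.C (spec x)) • (Polynomial.X - Polynomial.C (spec y)) • 1 := by
        rw [mul_assoc, ← mul_assoc (gMat y), mul_cofactor hk hkn h.gen₂, smul_mul_assoc, one_mul,
          mul_smul_comm, mul_cofactor hl hln h.gen₁, smul_comm]
      rw [mul_assoc, mul_assoc _ (gMat x * gMat y), e4, mul_smul_comm, mul_smul_comm, mul_smul_comm,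
        mul_smul_comm, mul_one, mul_one] at e3
      exact smul_left_cancel_folded (smul_left_cancel_folded e3)
    simp only [cofactor] at e2
    rw [← tw_mul, ← tw_mul, ← fl_mul, ← fl_mul, add_comm l k] at e2
    have e5 := congrArg (tw (k + l)) e2
    rw [tw_tw, tw_tw] at e5
    have e6 := congrArg fl e5
    rwa [fl_fl, fl_fl] at e6

theorem gProd_eq {x : XX n l} {y : XX n k} (hx : IsGeneric x.1) (hy : IsGeneric y.1) :
    gProd (x, y) = Part.some (gMat x * gMat y) := by
  simp only [gProd, g_eq hx, g_eq hy, Part.bind_eq_bind, Part.bind_some]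
  rfl

/-- `Ψ`, without regard to its domain of definition. -/
def psi (p : XX n l × XX n k) : XX n k :=
  (Gr.mkD p.2.1 (LinearMap.range
    (firstCols k (ev (spec p.2) (gMat p.1 * gMat p.2))).mulVecLin), p.2.2)

theorem finrank_psi (hl : 1 ≤ l) (hln : l < n) (hk : 1 ≤ k) (hkn : k < n) {x : XX n l} {y : XX n k}
    (hx : IsGeneric x.1) (hy : IsGeneric y.1) (hne : spec x ≠ spec y) : Module.finrank ℂ
      (LinearMap.range (firstCols k (ev (spec y) (gMat x * gMat y))).mulVecLin) = k := by
  rw [map_mul, firstCols_mul, Matrix.mulVecLin_mul, LinearMap.range_comp,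
    finrank_map_of_isUnit (isUnit_ev_gMat hl hln hx hne.symm),
    finrank_firstCols hkn (gMat_isMonicBand hk hkn hy) (spec_ne_zero y)]

theorem Psi_eq (hl : 1 ≤ l) (hln : l < n) (hk : 1 ≤ k) (hkn : k < n) {x : XX n l} {y : XX n k}
    (hx : IsGeneric x.1) (hy : IsGeneric y.1) (hne : spec x ≠ spec y) :
    Psi (x, y) = Part.some (psi (x, y)) := by
  rw [Psi, gProd_eq hx hy, Part.bind_some]
  exact proj_eq hkn.le y.1 y.2 (finrank_psi hl hln hk hkn hx hy hne)

/-- The subspace `Ψ(x, y)` is the image of the second subspace under `g(x)`. -/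
theorem psi_fst (hl : 1 ≤ l) (hln : l < n) (hk : 1 ≤ k) (hkn : k < n) {x : XX n l} {y : XX n k}
    (hx : IsGeneric x.1) (hy : IsGeneric y.1) (hne : spec x ≠ spec y) :
    (psi (x, y)).1.1 = y.1.1.map (ev (spec y) (gMat x)).mulVecLin := by
  refine (Gr.coe_mkD _ (finrank_psi hl hln hk hkn hx hy hne)).trans ?_
  rw [map_mul, firstCols_mul, Matrix.mulVecLin_mul, LinearMap.range_comp,
    range_firstCols_gMat hk hkn hy]

/-- At `spec y` the product has its range inside that of `g(y')`, namely `y'`, and the dimensions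
agree. -/
theorem Refactor.psi_eq (hl : 1 ≤ l) (hln : l < n) (hk : 1 ≤ k) (hkn : k < n) {x : XX n l}
    {y y' : XX n k} {x' : XX n l} (h : Refactor x y y' x') : psi (x, y) = y' := by
  refine Prod.ext (Subtype.ext ?_) h.snd₂.symm
  have hf := finrank_psi hl hln hk hkn h.gen₁ h.gen₂ h.ne
  refine (Gr.coe_mkD _ hf).trans (Submodule.eq_of_le_of_finrank_eq (range_le_of_col_mem fun b => ?_)
    (hf.trans y'.1.2.symm))
  rw [h.eq, map_mul, ← range_gMat hk hkn h.gen₁', spec_congr h.snd₂]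
  exact ⟨_, rfl⟩

theorem exists_refactor_of_psi (hl : 1 ≤ l) (hln : l < n) (hk : 1 ≤ k) (hkn : k < n) {x : XX n l}
    {y : XX n k} (hx : IsGeneric x.1) (hy : IsGeneric y.1) (hne : spec x ≠ spec y)
    (h : IsGeneric (psi (x, y)).1) : ∃ x', Refactor x y (psi (x, y)) x' := by
  obtain ⟨x', h1, h2, h3⟩ := exists_refactor hl hln hk hkn hx hy h rfl hne fun b => by
    rw [psi_fst hl hln hk hkn hx hy hne, map_mul]
    exact ⟨(ev (spec y) (gMat y)).col b, gMat_col_mem hk hkn y b, rfl⟩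
  exact ⟨x', hx, hy, h, h2, h1, rfl, hne, h3⟩

/-- The second component of `R`, without regard to its domain of definition. -/
def psiS (p : XX n l × XX n k) : XX n l := schutz (psi (schutz p.2, schutz p.1))

/-- `fl` reverses products, so the second factor becomes the first factor of the reflected
refactorization, to which `Refactor.psi_eq` applies. -/
theorem Refactor.psiS_eq (hl : 1 ≤ l) (hln : l < n) (hk : 1 ≤ k) (hkn : k < n) {x : XX n l}
    {y y' : XX n k} {x' : XX n l} (h : Refactor x y y' x') : psiS (x, y) = x' := by
  rw [psiS, (h.schutz hl hln hk hkn).psi_eq hk hkn hl hln, schutz_schutz hl hln h.gen₂']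

theorem S₂_eq (hl : 1 ≤ l) (hln : l < n) (hk : 1 ≤ k) (hkn : k < n) {x : XX n l} {y : XX n k}
    (hx : IsGeneric x.1) (hy : IsGeneric y.1) : S₂ (x, y) = Part.some (schutz y, schutz x) := by
  simp only [S₂, S_eq hl hln hx, S_eq hk hkn hy, Part.bind_eq_bind, Part.bind_some]
  rfl

theorem prodLift_eq {α β γ : Type} {f : α →. β} {g : α →. γ} {x : α} {b : β} {c : γ}
    (hf : f x = Part.some b) (hg : g x = Part.some c) : f.prodLift g x = Part.some (b, c) := by
  refine Part.eq_some_iff.2 ⟨⟨by rw [hf]; trivial, by rw [hg]; trivial⟩, ?_⟩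
  exact Prod.ext (Part.get_eq_of_mem (hf ▸ Part.mem_some b) _)
    (Part.get_eq_of_mem (hg ▸ Part.mem_some c) _)

theorem comp_eq {α β γ : Type} {f : β →. γ} {g : α →. β} {x : α} {b : β}
    (hg : g x = Part.some b) : f.comp g x = f b := by
  rw [PFun.comp_apply, hg]
  exact Part.bind_some _ _

theorem Refactor.R_eq (hl : 1 ≤ l) (hln : l < n) (hk : 1 ≤ k) (hkn : k < n) {x : XX n l}
    {y y' : XX n k} {x' : XX n l} (h : Refactor x y y' x') : R (x, y) = Part.some (y', x') := by
  refine prodLift_eq ?_ ?_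
  · rw [Psi_eq hl hln hk hkn h.gen₁ h.gen₂ h.ne, h.psi_eq hl hln hk hkn]
  · have hs := h.schutz hl hln hk hkn
    rw [comp_eq ((comp_eq (S₂_eq hl hln hk hkn h.gen₁ h.gen₂)).trans
      (Psi_eq hk hkn hl hln hs.gen₁ hs.gen₂ hs.ne)), hs.psi_eq hk hkn hl hln,
      S_eq hl hln hs.gen₁', schutz_schutz hl hln h.gen₂']

end Symmetries

/-! ### The cyclic shift. -/

section Rotation

variable {k l n : ℕ} [NeZero n]

/-- The cyclic shift of rows with loop parameter `z`. -/
def shM (n : ℕ) [NeZero n] (z : ℂ) : Matrix (Fin n) (Fin n) ℂ :=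
  Matrix.of fun i j => if j = i - 1 then (if i = 0 then z else 1) else 0

theorem shM_mul {m : Type*} (z : ℂ) (M : Matrix (Fin n) m ℂ) (a : Fin n) (b : m) :
    (shM n z * M) a b = (if a = 0 then z else 1) * M (a - 1) b := by
  rw [Matrix.mul_apply, Finset.sum_eq_single (a - 1)]
  · simp [shM]
  · intro c _ hc
    simp [shM, hc]
  · simp

theorem mul_shM {m : Type*} (z : ℂ) (M : Matrix m (Fin n) ℂ) (a : m) (b : Fin n) :
    (M * shM n z) a b = M a (b + 1) * (if b + 1 = 0 then z else 1) := by
  rw [Matrix.mul_apply, Finset.sum_eq_single (b + 1)]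
  · simp [shM]
  · intro c _ hc
    have : b ≠ c - 1 := fun h => hc (by rw [h, sub_add_cancel])
    simp [shM, this]
  · simp

theorem isUnit_shM {z : ℂ} (hz : z ≠ 0) : IsUnit (shM n z) := by
  refine IsUnit.of_mul_eq_one (Matrix.of fun i j : Fin n =>
    if i = j - 1 then (if j = 0 then z⁻¹ else 1) else 0) ?_
  ext a b
  rw [shM_mul, Matrix.of_apply, Matrix.one_apply]
  by_cases h : a = b
  · subst h
    split_ifs <;> simp_all
  · rw [if_neg (fun h' => h (sub_left_injective h')), if_neg h, mul_zero]

/-- The conjugate of a lower triangular folded matrix by the cyclic shift. -/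
def rot (A : Folded n) : Folded n := Matrix.of fun a b =>
  if a = 0 then (if b = 0 then A (a - 1) (b - 1) else Polynomial.X * A (a - 1) (b - 1))
  else if b = 0 then (A (a - 1) (b - 1)).divX else A (a - 1) (b - 1)

theorem val_neg_one_fin : (((0 : Fin n) - 1 : Fin n) : ℕ) = n - 1 := by
  have hn := Nat.pos_of_ne_zero (NeZero.ne n)
  rw [zero_sub]
  have h : (Fin.last (n - 1)).cast (by omega) + (1 : Fin n) = 0 := by
    ext
    rw [Fin.val_add]
    rcases Nat.lt_or_ge 1 n with h1 | h1
    · simp [Nat.mod_eq_of_lt h1, Nat.sub_add_cancel hn]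
    · have : n = 1 := by omega
      subst this
      simp
  rw [← eq_neg_of_add_eq_zero_left h]
  simp

theorem val_sub_one_fin {a : Fin n} (ha : a ≠ 0) : ((a - 1 : Fin n) : ℕ) = a - 1 := by
  have ha' : (a : ℕ) ≠ 0 := fun h => ha (Fin.ext (by simpa using h))
  have h : (⟨a - 1, by omega⟩ : Fin n) + 1 = a := by
    ext
    rw [Fin.val_add]
    have : 1 < n := by omega
    rw [Fin.coe_ofNat_eq_mod, Nat.mod_eq_of_lt this, Nat.mod_eq_of_lt (by simp only; omega)]
    simp only
    omega
  exact congrArg Fin.val (eq_sub_of_add_eq h).symm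

/-- Conjugation by the shift moves the unfolded matrix one step along its diagonal. The entries to
which `divX` is applied away from the corner come from above the diagonal, where triangularity makes
the constant term zero. -/
theorem unf_rot {A : Folded n} (hA : IsLower A) (i j : ℤ) :
    unf (rot A) i j = unf A (i - 1) (j - 1) := by
  have hn := Nat.pos_of_ne_zero (NeZero.ne n)
  have key : ∀ (a : Fin n) (s : ℤ), (a : ℤ) + 1 + n * s - 1 =
      ((a - 1 : Fin n) : ℕ) + 1 + n * (if a = 0 then s - 1 else s) := by
    intro a s
    split_ifs with h
    · subst h
      rw [val_neg_one_fin]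
      push_cast [hn]
      simp
      ring
    · rw [val_sub_one_fin h]
      have ha' : (a : ℕ) ≠ 0 := fun h' => h (Fin.ext h')
      push_cast [Nat.one_le_iff_ne_zero.2 ha']
      ring
  obtain ⟨a, s, rfl⟩ := exists_fin_add_mul (n := n) i
  obtain ⟨b, r, rfl⟩ := exists_fin_add_mul (n := n) j
  rw [key, key, unf_fin, unf_fin, rot, Matrix.of_apply]
  by_cases ha : a = 0 <;> by_cases hb : b = 0
  · simp [ha, hb]
  · simp only [ha, hb, if_true, if_false]
    by_cases h : r ≤ s - 1
    · rw [if_pos h, if_pos (by omega), show (s - r).toNat = (s - 1 - r).toNat + 1 by omega,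
        Polynomial.coeff_X_mul]
    · rw [if_neg h]
      split_ifs with h'
      · rw [show (s - r).toNat = 0 by omega, Polynomial.coeff_X_mul_zero]
      · rfl
  · simp only [ha, hb, if_true, if_false]
    by_cases h : r ≤ s
    · rw [if_pos h, if_pos (by omega), Polynomial.coeff_divX]
      congr 1
      omega
    · rw [if_neg h]
      split_ifs with h'
      · rw [show (s - (r - 1)).toNat = 0 by omega]
        refine (isLower_iff.1 hA _ _ ?_).symm
        have ha' : (a : ℕ) ≠ 0 := fun h' => ha (Fin.ext h')
        rw [Fin.lt_def, val_sub_one_fin ha, val_neg_one_fin]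
        omega
      · rfl
  · simp [ha, hb]

theorem IsLower.rot {A : Folded n} (h : IsLower A) : IsLower (rot A) := fun i j hij => by
  rw [unf_rot h]
  exact h _ _ (by omega)

theorem IsMonicBand.rot {d : ℕ} {A : Folded n} (h : IsMonicBand d A) : IsMonicBand d (rot A) := by
  refine isMonicBand_iff.2 fun i j => ?_
  rw [unf_rot h.isLower]
  have := isMonicBand_iff.1 h (i - 1) (j - 1)
  refine ⟨fun h0 => ?_, fun h0 => this.2 (by omega)⟩
  have := this.1 h0
  omega

theorem ev_rot {A : Folded n} (hA : IsLower A) (z : ℂ) :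
    ev z (rot A) * shM n z = shM n z * ev z A := by
  ext a b
  rw [shM_mul, mul_shM, ev_apply, ev_apply, GeomR.rot, Matrix.of_apply, add_sub_cancel_right]
  by_cases ha : a = 0 <;> by_cases hb : b + 1 = 0
  · simp [ha, hb, mul_comm]
  · simp [ha, hb]
  · have hb' : b = 0 - 1 := eq_sub_of_add_eq hb
    have h0 : (A (a - 1) b).coeff 0 = 0 := isLower_iff.1 hA _ _ (by
      have ha' : (a : ℕ) ≠ 0 := fun h' => ha (Fin.ext h')
      rw [hb', Fin.lt_def, val_sub_one_fin ha, val_neg_one_fin]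
      omega)
    have h1 := Polynomial.divX_mul_X_add (A (a - 1) b)
    rw [h0, Polynomial.C_0, add_zero] at h1
    conv_rhs => rw [← h1]
    simp [ha, hb]
  · simp [ha, hb]

/-- At nonzero parameters the shift is invertible and `rot` is an honest conjugation. -/
theorem rot_mul {A B : Folded n} (hA : IsLower A) (hB : IsLower B) :
    rot (A * B) = rot A * rot B := by
  refine folded_ext {0} (Set.finite_singleton _) fun z hz => ?_
  refine (isUnit_shM (n := n) hz).mul_left_injective ?_
  dsimp only
  rw [ev_rot (hA.mul hB), map_mul, map_mul, mul_assoc, ev_rot hB, ← mul_assoc, ← mul_assoc,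
    ev_rot hA]

/-- The cyclic shift of a point. -/
def prPt (x : XX n k) : XX n k :=
  (⟨x.1.1.map (shM n (spec x)).mulVecLin, by
    rw [finrank_map_of_isUnit (isUnit_shM (spec_ne_zero x)), x.1.2]⟩, x.2)

theorem PR_eq (x : XX n k) : PR x = Part.some (prPt x) := by
  have h : act (shM n (spec x)) x.1 = Part.some (prPt x).1 :=
    Part.eq_some_iff.2 ⟨(prPt x).1.2, rfl⟩
  exact (congrArg (Part.map fun N => (N, x.2)) h).trans (Part.map_some _ _)

/-- Conjugation keeps the band shape, and at `spec x` the conjugate has the same range as the shift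
applied to `g(x)`, that is, the shifted subspace. -/
theorem prPt_spec (hk : 1 ≤ k) (hkn : k < n) {x : XX n k} (hx : IsGeneric x.1) :
    IsGeneric (prPt x).1 ∧ gMat (prPt x) = rot (gMat x) := by
  have hb := gMat_isMonicBand hk hkn hx
  refine gMat_eq_of_col_mem hk hkn hb.rot fun b => ?_
  have h1 : IsUnit (shM n (spec x)) := isUnit_shM (spec_ne_zero x)
  have h2 : ev (spec x) (rot (gMat x)) =
      shM n (spec x) * (ev (spec x) (gMat x) * (shM n (spec x))⁻¹) := by
    rw [← mul_assoc, ← ev_rot hb.isLower, mul_assoc, Matrix.mul_nonsing_inv _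
      ((Matrix.isUnit_iff_isUnit_det _).1 h1), mul_one]
  change (ev (spec x) (rot (gMat x))).col b ∈ _
  rw [h2]
  refine ⟨(ev (spec x) (gMat x) * (shM n (spec x))⁻¹).col b, ?_, rfl⟩
  rw [← range_gMat hk hkn hx]
  exact ⟨(shM n (spec x))⁻¹.col b, rfl⟩

theorem Refactor.pr (hl : 1 ≤ l) (hln : l < n) (hk : 1 ≤ k) (hkn : k < n) {x : XX n l}
    {y y' : XX n k} {x' : XX n l} (h : Refactor x y y' x') :
    Refactor (prPt x) (prPt y) (prPt y') (prPt x') := by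
  have h1 := prPt_spec hl hln h.gen₁
  have h2 := prPt_spec hk hkn h.gen₂
  have h1' := prPt_spec hk hkn h.gen₁'
  have h2' := prPt_spec hl hln h.gen₂'
  refine ⟨h1.1, h2.1, h1'.1, h2'.1, h.snd₁, h.snd₂, h.ne, ?_⟩
  rw [h1.2, h2.2, h1'.2, h2'.2,
    ← rot_mul (gMat_isMonicBand hl hln h.gen₁).isLower (gMat_isMonicBand hk hkn h.gen₂).isLower,
    ← rot_mul (gMat_isMonicBand hk hkn h.gen₁').isLower (gMat_isMonicBand hl hln h.gen₂').isLower,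
    h.eq]

theorem prodMap_eq {α β γ δ : Type} {f : α →. β} {g : γ →. δ} {x : α} {y : γ} {b : β} {d : δ}
    (hf : f x = Part.some b) (hg : g y = Part.some d) :
    f.prodMap g (x, y) = Part.some (b, d) := by
  refine Part.eq_some_iff.2 ⟨⟨by rw [hf]; trivial, by rw [hg]; trivial⟩, ?_⟩
  exact Prod.ext (Part.get_eq_of_mem (hf ▸ Part.mem_some b) _)
    (Part.get_eq_of_mem (hg ▸ Part.mem_some d) _)

theorem PR₂_eq (x : XX n l) (y : XX n k) : PR₂ (x, y) = Part.some (prPt x, prPt y) :=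
  prodMap_eq (PR_eq x) (PR_eq y)

end Rotation

/-! ### Two-sided multiplication by loop unipotents. -/

section Move

variable {n : ℕ} [NeZero n]

theorem idx_eq_idx_val {i : ZMod n} {p : ℤ} : idx n p = idx n i.val ↔ (p : ZMod n) = i := by
  rw [idx_eq_iff, ← ZMod.intCast_eq_intCast_iff_dvd_sub]
  simp [eq_comm]

theorem idx_eq_idx_val_add_one {i : ZMod n} {p : ℤ} :
    idx n p = idx n (i.val + 1) ↔ (p : ZMod n) = i + 1 := by
  rw [idx_eq_iff, ← ZMod.intCast_eq_intCast_iff_dvd_sub]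
  simp [eq_comm]

theorem unf_congr (A : Folded n) {p q p' q' : ℤ} (h : (q : ZMod n) = q') (h' : p - q = p' - q') :
    unf A p q = unf A p' q' := by
  obtain ⟨c, hc⟩ := (ZMod.intCast_eq_intCast_iff_dvd_sub _ _ _).1 h
  have h1 : q' = q + n * c := by linarith
  have h2 : p' = p + n * c := by linarith
  rw [h1, h2, unf_add_mul]

/-- The entry in column `i` on the `m`-th diagonal below the main one. -/
def bd (A : Folded n) (m : ℤ) (i : ZMod n) : ℂ := unf A (i.val + m) i.val

theorem unf_eq_bd (A : Folded n) {p q m : ℤ} (h : p = q + m) : unf A p q = bd A m q :=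
  unf_congr A (by simp) (by linarith)

theorem bd_zero_mul {A B : Folded n} (hA : IsLower A) (hB : IsLower B) (i : ZMod n) :
    bd (A * B) 0 i = bd A 0 i * bd B 0 i := by
  rw [bd, unf_mul hA hB]
  simp [bd]

theorem bd_one_mul {A B : Folded n} (hA : IsLower A) (hB : IsLower B) (i : ZMod n) :
    bd (A * B) 1 i = bd A 1 i * bd B 0 i + bd A 0 (i + 1) * bd B 1 i := by
  rw [bd, unf_mul hA hB]
  have : Finset.Icc (i.val : ℤ) (i.val + 1) = {(i.val : ℤ), (i.val : ℤ) + 1} := by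
    ext m
    simp only [Finset.mem_Icc, Finset.mem_insert, Finset.mem_singleton]
    omega
  rw [this, Finset.sum_pair (by omega), unf_eq_bd A (m := 1) rfl, unf_eq_bd A (m := 0) (by ring),
    unf_eq_bd B (m := 0) (by ring), unf_eq_bd B (m := 1) rfl]
  simp

theorem bd_rot {A : Folded n} (hA : IsLower A) (m : ℤ) (i : ZMod n) :
    bd (rot A) m (i + 1) = bd A m i := by
  have h : ((i.val + 1 : ℤ) : ZMod n) = i + 1 := by simp
  rw [← h, ← unf_eq_bd _ rfl, unf_rot hA, unf_eq_bd A (m := m) (by ring)]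
  simp

/-- The one-parameter unipotent subgroups of the loop group. -/
def loopX (i : ZMod n) (a z : ℂ) : Matrix (Fin n) (Fin n) ℂ := xMat i (if i = 0 then a / z else a)

theorem idx_val_ne (hn : 2 ≤ n) (i : ZMod n) : idx n (i.val + 1) ≠ idx n i.val := by
  rw [ne_eq, idx_eq_idx_val]
  intro h
  have h1 : (1 : ZMod n) = 0 := by simpa using h
  have : Fact (1 < n) := ⟨hn⟩
  exact one_ne_zero h1

theorem xMat_mul (hn : 2 ≤ n) (i : ZMod n) (a b : ℂ) : xMat i a * xMat i b = xMat i (a + b) := by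
  rw [xMat, xMat, xMat, add_mul, mul_add, mul_add, one_mul, one_mul, mul_one,
    Matrix.single_mul_single_of_ne _ _ _ _ (idx_val_ne hn i), add_zero, Matrix.single_add]
  abel

theorem xMat_zero (i : ZMod n) : xMat i 0 = 1 := by
  simp [xMat]

theorem loopX_mul (hn : 2 ≤ n) (i : ZMod n) (a b z : ℂ) :
    loopX i a z * loopX i b z = loopX i (a + b) z := by
  rw [loopX, loopX, loopX, xMat_mul hn]
  split_ifs
  · rw [add_div]
  · rfl

theorem loopX_zero (i : ZMod n) (z : ℂ) : loopX i 0 z = 1 := by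
  simp [loopX, xMat_zero]

theorem loopX_mul_neg (hn : 2 ≤ n) (i : ZMod n) (a z : ℂ) : loopX i a z * loopX i (-a) z = 1 := by
  rw [loopX_mul hn, add_neg_cancel, loopX_zero]

theorem isUnit_loopX (hn : 2 ≤ n) (i : ZMod n) (a z : ℂ) : IsUnit (loopX i a z) :=
  IsUnit.of_mul_eq_one _ (loopX_mul_neg hn i a z)

theorem idx_add_one (p : ℤ) : idx n (p + 1) = idx n p + 1 := by
  ext
  rw [Fin.val_add, ← Int.natCast_inj]
  push_cast
  rw [coe_idx, coe_idx, Fin.coe_ofNat_eq_mod]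
  push_cast
  rw [add_sub_cancel_right, ← Int.add_emod, sub_add_cancel]

/-- Conjugation by the shift carries the index `0` to the index `1`, whose unipotent does not
involve the loop parameter. -/
theorem shM_mul_loopX (hn : 2 ≤ n) (a : ℂ) {z : ℂ} (hz : z ≠ 0) :
    shM n z * loopX 0 a z = loopX 1 a z * shM n z := by
  have : Fact (1 < n) := ⟨hn⟩
  have h1 : (idx n 1 : Fin n) = 0 := by ext; simp [coe_idx, ← Int.natCast_inj]
  have h0 : (idx n 0 : Fin n) = 0 - 1 := eq_sub_of_add_eq (by rw [← idx_add_one, zero_add, h1])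
  have h2 : (idx n 2 : Fin n) = 1 := by
    rw [show (2 : ℤ) = 1 + 1 by norm_num, idx_add_one, h1, zero_add]
  rw [loopX, loopX, if_pos rfl, if_neg one_ne_zero, xMat, xMat, mul_add, add_mul, mul_one, one_mul]
  congr 1
  ext r s
  rw [shM_mul, mul_shM, ZMod.val_zero, ZMod.val_one]

  have e3 : ((0 : ℕ) : ℤ) = 0 := rfl
  have e4 : ((1 : ℕ) : ℤ) = 1 := rfl
  have e1 : (0 : ℤ) + 1 = 1 := rfl
  have e2 : (1 : ℤ) + 1 = 2 := rfl
  rw [e3, e4, e1, e2, h2, h1, h0]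
  simp only [Matrix.single_apply]
  have h3 : (0 : Fin n) - 1 = r - 1 ↔ r = 0 := by rw [sub_left_inj, eq_comm]
  have h4 : (1 : Fin n) = s + 1 ↔ s = 0 := by rw [eq_comm, add_eq_right]
  have h5 : (1 : Fin n) ≠ 0 := by
    intro h
    have := congrArg Fin.val h
    rw [Fin.coe_ofNat_eq_mod, Fin.coe_ofNat_eq_mod, Nat.mod_eq_of_lt hn] at this
    simp at this
  simp only [h3, h4, eq_comm (a := (0 : Fin n)) (b := s), eq_comm (a := (0 : Fin n)) (b := r)]
  by_cases hr : r = 0 <;> by_cases hs : s = 0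
  · subst hr hs
    rw [zero_add, if_neg h5]
    simp [mul_div_cancel₀ _ hz]
  all_goals simp [hr, hs]

theorem unf_single_mul (A : Folded n) {r r' : Fin n} (h : (r' : ℕ) = r + 1) (a : ℂ) (p q : ℤ) :
    unf ((1 + Matrix.single r r' (Polynomial.C a)) * A) p q =
      unf A p q + if idx n p = r then a * unf A (p + 1) q else 0 := by
  obtain ⟨c, s, rfl⟩ := exists_fin_add_mul (n := n) p
  obtain ⟨d, t, rfl⟩ := exists_fin_add_mul (n := n) q
  rw [idx_add_mul, idx_coe, add_mul, one_mul]
  by_cases hc : c = r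
  · subst hc
    rw [if_pos rfl, show (c : ℤ) + 1 + n * s + 1 = r' + 1 + n * s by rw [h]; push_cast; ring,
      unf_fin, unf_fin, unf_fin]
    split_ifs
    · simp
    · simp
  · rw [if_neg hc, unf_fin, unf_fin, Matrix.add_apply, Matrix.single_mul_apply_of_ne _ _ _ _ _ hc,
      add_zero, add_zero]

theorem unf_mul_single (A : Folded n) {r r' : Fin n} (h : (r' : ℕ) = r + 1) (a : ℂ) (p q : ℤ) :
    unf (A * (1 + Matrix.single r r' (Polynomial.C a))) p q =
      unf A p q + if idx n q = r' then a * unf A p (q - 1) else 0 := by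
  obtain ⟨c, s, rfl⟩ := exists_fin_add_mul (n := n) p
  obtain ⟨d, t, rfl⟩ := exists_fin_add_mul (n := n) q
  rw [idx_add_mul, idx_coe, mul_add, mul_one]
  by_cases hc : d = r'
  · subst hc
    rw [if_pos rfl, show (d : ℤ) + 1 + n * t - 1 = r + 1 + n * t by rw [h]; push_cast; ring,
      unf_fin, unf_fin, unf_fin]
    split_ifs
    · simp [mul_comm]
    · simp
  · rw [if_neg hc, unf_fin, unf_fin, Matrix.add_apply, Matrix.mul_single_apply_of_ne _ _ _ _ _ hc,
      add_zero, add_zero]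

/-- `A'` is obtained from `A` by multiplication with loop unipotents on both sides. -/
def IsMove (i : ZMod n) (a b : ℂ) (A A' : Folded n) : Prop :=
  ∀ z, z ≠ 0 → ev z A' = loopX i a z * ev z A * loopX i b z

/-- The entries of the matrix obtained by multiplication with loop unipotents on both sides. -/
def mvUnf (i : ZMod n) (a b : ℂ) (A : Folded n) (p q : ℤ) : ℂ :=
  (unf A p q + if (p : ZMod n) = i then a * unf A (p + 1) q else 0) +
    if (q : ZMod n) = i + 1 then
      b * (unf A p (q - 1) + if (p : ZMod n) = i then a * unf A (p + 1) (q - 1) else 0) else 0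

/-- The moves push entries towards the upper right, so the last diagonal is unaffected. The only
entry that can leave the band is the one just above the main diagonal in rows congruent to `i`, and
`hab` is its vanishing. -/
theorem isMonicBand_of_mvUnf (hn : 2 ≤ n) {i : ZMod n} {a b : ℂ} {d : ℕ} {A A' : Folded n}
    (hA : IsMonicBand d A)
    (hab : a * bd A 0 (i + 1) + b * bd A 0 i + b * a * bd A 1 i = 0)
    (h : ∀ p q, unf A' p q = mvUnf i a b A p q) : IsMonicBand d A' := by
  have : Fact (1 < n) := ⟨hn⟩
  rw [isMonicBand_iff] at hA ⊢
  have hz : ∀ p q : ℤ, ¬ (q ≤ p ∧ p ≤ q + d) → unf A p q = 0 := fun p q hpq => by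
    by_contra h0
    exact hpq ((hA p q).1 h0)
  intro p q
  rw [h, mvUnf]
  constructor
  · refine not_imp_comm.1 fun hpq => ?_
    rw [not_and_or, not_le, not_le] at hpq
    rcases hpq with hpq | hpq
    · by_cases h1 : p + 1 = q
      · subst h1
        rw [hz p _ (by omega), zero_add, add_sub_cancel_right, unf_eq_bd A (m := 0) (by ring),
          unf_eq_bd A (m := 0) (by ring), unf_eq_bd A (m := 1) (by ring)]
        push_cast
        by_cases hp : (p : ZMod n) = i
        · rw [if_pos hp, hp, if_pos rfl, if_pos rfl, ← hab]
          ring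
        · rw [if_neg hp, if_neg (fun h' => hp (add_right_cancel h')), add_zero]
      · rw [hz p _ (by omega), hz p _ (by omega), hz _ q (by omega)]
        by_cases h2 : p + 2 = q
        · subst h2
          by_cases hp : (p : ZMod n) = i
          · rw [if_neg (c := _ = i + 1)]
            · simp
            · rw [hp.symm]
              push_cast
              intro h3
              have h4 := add_left_cancel h3
              have h5 : (1 : ZMod n) + 1 = 1 + 0 := by rw [add_zero, one_add_one_eq_two, h4]
              exact one_ne_zero (add_left_cancel h5)
          · simp [hp]
        · rw [hz _ (q - 1) (by omega)]
          simp
    · rw [hz p _ (by omega), hz p _ (by omega), hz _ q (by omega), hz _ (q - 1) (by omega)]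
      simp
  · intro hpq
    rw [(hA p q).2 hpq, hz p _ (by omega), hz _ q (by omega), hz _ (q - 1) (by omega)]
    simp

theorem unf_iterate_rot {A : Folded n} (hA : IsLower A) (m : ℕ) :
    IsLower (rot^[m] A) ∧ ∀ p q, unf (rot^[m] A) p q = unf A (p - m) (q - m) := by
  induction m with
  | zero => simpa using hA
  | succ m ih =>
    rw [Function.iterate_succ_apply']
    refine ⟨ih.1.rot, fun p q => ?_⟩
    rw [unf_rot ih.1, ih.2]
    push_cast
    congr 1 <;> ring

theorem exists_isMove_of_ne_zero {i : ZMod n} (hi : i ≠ 0) (A : Folded n) (a b : ℂ) :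
    ∃ A', IsMove i a b A A' ∧ ∀ p q, unf A' p q = mvUnf i a b A p q := by
  have hv : ((idx n (i.val + 1) : Fin n) : ℕ) = (idx n i.val : Fin n) + 1 := by
    have h1 : i.val ≠ 0 := (ZMod.val_ne_zero i).2 hi
    have h2 := ZMod.val_lt i
    rw [idx_eq_of (i := ⟨i.val, h2⟩) rfl, idx_eq_of (i := ⟨i.val - 1, by omega⟩) (by simp only; omega)]
    simp only
    omega
  refine ⟨(1 + Matrix.single (idx n i.val) (idx n (i.val + 1)) (Polynomial.C a)) * A *
    (1 + Matrix.single (idx n i.val) (idx n (i.val + 1)) (Polynomial.C b)), fun z _ => ?_,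
    fun p q => ?_⟩
  · have h1 : ∀ c : ℂ, ev z (1 + Matrix.single (idx n i.val) (idx n (i.val + 1)) (Polynomial.C c)) =
        loopX i c z := fun c => by
      rw [loopX, if_neg hi, xMat]
      ext r s
      simp only [ev_apply, Matrix.add_apply, Matrix.one_apply, Matrix.single_apply]
      split_ifs <;> simp
    rw [map_mul, map_mul, h1, h1]
  · rw [unf_mul_single _ hv, unf_single_mul _ hv, unf_single_mul _ hv]
    simp only [idx_eq_idx_val, idx_eq_idx_val_add_one]
    rfl

/-- The unipotent with index `0` contains `a / λ`, so polynomiality of the product is not obvious.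
For `i = 0` the product is formed with index `1` on the rotated matrix, and the result is rotated
back. -/
theorem exists_isMove (hn : 2 ≤ n) (i : ZMod n) {d : ℕ} {A : Folded n} (hA : IsMonicBand d A)
    {a b : ℂ} (hab : a * bd A 0 (i + 1) + b * bd A 0 i + b * a * bd A 1 i = 0) :
    ∃ A', IsMonicBand d A' ∧ IsMove i a b A A' ∧ ∀ p q, unf A' p q = mvUnf i a b A p q := by
  have : Fact (1 < n) := ⟨hn⟩
  by_cases hi : i = 0
  · subst hi
    obtain ⟨B, hB, hB'⟩ := exists_isMove_of_ne_zero (one_ne_zero (α := ZMod n)) (rot A) a b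
    have hBb : IsMonicBand d B := isMonicBand_of_mvUnf hn hA.rot (by
      have h1 := bd_rot hA.isLower 0 (0 + 1)
      have h2 := bd_rot hA.isLower 0 0
      have h3 := bd_rot hA.isLower 1 0
      rw [zero_add] at h1 h2 h3
      rw [h1, h2, h3, ← hab, zero_add]) hB'
    have h1 := unf_iterate_rot hBb.isLower (n - 1)
    -- A full turn of `n` rotations is the identity, so `n - 1` of them undo one.
    have h2 : ∀ p q, unf (rot^[n - 1] B) p q = unf B (p + 1) (q + 1) := fun p q => by
      rw [h1.2]
      refine unf_congr B ?_ (by ring)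
      push_cast [(by omega : 1 ≤ n)]
      simp
    have h3 : ∀ p q, unf (rot^[n - 1] B) p q = mvUnf 0 a b A p q := fun p q => by
      rw [h2, hB', mvUnf, mvUnf]
      simp only [unf_rot hA.isLower]
      have e1 : ((p + 1 : ℤ) : ZMod n) = 1 ↔ (p : ZMod n) = 0 := by
        push_cast
        exact add_eq_right
      have e2 : ((q + 1 : ℤ) : ZMod n) = 1 + 1 ↔ (q : ZMod n) = 0 + 1 := by
        push_cast
        rw [zero_add, add_left_inj]
      simp only [e1, e2, add_sub_cancel_right]
    refine ⟨_, isMonicBand_of_mvUnf hn hA hab h3, fun z hz => ?_, h3⟩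
    have h4 : rot (rot^[n - 1] B) = B := folded_ext_unf fun p q => by
      rw [unf_rot h1.1, h2, sub_add_cancel, sub_add_cancel]
    refine (isUnit_shM (n := n) hz).mul_right_injective ?_
    dsimp only
    rw [← ev_rot h1.1, h4, hB z hz, mul_assoc, ← shM_mul_loopX hn b hz, ← mul_assoc,
      mul_assoc (loopX 1 a z), ev_rot hA.isLower, ← mul_assoc, ← shM_mul_loopX hn a hz]
    simp only [mul_assoc]
  · obtain ⟨B, hB, hB'⟩ := exists_isMove_of_ne_zero hi A a b
    exact ⟨B, isMonicBand_of_mvUnf hn hA hab hB', hB, hB'⟩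

theorem IsMove.eq {i : ZMod n} {a b : ℂ} {A B B' : Folded n} (h : IsMove i a b A B)
    (h' : IsMove i a b A B') : B = B' :=
  folded_ext {0} (Set.finite_singleton _) fun z hz => (h z hz).trans (h' z hz).symm

end Move

/-! ### The crystal structure of one factor in terms of diagonals of `g`. -/

section Crystal

variable {k n : ℕ} [NeZero n]

theorem bd_eq_of_mvUnf {i : ZMod n} {a b : ℂ} {A A' : Folded n}
    (h : ∀ p q, unf A' p q = mvUnf i a b A p q) (m : ℤ) (j : ZMod n) :
    bd A' m j = (bd A m j + if j + m = i then a * bd A (m + 1) j else 0) +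
      if j = i + 1 then b * (bd A (m + 1) (j - 1) +
        if j + m = i then a * bd A (m + 2) (j - 1) else 0) else 0 := by
  rw [bd, h, mvUnf, unf_eq_bd A (m := m) rfl, unf_eq_bd A (m := m + 1) (by ring),
    unf_eq_bd A (m := m + 1) (by ring), unf_eq_bd A (m := m + 2) (by ring)]
  simp

/-- The coefficient of the left factor in the action of `e_i^c`. -/
def fa (A : Folded n) (i : ZMod n) (c : ℂ) : ℂ := (c - 1) * bd A 0 i / bd A 1 i

/-- The coefficient of the right factor in the action of `e_i^c`. -/
def fb (A : Folded n) (i : ZMod n) (c : ℂ) : ℂ := (c⁻¹ - 1) * bd A 0 (i + 1) / bd A 1 i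

/-- This is the condition under which the two-sided multiplication creates no entry above the main
diagonal. -/
theorem fa_fb {A : Folded n} {i : ZMod n} {c : ℂ} (hc : c ≠ 0) (h : bd A 1 i ≠ 0) :
    fa A i c * bd A 0 (i + 1) + fb A i c * bd A 0 i + fb A i c * fa A i c * bd A 1 i = 0 := by
  rw [fa, fb]
  field_simp
  ring

/-- The effect of `e_i^c` on folded matrices. -/
structure IsE (i : ZMod n) (c : ℂ) (A A' : Folded n) : Prop where
  move : IsMove i (fa A i c) (fb A i c) A A'
  unf_eq : ∀ p q, unf A' p q = mvUnf i (fa A i c) (fb A i c) A p q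

theorem exists_isE (hn : 2 ≤ n) {i : ZMod n} {c : ℂ} {d : ℕ} {A : Folded n} (hA : IsMonicBand d A)
    (hc : c ≠ 0) (h : bd A 1 i ≠ 0) : ∃ A', IsMonicBand d A' ∧ IsE i c A A' := by
  obtain ⟨A', h1, h2, h3⟩ := exists_isMove hn i hA (fa_fb hc h)
  exact ⟨A', h1, h2, h3⟩

theorem IsMove.isE (hn : 2 ≤ n) {i : ZMod n} {c : ℂ} {d : ℕ} {A A' : Folded n}
    (hA : IsMonicBand d A) (hc : c ≠ 0) (h : bd A 1 i ≠ 0)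
    (h' : IsMove i (fa A i c) (fb A i c) A A') : IsE i c A A' := by
  obtain ⟨B, -, hB⟩ := exists_isE hn hA hc h
  rwa [h'.eq hB.move]

theorem zmod_one_ne_zero (hn : 2 ≤ n) : (1 : ZMod n) ≠ 0 := by
  have : Fact (1 < n) := ⟨hn⟩
  exact one_ne_zero

theorem zmod_two_ne_zero (hn : 3 ≤ n) : (2 : ZMod n) ≠ 0 := by
  intro h
  have := (ZMod.natCast_eq_zero_iff 2 n).1 (by exact_mod_cast h)
  have := Nat.le_of_dvd (by norm_num) this
  omega

section

variable {i : ZMod n} {c : ℂ} {A A' : Folded n}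

theorem IsE.bd_zero_self (hn : 2 ≤ n) (h0 : bd A 1 i ≠ 0) (h : IsE i c A A') :
    bd A' 0 i = c * bd A 0 i := by
  rw [bd_eq_of_mvUnf h.unf_eq, if_pos (by simp), if_neg (by simpa using zmod_one_ne_zero hn), fa,
    zero_add]
  field_simp
  ring

theorem IsE.bd_zero_succ (hn : 2 ≤ n) (h0 : bd A 1 i ≠ 0) (h : IsE i c A A') :
    bd A' 0 (i + 1) = c⁻¹ * bd A 0 (i + 1) := by
  have h1 : ¬ (i + 1 + ((0 : ℤ) : ZMod n) = i) := by simpa using zmod_one_ne_zero hn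
  rw [bd_eq_of_mvUnf h.unf_eq, if_neg h1, if_pos rfl, if_neg h1, fb, add_sub_cancel_right,
    zero_add]
  field_simp
  ring

theorem IsE.bd_zero_of_ne (h : IsE i c A A') {j : ZMod n} (h1 : j ≠ i) (h2 : j ≠ i + 1) :
    bd A' 0 j = bd A 0 j := by
  rw [bd_eq_of_mvUnf h.unf_eq, if_neg (by simpa using h1), if_neg h2, add_zero, add_zero]

theorem IsE.bd_one_self (hn : 2 ≤ n) (h : IsE i c A A') : bd A' 1 i = bd A 1 i := by
  have h1 := zmod_one_ne_zero hn
  rw [bd_eq_of_mvUnf h.unf_eq, if_neg (by simpa using h1), if_neg (by simpa using h1), add_zero,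
    add_zero]

theorem IsE.bd_one_of_ne (h : IsE i c A A') {j : ZMod n} (h1 : j + 1 ≠ i) (h2 : j ≠ i + 1) :
    bd A' 1 j = bd A 1 j := by
  rw [bd_eq_of_mvUnf h.unf_eq, if_neg (by simpa using h1), if_neg h2, add_zero, add_zero]

theorem IsE.bd_one_succ (hn : 3 ≤ n) (h : IsE i c A A') :
    bd A' 1 (i + 1) = bd A 1 (i + 1) + fb A i c * bd A 2 i := by
  have h1 : ¬ (i + 1 + ((1 : ℤ) : ZMod n) = i) := by
    rw [Int.cast_one, add_assoc, add_eq_left, one_add_one_eq_two]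
    exact zmod_two_ne_zero hn
  rw [bd_eq_of_mvUnf h.unf_eq, if_neg h1, if_pos rfl, if_neg h1, add_sub_cancel_right]
  norm_num

theorem IsE.bd_one_pred (hn : 3 ≤ n) {j : ZMod n} (hj : j + 1 = i) (h : IsE i c A A') :
    bd A' 1 j = bd A 1 j + fa A i c * bd A 2 j := by
  have h1 : j ≠ i + 1 := by
    rw [← hj, add_assoc, one_add_one_eq_two, ne_eq, left_eq_add]
    exact zmod_two_ne_zero hn
  rw [bd_eq_of_mvUnf h.unf_eq, if_pos (by simpa using hj), if_neg h1]
  norm_num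

theorem IsE.bd_two_self (hn : 3 ≤ n) (h : IsE i c A A') : bd A' 2 i = bd A 2 i := by
  have h1 := zmod_one_ne_zero (n := n) (by omega)
  have h2 := zmod_two_ne_zero hn
  rw [bd_eq_of_mvUnf h.unf_eq, if_neg (by simpa using h2), if_neg (by simpa using h1), add_zero,
    add_zero]

theorem IsE.bd_two_pred (hn : 3 ≤ n) {j : ZMod n} (hj : j + 1 = i) (h : IsE i c A A') :
    bd A' 2 j = bd A 2 j := by
  have h1 := zmod_one_ne_zero (n := n) (by omega)
  have h2 : j ≠ i + 1 := by
    rw [← hj, add_assoc, one_add_one_eq_two, ne_eq, left_eq_add]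
    exact zmod_two_ne_zero hn
  have h3 : ¬ (j + ((2 : ℤ) : ZMod n) = i) := by
    rw [← hj, add_right_inj, Int.cast_ofNat, ← one_add_one_eq_two, add_eq_left]
    exact h1
  rw [bd_eq_of_mvUnf h.unf_eq, if_neg h3, if_neg h2, add_zero, add_zero]

end

/-- The ratios of Plücker coordinates on the main diagonal of `g`. -/
def plv (N : Gr k n) (m : ℤ) : ℂ :=
  pl N (Finset.Icc (m - k + 1) m) / pl N (Finset.Icc (m - k) (m - 1))

/-- The ratios of Plücker coordinates below the main diagonal of `g`. -/
def plu (N : Gr k n) (m : ℤ) : ℂ :=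
  pl N (insert (m + 1) (Finset.Icc (m - k + 1) (m - 1))) / pl N (Finset.Icc (m - k) (m - 1))

theorem image_idx_add (I : Finset ℤ) : (I.image (· + (n : ℤ))).image (idx n) = I.image (idx n) := by
  rw [Finset.image_image]
  refine Finset.image_congr fun m _ => ?_
  have := idx_add_mul (n := n) m 1
  rwa [mul_one] at this

theorem image_add_Icc (a b c : ℤ) : (Finset.Icc a b).image (· + c) = Finset.Icc (a + c) (b + c) :=
  Finset.image_add_right_Icc a b c

theorem pl_Icc_add (N : Gr k n) (a b : ℤ) :
    pl N (Finset.Icc (a + n) (b + n)) = pl N (Finset.Icc a b) := by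
  refine pl_congr N ?_
  rw [← image_idx_add (Finset.Icc a b), image_add_Icc]

theorem pl_insert_Icc_add (N : Gr k n) (i a b : ℤ) :
    pl N (insert (i + n) (Finset.Icc (a + n) (b + n))) = pl N (insert i (Finset.Icc a b)) := by
  refine pl_congr N ?_
  rw [← image_idx_add (insert i (Finset.Icc a b)), Finset.image_insert (f := (· + (n : ℤ))),
    image_add_Icc]

theorem plv_add (N : Gr k n) (m : ℤ) : plv N (m + n) = plv N m := by
  rw [plv, plv, ← pl_Icc_add N (m - k + 1) m, ← pl_Icc_add N (m - k) (m - 1)]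
  congr 3 <;> ring_nf

theorem plu_add (N : Gr k n) (m : ℤ) : plu N (m + n) = plu N m := by
  rw [plu, plu, ← pl_insert_Icc_add N (m + 1), ← pl_Icc_add N (m - k) (m - 1)]
  congr 3 <;> ring_nf

theorem bd_zero_gMat (hk : 1 ≤ k) (x : XX n k) {j : ℤ} (h1 : 1 ≤ j) (h2 : j ≤ n) :
    bd (gMat x) 0 (j : ZMod n) = (if j ≤ k then 1 else x.2) * plv x.1 j := by
  obtain ⟨b, rfl⟩ : ∃ b : Fin n, j = (b : ℕ) + 1 := ⟨⟨(j - 1).toNat, by omega⟩, by simp only; omega⟩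
  have h := unf_coeff (gMat x) b b 0
  rw [Nat.cast_zero, mul_zero, add_zero] at h
  rw [← unf_eq_bd _ (add_zero _).symm, h, plv, gMat, Matrix.of_apply]
  simp only [le_refl, if_true]
  rw [insert_Icc_right hk]
  split_ifs <;> simp

theorem bd_one_gMat (hk : 1 ≤ k) (hkn : k < n) (x : XX n k) (i : ZMod n) :
    bd (gMat x) 1 i = (if i.val ≤ k then 1 else x.2) * plu x.1 i.val := by
  have hv := ZMod.val_lt i
  -- For the class `0` the column is `n`, and the row below the diagonal is `n + 1`, folded into the
  -- coefficient of `λ` in row `1`.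
  rcases Nat.eq_zero_or_pos i.val with h0 | h0
  · have hi : i = ((n : ℤ) : ZMod n) := by rw [(ZMod.val_eq_zero i).1 h0]; simp
    have h := unf_coeff (gMat x) ⟨0, by omega⟩ ⟨n - 1, by omega⟩ 1
    have h3 : ((n - 1 : ℕ) : ℤ) + 1 = n := by omega
    simp only [h3] at h
    rw [h0, if_pos (by omega)]
    conv_lhs => rw [hi]
    rw [← unf_eq_bd (p := ((0 : ℕ) : ℤ) + 1 + n * (1 : ℕ)) _ (by push_cast; ring), h, gMat,
      Matrix.of_apply]
    simp only [h3]
    rw [if_neg (by omega), if_neg (by push_cast; omega), Polynomial.coeff_X_mul,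
      Polynomial.coeff_C_zero, Units.val_one, one_mul, ← plu_add, Nat.cast_zero, zero_add,
      zero_add, plu]
    congr 1
    refine pl_congr _ ?_
    rw [Finset.image_insert, Finset.image_insert, add_comm (n : ℤ) 1]
    have := idx_add_mul (n := n) 1 1
    rw [mul_one] at this
    rw [this]
  · have h := unf_coeff (gMat x) ⟨i.val, by omega⟩ ⟨i.val - 1, by omega⟩ 0
    have h3 : ((i.val - 1 : ℕ) : ℤ) + 1 = i.val := by omega
    simp only [h3, Nat.cast_zero, mul_zero, add_zero] at h
    rw [bd, h, gMat, Matrix.of_apply]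
    simp only [h3]
    rw [plu, if_pos (show (i.val : ℤ) ≤ i.val + 1 by omega)]
    simp only [Nat.cast_le]
    split_ifs <;> simp

/-- A nonzero complex number as a unit (and `1` for zero). -/
def unitOf (a : ℂ) : ℂˣ := if h : a ≠ 0 then Units.mk0 a h else 1

theorem coe_unitOf {a : ℂ} (h : a ≠ 0) : (unitOf a : ℂ) = a := by
  rw [unitOf, dif_pos h, Units.val_mk0]

theorem toUnit_eq {a : ℂ} (h : a ≠ 0) : toUnit a = Part.some (unitOf a) :=
  Part.eq_some_iff.2 ⟨h, by rw [unitOf, dif_pos h]; rfl⟩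

theorem ratio_map_eq {a b r : ℂ} (u : ℂˣ) (ha : a ≠ 0) (hb : b ≠ 0) (hr : r = u * (a / b)) :
    (ratio a b).map (fun v => u * v) = Part.some (unitOf r) := by
  have h1 : ratio a b = Part.some (Units.mk0 (a / b) (div_ne_zero ha hb)) :=
    Part.eq_some_iff.2 ⟨⟨ha, hb⟩, rfl⟩
  rw [h1, Part.map_some]
  congr 1
  ext
  rw [coe_unitOf]
  · rw [hr]; rfl
  · rw [hr]
    exact mul_ne_zero u.ne_zero (div_ne_zero ha hb)

theorem IsGeneric.pl_ne_zero' (hk : k ≤ n) {N : Gr k n} (h : IsGeneric N) (a b : ℤ)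
    (hab : b = a + k - 1) : pl N (Finset.Icc a b) ≠ 0 := by
  have := h.pl_ne_zero hk (a + k)
  rwa [add_sub_cancel_right, ← hab] at this

theorem bd_zero_gMat_ne_zero (hk : 1 ≤ k) (hkn : k < n) {x : XX n k} (hx : IsGeneric x.1)
    (i : ZMod n) : bd (gMat x) 0 i ≠ 0 := by
  obtain ⟨j, h1, h2, rfl⟩ : ∃ j : ℤ, 1 ≤ j ∧ j ≤ n ∧ i = j := by
    have := ZMod.val_lt i
    rcases Nat.eq_zero_or_pos i.val with h0 | h0
    · exact ⟨n, by omega, le_rfl, by rw [(ZMod.val_eq_zero i).1 h0]; simp⟩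
    · exact ⟨i.val, by omega, by omega, by simp⟩
  rw [bd_zero_gMat hk x h1 h2, plv]
  refine mul_ne_zero ?_ (div_ne_zero (hx.pl_ne_zero' hkn.le _ _ (by ring))
    (hx.pl_ne_zero' hkn.le _ _ (by ring)))
  split_ifs
  · exact one_ne_zero
  · exact x.2.ne_zero

theorem repr1_spec (i : ZMod n) : 1 ≤ repr1 i ∧ repr1 i ≤ n ∧ ((repr1 i : ℤ) : ZMod n) = i := by
  have hn := natCast_pos_of_neZero n
  have hv := ZMod.val_lt i
  rw [repr1]
  split_ifs with h
  · subst h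
    exact ⟨by omega, le_rfl, by simp⟩
  · have := (ZMod.val_ne_zero i).2 h
    exact ⟨by omega, by omega, by simp⟩

theorem γEntry_eq (hk : 1 ≤ k) (hkn : k < n) {x : XX n k} (hx : IsGeneric x.1) (i : ZMod n) :
    γEntry (repr1 i) x = Part.some (unitOf (bd (gMat x) 0 i)) := by
  obtain ⟨h1, h2, h3⟩ := repr1_spec i
  refine ratio_map_eq _ (hx.pl_ne_zero' hkn.le _ _ (by ring)) (hx.pl_ne_zero hkn.le _) ?_
  rw [← h3, bd_zero_gMat hk x h1 h2, h3]
  split_ifs <;> rfl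

theorem bd_zero_gMat_val (hk : 1 ≤ k) (hkn : k < n) (x : XX n k) (i : ZMod n) :
    bd (gMat x) 0 i = (if i.val ≤ k ∧ i.val ≠ 0 then 1 else x.2) * plv x.1 i.val := by
  have := ZMod.val_lt i
  rcases Nat.eq_zero_or_pos i.val with h0 | h0
  · have hi : i = ((n : ℤ) : ZMod n) := by rw [(ZMod.val_eq_zero i).1 h0]; simp
    rw [h0, if_neg (by simp)]
    conv_lhs => rw [hi]
    have hp := plv_add (n := n) x.1 0
    rw [zero_add] at hp
    rw [bd_zero_gMat hk x (by omega) le_rfl, hp, if_neg (by omega)]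
    rfl
  · have hi : i = ((i.val : ℤ) : ZMod n) := by simp
    conv_lhs => rw [hi]
    rw [bd_zero_gMat hk x (by omega) (by omega)]
    simp only [Nat.cast_le, ne_eq, h0.ne', not_false_iff, and_true]

/-- The factor `t⁻¹` in `φ_0` arises because in column `n` the diagonal entry of `g` carries `t`,
while the unfolded entry below it is a coefficient of `λ`. -/
theorem φEntry_eq (hk : 1 ≤ k) (hkn : k < n) {x : XX n k} (hx : IsGeneric x.1) {i : ZMod n}
    (h : bd (gMat x) 1 i ≠ 0) :
    φEntry i x = Part.some (unitOf (bd (gMat x) 1 i / bd (gMat x) 0 i)) := by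
  have h1 := hx.pl_ne_zero' hkn.le (i.val - k) (i.val - 1) (by ring)
  have h2 := hx.pl_ne_zero' hkn.le (i.val - k + 1) i.val (by ring)
  have ht := x.2.ne_zero
  rw [bd_one_gMat hk hkn, plu] at h
  refine ratio_map_eq _ (fun h0 => h (by rw [h0]; simp)) h2 ?_
  rw [bd_one_gMat hk hkn, bd_zero_gMat_val hk hkn, plu, plv]
  simp only [Nat.cast_eq_zero]
  by_cases h0 : i.val = 0
  · simp only [h0, Nat.zero_le, if_true, Nat.cast_zero, ne_eq, not_true, and_false, if_false] at h1 h2 ⊢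
    simp only [Units.val_one, Units.val_inv_eq_inv_val]
    field_simp
  · by_cases hk' : i.val ≤ k
    · simp only [h0, hk', if_true, if_false, ne_eq, not_false_iff, and_true]
      simp only [Units.val_one]
      field_simp
    · simp only [h0, hk', if_false, false_and]
      simp only [Units.val_one]
      field_simp

/-- The factor `t⁻¹` in `ε_k` reflects that diagonal entries of `g` acquire the factor `t` from
column `k + 1` on. -/
theorem εEntry_eq (hk : 1 ≤ k) (hkn : k < n) {x : XX n k} (hx : IsGeneric x.1) {i : ZMod n}
    (h : bd (gMat x) 1 i ≠ 0) :
    εEntry i x = Part.some (unitOf (bd (gMat x) 1 i / bd (gMat x) 0 (i + 1))) := by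
  have h1 := hx.pl_ne_zero' hkn.le (i.val - k) (i.val - 1) (by ring)
  have h2 := hx.pl_ne_zero' hkn.le (i.val - k + 1) i.val (by ring)
  have h3 := hx.pl_ne_zero' hkn.le (i.val - k + 2) (i.val + 1) (by ring)
  have hv := ZMod.val_lt i
  have ht := x.2.ne_zero
  have hi : i + 1 = ((i.val + 1 : ℤ) : ZMod n) := by simp
  rw [bd_one_gMat hk hkn, plu] at h
  refine ratio_map_eq _ (mul_ne_zero (fun h0 => h (by rw [h0]; simp)) h2) (mul_ne_zero h1 h3) ?_
  rw [hi, bd_zero_gMat hk x (by omega) (by omega), bd_one_gMat hk hkn, plu, plv]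
  have e1 : (i.val : ℤ) + 1 - k + 1 = i.val - k + 2 := by ring
  have e2 : (i.val : ℤ) + 1 - k = i.val - k + 1 := by ring
  rw [e1, e2, add_sub_cancel_right]
  rcases lt_trichotomy i.val k with hlt | heq | hlt
  · rw [if_pos hlt.le, if_pos (by omega), if_neg (by omega)]
    simp only [Units.val_one]
    field_simp
  · rw [if_pos heq.le, if_neg (by omega), if_pos (by omega)]
    simp only [Units.val_one, Units.val_inv_eq_inv_val]
    field_simp
  · rw [if_neg (by omega), if_neg (by omega), if_neg (by omega)]
    simp only [Units.val_one]
    field_simp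

end Crystal

/-! ### Relations between loop unipotents. -/

section Unipotent

variable {n : ℕ} [NeZero n]

/-- The elementary matrices of the loop algebra. -/
def loopE (i : ZMod n) (z : ℂ) : Matrix (Fin n) (Fin n) ℂ :=
  Matrix.single (idx n i.val) (idx n (i.val + 1)) (if i = 0 then 1 / z else 1)

theorem loopX_eq (i : ZMod n) (a z : ℂ) : loopX i a z = 1 + a • loopE i z := by
  rw [loopX, xMat, loopE, Matrix.smul_single]
  split_ifs <;> simp [div_eq_mul_inv]

theorem loopE_mul (i j : ZMod n) (h : i + 1 ≠ j) (z : ℂ) : loopE i z * loopE j z = 0 := by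
  refine Matrix.single_mul_single_of_ne _ _ _ _ (fun h0 => h ?_) _
  rw [idx_eq_idx_val] at h0
  simpa using h0

theorem loopX_comm {i j : ZMod n} (h1 : i + 1 ≠ j) (h2 : j + 1 ≠ i) (a b z : ℂ) :
    loopX i a z * loopX j b z = loopX j b z * loopX i a z := by
  rw [loopX_eq, loopX_eq, add_mul, mul_add, mul_add, add_mul, mul_add, mul_add, smul_mul_smul_comm,
    smul_mul_smul_comm, loopE_mul i j h1, loopE_mul j i h2]
  simp only [one_mul, mul_one, smul_zero, add_zero]
  abel

/-- Since `E_j E_i = 0` when `n ≥ 3`, both triple products are combinations of `1`, `E_i`, `E_j` and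
`E_i E_j`; the hypotheses match the coefficients. -/
theorem loopX_braid (hn : 3 ≤ n) {i j : ZMod n} (hj : j = i + 1) {a₁ a₂ a₃ b₁ b₂ b₃ : ℂ}
    (h1 : a₁ + a₃ = b₂) (h2 : a₂ = b₁ + b₃) (h3 : a₃ * a₂ = b₂ * b₁) (z : ℂ) :
    loopX i a₃ z * (loopX j a₂ z * loopX i a₁ z) =
      loopX j b₃ z * (loopX i b₂ z * loopX j b₁ z) := by
  have e1 : ∀ i : ZMod n, loopE i z * loopE i z = 0 := fun i =>
    loopE_mul i i (by simpa using zmod_one_ne_zero (n := n) (by omega)) z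
  have e2 : loopE j z * loopE i z = 0 := loopE_mul j i (by
    rw [hj, add_assoc, one_add_one_eq_two, ne_eq, add_eq_left]
    exact zmod_two_ne_zero hn) z
  have e3 : loopX i a₃ z * (loopX j a₂ z * loopX i a₁ z) = 1 + (a₁ + a₃) • loopE i z +
      a₂ • loopE j z + (a₃ * a₂) • (loopE i z * loopE j z) := by
    simp only [loopX_eq, add_mul, mul_add, one_mul, mul_one, smul_mul_smul_comm, e2, e1, smul_zero,
      add_zero, add_smul]
    abel
  have e4 : loopX j b₃ z * (loopX i b₂ z * loopX j b₁ z) = 1 + b₂ • loopE i z +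
      (b₁ + b₃) • loopE j z + (b₂ * b₁) • (loopE i z * loopE j z) := by
    have e5 : loopE j z * (loopE i z * loopE j z) = 0 := by rw [← mul_assoc, e2, zero_mul]
    simp only [loopX_eq, add_mul, mul_add, one_mul, mul_one, smul_mul_smul_comm, e2, e1, e5,
      smul_zero, add_zero, add_smul]
    abel
  rw [e3, e4, h1, h2, ← h2, h3]

/-- `A'` is a multiple of `A` by `M` on the left, up to an invertible matrix on the right. -/
def LeftRel (M : ℂ → Matrix (Fin n) (Fin n) ℂ) (A A' : Folded n) : Prop :=
  ∀ z, z ≠ 0 → ∃ Q, IsUnit Q ∧ ev z A' = M z * ev z A * Q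

theorem LeftRel.trans {M M' : ℂ → Matrix (Fin n) (Fin n) ℂ} {A A' A'' : Folded n}
    (h' : LeftRel M' A' A'') (h : LeftRel M A A') : LeftRel (fun z => M' z * M z) A A'' := by
  intro z hz
  obtain ⟨Q, hQ, h⟩ := h z hz
  obtain ⟨Q', hQ', h'⟩ := h' z hz
  refine ⟨Q * Q', hQ.mul hQ', ?_⟩
  rw [h', h]
  simp only [mul_assoc]

theorem range_mul_of_isUnit {P Q : Matrix (Fin n) (Fin n) ℂ} (h : IsUnit Q) :
    LinearMap.range (P * Q).mulVecLin = LinearMap.range P.mulVecLin := by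
  rw [Matrix.mulVecLin_mul]
  refine LinearMap.range_comp_of_range_eq_top _ (LinearMap.range_eq_top.2 ?_)
  exact Matrix.mulVec_surjective_iff_isUnit.2 h

theorem LeftRel.range_eq {M : ℂ → Matrix (Fin n) (Fin n) ℂ} {A A' A'' : Folded n}
    (h : LeftRel M A A') (h' : LeftRel M A A'') {z : ℂ} (hz : z ≠ 0) :
    LinearMap.range (ev z A').mulVecLin = LinearMap.range (ev z A'').mulVecLin := by
  obtain ⟨Q, hQ, h⟩ := h z hz
  obtain ⟨Q', hQ', h'⟩ := h' z hz
  rw [h, h', range_mul_of_isUnit hQ, range_mul_of_isUnit hQ']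

theorem IsE.leftRel (hn : 2 ≤ n) {i : ZMod n} {c : ℂ} {A A' : Folded n} (h : IsE i c A A') :
    LeftRel (loopX i (fa A i c)) A A' := fun z hz => ⟨_, isUnit_loopX hn _ _ _, h.move z hz⟩

theorem LeftRel.congr {M M' : ℂ → Matrix (Fin n) (Fin n) ℂ} {A A' : Folded n}
    (h : LeftRel M A A') (h' : ∀ z, M z = M' z) : LeftRel M' A A' := by
  rwa [← funext h']

/-- This and the next two identities are the coefficient conditions of `loopX_braid`. In `IsE.braid`
the letters stand for diagonal entries of `A`: `p`, `q` for diagonal `0` at `i`, `j`; `u`, `v` for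
diagonal `1` at `i`, `j`; and `w` for diagonal `2` at `i`. -/
theorem braid_add {p q u v w c d : ℂ} (hu : u ≠ 0) (hv : v ≠ 0) (hd : d ≠ 0)
    (h1 : v + (d⁻¹ - 1) * q / u * w ≠ 0)
    (h2 : u + (c - 1) * q / v * w ≠ 0) :
    (d - 1) * p / u + (c - 1) * (d * p) / (u + (c * d - 1) * (d⁻¹ * q) /
      (v + (d⁻¹ - 1) * q / u * w) * w) = (c * d - 1) * p / (u + (c - 1) * q / v * w) := by
  have e1 : v + (d⁻¹ - 1) * q / u * w = (d * u * v + (1 - d) * q * w) / (d * u) := by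
    field_simp
  have e2 : u + (c - 1) * q / v * w = (u * v + (c - 1) * q * w) / v := by
    field_simp
  rw [e1] at h1 ⊢
  rw [e2] at h2 ⊢
  have h1' : d * u * v + (1 - d) * q * w ≠ 0 := left_ne_zero_of_mul h1
  have h2' : u * v + (c - 1) * q * w ≠ 0 := left_ne_zero_of_mul h2
  have e3 : u + (c * d - 1) * (d⁻¹ * q) / ((d * u * v + (1 - d) * q * w) / (d * u)) * w =
      d * u * (u * v + (c - 1) * q * w) / (d * u * v + (1 - d) * q * w) := by
    generalize hX : d * u * v + (1 - d) * q * w = X at h1'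
    field_simp
    rw [← hX]
    ring
  rw [e3]
  generalize hX : d * u * v + (1 - d) * q * w = X at h1'
  generalize hY : u * v + (c - 1) * q * w = Y at h2'
  field_simp
  rw [← hX, ← hY]
  ring

theorem braid_add' {q u v w c d : ℂ} (hu : u ≠ 0) (hv : v ≠ 0) (hc : c ≠ 0) (hd : d ≠ 0)
    (h1 : v + (d⁻¹ - 1) * q / u * w ≠ 0)
    (h2 : u + (c - 1) * q / v * w ≠ 0) :
    (c * d - 1) * (d⁻¹ * q) / (v + (d⁻¹ - 1) * q / u * w) =
      (c - 1) * q / v + (d - 1) * ((c * d)⁻¹ * (c * q)) /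
        (v + ((c * d)⁻¹ - 1) * (c * q) / (u + (c - 1) * q / v * w) * w) := by
  have e1 : v + (d⁻¹ - 1) * q / u * w = (d * u * v + (1 - d) * q * w) / (d * u) := by
    field_simp
  have e2 : u + (c - 1) * q / v * w = (u * v + (c - 1) * q * w) / v := by
    field_simp
  rw [e1] at h1 ⊢
  rw [e2] at h2 ⊢
  have h1' : d * u * v + (1 - d) * q * w ≠ 0 := left_ne_zero_of_mul h1
  have h2' : u * v + (c - 1) * q * w ≠ 0 := left_ne_zero_of_mul h2
  have e3 : v + ((c * d)⁻¹ - 1) * (c * q) / ((u * v + (c - 1) * q * w) / v) * w =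
      v * (d * u * v + (1 - d) * q * w) / (d * (u * v + (c - 1) * q * w)) := by
    generalize hY : u * v + (c - 1) * q * w = Y at h2'
    field_simp
    rw [← hY]
    ring
  rw [e3]
  generalize hX : d * u * v + (1 - d) * q * w = X at h1'
  generalize hY : u * v + (c - 1) * q * w = Y at h2'
  field_simp
  rw [← hX, ← hY]
  ring

theorem braid_mul {p q u v w c d : ℂ} (hu : u ≠ 0) (hv : v ≠ 0) (hd : d ≠ 0)
    (h1 : v + (d⁻¹ - 1) * q / u * w ≠ 0)
    (h2 : u + (c - 1) * q / v * w ≠ 0) :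
    (c - 1) * (d * p) / (u + (c * d - 1) * (d⁻¹ * q) / (v + (d⁻¹ - 1) * q / u * w) * w) *
      ((c * d - 1) * (d⁻¹ * q) / (v + (d⁻¹ - 1) * q / u * w)) =
    (c * d - 1) * p / (u + (c - 1) * q / v * w) * ((c - 1) * q / v) := by
  have e1 : v + (d⁻¹ - 1) * q / u * w = (d * u * v + (1 - d) * q * w) / (d * u) := by
    field_simp
  have e2 : u + (c - 1) * q / v * w = (u * v + (c - 1) * q * w) / v := by
    field_simp
  rw [e1] at h1 ⊢
  rw [e2] at h2 ⊢
  have h1' : d * u * v + (1 - d) * q * w ≠ 0 := left_ne_zero_of_mul h1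
  have h2' : u * v + (c - 1) * q * w ≠ 0 := left_ne_zero_of_mul h2
  have e3 : u + (c * d - 1) * (d⁻¹ * q) / ((d * u * v + (1 - d) * q * w) / (d * u)) * w =
      d * u * (u * v + (c - 1) * q * w) / (d * u * v + (1 - d) * q * w) := by
    generalize hX : d * u * v + (1 - d) * q * w = X at h1'
    field_simp
    rw [← hX]
    ring
  rw [e3]
  generalize d * u * v + (1 - d) * q * w = X at h1'
  generalize u * v + (c - 1) * q * w = Y at h2'
  field_simp

/-- Right factors do not affect ranges. The left factors after each step are determined by diagonals
`0`, `1` and `2`, whose changes are tracked explicitly, and they satisfy the braid relation. -/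
theorem IsE.braid (hn : 3 ≤ n) {i j : ZMod n} (hj : j = i + 1) {c d : ℂ} (hc : c ≠ 0) (hd : d ≠ 0)
    {A A₁ A₂ A₃ B₁ B₂ B₃ : Folded n} (h1 : IsE i d A A₁) (h2 : IsE j (c * d) A₁ A₂)
    (h3 : IsE i c A₂ A₃) (k1 : IsE j c A B₁) (k2 : IsE i (c * d) B₁ B₂) (k3 : IsE j d B₂ B₃)
    (n1 : bd A 1 i ≠ 0) (n2 : bd A 1 j ≠ 0) (n3 : bd A₁ 1 j ≠ 0) (n4 : bd B₁ 1 i ≠ 0) {z : ℂ}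
    (hz : z ≠ 0) :
    LinearMap.range (ev z A₃).mulVecLin = LinearMap.range (ev z B₃).mulVecLin := by
  have hn2 : 2 ≤ n := by omega
  have hij : i ≠ j := by
    rw [hj]
    simpa using zmod_one_ne_zero hn2
  have hij' : i ≠ j + 1 := by
    rw [hj, add_assoc, one_add_one_eq_two, ne_eq, left_eq_add]
    exact zmod_two_ne_zero hn
  have a1 : bd A₁ 0 j = d⁻¹ * bd A 0 j := hj ▸ h1.bd_zero_succ hn2 n1
  have a2 : bd A₁ 0 i = d * bd A 0 i := h1.bd_zero_self hn2 n1
  have a3 : bd A₁ 1 j = bd A 1 j + fb A i d * bd A 2 i := hj ▸ h1.bd_one_succ hn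
  have a4 : bd A₁ 1 i = bd A 1 i := h1.bd_one_self hn2
  have a5 : bd A₁ 2 i = bd A 2 i := h1.bd_two_self hn
  have a6 : bd A₂ 0 i = bd A₁ 0 i := h2.bd_zero_of_ne hij hij'
  have a7 : bd A₂ 1 i = bd A₁ 1 i + fa A₁ j (c * d) * bd A₁ 2 i := h2.bd_one_pred hn hj.symm
  have b1 : bd B₁ 0 j = c * bd A 0 j := k1.bd_zero_self hn2 n2
  have b2 : bd B₁ 0 i = bd A 0 i := k1.bd_zero_of_ne hij hij'
  have b3 : bd B₁ 1 j = bd A 1 j := k1.bd_one_self hn2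
  have b4 : bd B₁ 1 i = bd A 1 i + fa A j c * bd A 2 i := k1.bd_one_pred hn hj.symm
  have b5 : bd B₁ 2 i = bd A 2 i := k1.bd_two_pred hn hj.symm
  have b6 : bd B₂ 0 j = (c * d)⁻¹ * bd B₁ 0 j := hj ▸ k2.bd_zero_succ hn2 n4
  have b7 : bd B₂ 1 j = bd B₁ 1 j + fb B₁ i (c * d) * bd B₁ 2 i := hj ▸ k2.bd_one_succ hn
  have v1 : bd A 1 j + (d⁻¹ - 1) * bd A 0 j / bd A 1 i * bd A 2 i ≠ 0 := by
    rw [a3, fb, ← hj] at n3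
    exact n3
  have v2 : bd A 1 i + (c - 1) * bd A 0 j / bd A 1 j * bd A 2 i ≠ 0 := by
    rw [b4, fa] at n4
    exact n4
  refine LeftRel.range_eq (((h3.leftRel hn2).trans ((h2.leftRel hn2).trans (h1.leftRel hn2))).congr
    fun z => loopX_braid hn hj ?_ ?_ ?_ z)
    ((k3.leftRel hn2).trans ((k2.leftRel hn2).trans (k1.leftRel hn2))) hz
  · simp only [fa, fb, a6, a7, a5, a4, a3, a2, a1, b4, b2, ← hj]
    exact braid_add n1 n2 hd v1 v2
  · simp only [fa, fb, a3, a1, b7, b6, b5, b4, b3, b1, ← hj]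
    exact braid_add' n1 n2 hc hd v1 v2
  · simp only [fa, fb, a6, a7, a5, a4, a3, a2, a1, b4, b2, ← hj]
    exact braid_mul n1 n2 hd v1 v2

theorem IsE.comm (hn : 2 ≤ n) {i j : ZMod n} (hij : i ≠ j) (hij₁ : i ≠ j + 1) (hij₂ : j ≠ i + 1)
    {c d : ℂ} {A A₁ A₂ B₁ B₂ : Folded n} (h1 : IsE j d A A₁) (h2 : IsE i c A₁ A₂)
    (k1 : IsE i c A B₁) (k2 : IsE j d B₁ B₂) {z : ℂ} (hz : z ≠ 0) :
    LinearMap.range (ev z A₂).mulVecLin = LinearMap.range (ev z B₂).mulVecLin := by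
  refine LeftRel.range_eq (((h2.leftRel hn).trans (h1.leftRel hn)).congr fun z => ?_)
    ((k2.leftRel hn).trans (k1.leftRel hn)) hz
  rw [loopX_comm hij₂.symm hij₁.symm, fa, fa, fa, fa, h1.bd_zero_of_ne hij hij₁,
    h1.bd_one_of_ne hij₂.symm hij₁, k1.bd_zero_of_ne hij.symm hij₂, k1.bd_one_of_ne hij₁.symm hij₂]

/-- The first step multiplies the diagonal entry at `i` by `d` and keeps the one below it, so the
left parameters add up: `(d - 1) + (c - 1) d = c d - 1`. -/
theorem IsE.mul (hn : 2 ≤ n) {i : ZMod n} {c d : ℂ} {A A₁ A₂ B : Folded n} (h0 : bd A 1 i ≠ 0)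
    (h1 : IsE i d A A₁) (h2 : IsE i c A₁ A₂) (k : IsE i (c * d) A B) {z : ℂ} (hz : z ≠ 0) :
    LinearMap.range (ev z A₂).mulVecLin = LinearMap.range (ev z B).mulVecLin := by
  refine LeftRel.range_eq (((h2.leftRel hn).trans (h1.leftRel hn)).congr fun z => ?_)
    (k.leftRel hn) hz
  rw [loopX_mul hn, fa, fa, fa, h1.bd_zero_self hn h0, h1.bd_one_self hn]
  congr 1
  field_simp
  ring

end Unipotent

/-! ### The operators `e_i^c` on points and on pairs of points. -/

section Points

variable {k l n : ℕ} [NeZero n]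

/-- The action of `e_i^c` on `𝕏_k`, without regard to its domain of definition. -/
def eT (i : ZMod n) (c : ℂ) (x : XX n k) : XX n k :=
  (Gr.mkD x.1 (x.1.1.map (loopX i (fa (gMat x) i c) (spec x)).mulVecLin), x.2)

@[simp] theorem eT_snd (i : ZMod n) (c : ℂ) (x : XX n k) : (eT i c x).2 = x.2 := rfl

theorem coe_eT (hn : 2 ≤ n) (i : ZMod n) (c : ℂ) (x : XX n k) :
    (eT i c x).1.1 = x.1.1.map (loopX i (fa (gMat x) i c) (spec x)).mulVecLin :=
  Gr.coe_mkD _ (by rw [finrank_map_of_isUnit (isUnit_loopX hn _ _ _), x.1.2])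

theorem eT_one (hn : 2 ≤ n) (i : ZMod n) (x : XX n k) : eT i 1 x = x := by
  refine Prod.ext (Subtype.ext ?_) rfl
  rw [coe_eT hn, fa, sub_self, zero_mul, zero_div, loopX_zero, Matrix.mulVecLin_one,
    Submodule.map_id]

/-- The right unipotent factor does not enlarge the column span, so the moved band matrix has its
columns in the moved subspace at the special value; the characterization of `g` identifies it. -/
theorem eT_spec (hk : 1 ≤ k) (hkn : k < n) {i : ZMod n} {c : ℂ} {x : XX n k} (hx : IsGeneric x.1)
    (hc : c ≠ 0) (h : bd (gMat x) 1 i ≠ 0) :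
    IsGeneric (eT i c x).1 ∧ IsE i c (gMat x) (gMat (eT i c x)) := by
  have hn : 2 ≤ n := by omega
  obtain ⟨A', h1, h2⟩ := exists_isE hn (gMat_isMonicBand hk hkn hx) hc h
  obtain ⟨h3, h4⟩ := gMat_eq_of_col_mem hk hkn h1 (x := eT i c x) fun b => by
    rw [coe_eT hn]
    have h5 := h2.move _ (spec_ne_zero x)
    change (ev (spec x) A').col b ∈ _
    rw [h5, mul_assoc]
    refine ⟨(ev (spec x) (gMat x) * loopX i (fb (gMat x) i c) (spec x)).col b, ?_, rfl⟩
    rw [← range_gMat hk hkn hx]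
    exact ⟨(loopX i (fb (gMat x) i c) (spec x)).col b, rfl⟩
  refine ⟨h3, ?_⟩
  rw [h4]
  exact h2

theorem e_crystal_eq (hk : 1 ≤ k) (hkn : k < n) {i : ZMod n} (c : ℂˣ) {x : XX n k}
    (hx : IsGeneric x.1) (h : bd (gMat x) 1 i ≠ 0) :
    (crystal n k).e i (c, x) = Part.some (eT i c x) := by
  have hn : 2 ≤ n := by omega
  have h0 := bd_zero_gMat_ne_zero hk hkn hx i
  have h1 : act (xMat i (if i = 0 then (-1) ^ (k - 1) / (x.2 : ℂ) * (((c : ℂ) - 1) /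
      (unitOf (bd (gMat x) 1 i / bd (gMat x) 0 i) : ℂ)) else (((c : ℂ) - 1) /
      (unitOf (bd (gMat x) 1 i / bd (gMat x) 0 i) : ℂ)))) x.1 = Part.some (eT i c x).1 := by
    have h2 : loopX i (fa (gMat x) i c) (spec x) =
        xMat i (if i = 0 then (-1) ^ (k - 1) / (x.2 : ℂ) * (((c : ℂ) - 1) /
      (unitOf (bd (gMat x) 1 i / bd (gMat x) 0 i) : ℂ)) else (((c : ℂ) - 1) /
      (unitOf (bd (gMat x) 1 i / bd (gMat x) 0 i) : ℂ))) := by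
      have h3 := x.2.ne_zero
      -- The sign is its own inverse, so the factor `(-1)^(k-1) / t` in the definition of `e_0` is
      -- `1 / spec x`.
      have h4 : ((-1 : ℂ) ^ (k - 1)) * (-1 : ℂ) ^ (k - 1) = 1 := by
        rw [← mul_pow]
        simp
      have h5 : ((-1 : ℂ) ^ (k - 1)) ≠ 0 := pow_ne_zero _ (by norm_num)
      rw [loopX, coe_unitOf (div_ne_zero h h0), fa, spec]
      congr 2
      · rw [div_div_eq_mul_div]
        generalize ((-1 : ℂ) ^ (k - 1)) = s at *
        field_simp
        linear_combination (-(c : ℂ) + 1) * h4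
      · rw [div_div_eq_mul_div]
    rw [← h2]
    exact Gr.mk?_eq x.1 (by rw [finrank_map_of_isUnit (isUnit_loopX hn _ _ _), x.1.2])
  simp only [crystal, φEntry_eq hk hkn hx h, Part.bind_eq_bind, Part.bind_some]
  rw [h1, Part.bind_some]
  rfl

theorem γ_crystal_eq (hk : 1 ≤ k) (hkn : k < n) {x : XX n k} (hx : IsGeneric x.1) :
    (crystal n k).γ x = Part.some fun i => unitOf (bd (gMat x) 0 i) := by
  refine Part.eq_some_iff.2 ⟨fun i => ?_, ?_⟩
  · rw [γEntry_eq hk hkn hx]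
    trivial
  · ext1 i
    exact Part.get_eq_of_mem (γEntry_eq hk hkn hx i ▸ Part.mem_some _) _

/-- The product of the two matrices attached to a point. -/
def gm (p : XX n l × XX n k) : Folded n := gMat p.1 * gMat p.2

/-- The denominators in the action of `e_i^c` on a product. -/
def den (i : ZMod n) (c : ℂ) (p : XX n l × XX n k) : ℂ :=
  c * bd (gMat p.1) 1 i * bd (gMat p.2) 0 i + bd (gMat p.1) 0 (i + 1) * bd (gMat p.2) 1 i

/-- The action of `e_i^c` on a product, without regard to its domain of definition. -/
def eP (i : ZMod n) (c : ℂ) (p : XX n l × XX n k) : XX n l × XX n k :=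
  (eT i (den i c p / den i 1 p) p.1, eT i (den i 1 p * c / den i c p) p.2)

/-- Both components are generic. -/
def Gen₂ (p : XX n l × XX n k) : Prop := IsGeneric p.1.1 ∧ IsGeneric p.2.1

/-- The domain on which the maps with index `i` are considered. -/
structure DomF (i : ZMod n) (p : XX n l × XX n k) : Prop where
  gen : Gen₂ p
  ne₁ : bd (gMat p.1) 1 i ≠ 0
  ne₂ : bd (gMat p.2) 1 i ≠ 0
  ne : den i 1 p ≠ 0

theorem eP_one (hn : 2 ≤ n) {i : ZMod n} {p : XX n l × XX n k} (h : den i 1 p ≠ 0) :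
    eP i 1 p = p := by
  rw [eP, mul_one, div_self h, eT_one hn, eT_one hn]

variable (hl : 1 ≤ l) (hln : l < n) (hk : 1 ≤ k) (hkn : k < n)
include hl hln hk hkn

theorem gm_isMonicBand {p : XX n l × XX n k} (hp : Gen₂ p) :
    IsMonicBand (n - l + (n - k)) (gm p) :=
  (gMat_isMonicBand hl hln hp.1).mul (gMat_isMonicBand hk hkn hp.2)

theorem bd_zero_gm {p : XX n l × XX n k} (hp : Gen₂ p) (i : ZMod n) :
    bd (gm p) 0 i = bd (gMat p.1) 0 i * bd (gMat p.2) 0 i :=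
  bd_zero_mul (gMat_isMonicBand hl hln hp.1).isLower (gMat_isMonicBand hk hkn hp.2).isLower i

theorem bd_one_gm {p : XX n l × XX n k} (hp : Gen₂ p) (i : ZMod n) :
    bd (gm p) 1 i = den i 1 p := by
  rw [gm, bd_one_mul (gMat_isMonicBand hl hln hp.1).isLower (gMat_isMonicBand hk hkn hp.2).isLower,
    den, one_mul]

theorem bd_zero_gm_ne_zero {p : XX n l × XX n k} (hp : Gen₂ p) (i : ZMod n) :
    bd (gm p) 0 i ≠ 0 := by
  rw [bd_zero_gm hl hln hk hkn hp]
  exact mul_ne_zero (bd_zero_gMat_ne_zero hl hln hp.1 i) (bd_zero_gMat_ne_zero hk hkn hp.2 i)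

/-- With the parameters of the product rule, the unipotents between the two factors cancel, and the
outer ones are those that the diagonals of the product matrix prescribe. -/
theorem eP_spec {i : ZMod n} {c : ℂ} {p : XX n l × XX n k} (hp : DomF i p) (hc : c ≠ 0)
    (hd : den i c p ≠ 0) : DomF i (eP i c p) ∧ IsE i c (gm p) (gm (eP i c p)) := by
  have hn : 2 ≤ n := by omega
  obtain ⟨⟨g1, g2⟩, n1, n2, n0⟩ := hp
  have c1 : den i c p / den i 1 p ≠ 0 := div_ne_zero hd n0
  have c2 : den i 1 p * c / den i c p ≠ 0 := div_ne_zero (mul_ne_zero n0 hc) hd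
  obtain ⟨g1', e1⟩ := eT_spec hl hln g1 c1 n1
  obtain ⟨g2', e2⟩ := eT_spec hk hkn g2 c2 n2
  have hgen : Gen₂ (eP i c p) := ⟨g1', g2'⟩
  have n0' : bd (gm p) 1 i ≠ 0 := by rwa [bd_one_gm hl hln hk hkn ⟨g1, g2⟩]
  have d1 := bd_zero_gMat_ne_zero hl hln g1 i
  have d1' := bd_zero_gMat_ne_zero hl hln g1 (i + 1)
  have d2 := bd_zero_gMat_ne_zero hk hkn g2 i
  have d2' := bd_zero_gMat_ne_zero hk hkn g2 (i + 1)
  have key : IsE i c (gm p) (gm (eP i c p)) := by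
    refine IsMove.isE hn (gm_isMonicBand hl hln hk hkn ⟨g1, g2⟩) hc n0' fun z hz => ?_
    have h1 := e1.move z hz
    have h2 := e2.move z hz
    rw [gm, gm, map_mul, map_mul]
    simp only [eP]
    rw [h1, h2]
    -- Cancellation of the right factor of the first matrix against the left factor of the second.
    have h3 : fb (gMat p.1) i (den i c p / den i 1 p) +
        fa (gMat p.2) i (den i 1 p * c / den i c p) = 0 := by
      rw [fa, fb]
      field_simp
      rw [den, den]
      ring
    have h4 : fa (gMat p.1) i (den i c p / den i 1 p) = fa (gm p) i c := by
      rw [fa, fa, bd_one_gm hl hln hk hkn ⟨g1, g2⟩, bd_zero_gm hl hln hk hkn ⟨g1, g2⟩]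
      field_simp
      rw [den, den]
      ring
    have h5 : fb (gMat p.2) i (den i 1 p * c / den i c p) = fb (gm p) i c := by
      rw [fb, fb, bd_one_gm hl hln hk hkn ⟨g1, g2⟩, bd_zero_gm hl hln hk hkn ⟨g1, g2⟩]
      field_simp
      rw [den, den]
      ring
    rw [h4, h5]
    change _ = loopX i (fa (gm p) i c) z * (ev z (gMat p.1) * ev z (gMat p.2)) *
      loopX i (fb (gm p) i c) z
    calc _ = loopX i (fa (gm p) i c) z * ev z (gMat p.1) *
          (loopX i (fb (gMat p.1) i (den i c p / den i 1 p)) z *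
            loopX i (fa (gMat p.2) i (den i 1 p * c / den i c p)) z) * ev z (gMat p.2) *
          loopX i (fb (gm p) i c) z := by simp only [mul_assoc]
      _ = _ := by
        rw [loopX_mul hn, h3, loopX_zero]
        simp only [mul_assoc, one_mul]
  refine ⟨⟨hgen, ?_, ?_, ?_⟩, key⟩
  · exact (e1.bd_one_self hn).trans_ne n1
  · exact (e2.bd_one_self hn).trans_ne n2
  · rw [← bd_one_gm hl hln hk hkn hgen, key.bd_one_self hn]
    exact n0'

theorem γ_prod_eq {p : XX n l × XX n k} (hp : Gen₂ p) :
    ((crystal n l).prod (crystal n k)).γ p = Part.some fun i => unitOf (bd (gm p) 0 i) := by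
  simp only [CrystalMaps.prod, γ_crystal_eq hl hln hp.1, γ_crystal_eq hk hkn hp.2,
    Part.bind_eq_bind, Part.bind_some]
  refine congrArg Part.some (funext fun i => Units.ext ?_)
  rw [Pi.mul_apply, Units.val_mul, coe_unitOf (bd_zero_gMat_ne_zero hl hln hp.1 i),
    coe_unitOf (bd_zero_gMat_ne_zero hk hkn hp.2 i),
    coe_unitOf (bd_zero_gm_ne_zero hl hln hk hkn hp i), bd_zero_gm hl hln hk hkn hp]

/-- `ε_i(x) + φ_i(y)` is `den i 1 p` up to diagonal entries, and `den i 1 p` is the entry below the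
diagonal of the product; hence the product rule has the form of the rule for one factor. -/
theorem φ_prod_eq {i : ZMod n} {p : XX n l × XX n k} (hp : DomF i p) :
    ((crystal n l).prod (crystal n k)).φ i p =
      Part.some (unitOf (bd (gm p) 1 i / bd (gm p) 0 i)) := by
  obtain ⟨hg, n1, n2, n0⟩ := hp
  have d1 := bd_zero_gMat_ne_zero hl hln hg.1 i
  have d1' := bd_zero_gMat_ne_zero hl hln hg.1 (i + 1)
  have d2 := bd_zero_gMat_ne_zero hk hkn hg.2 i
  have hs : (unitOf (bd (gMat p.1) 1 i / bd (gMat p.1) 0 (i + 1)) : ℂ) +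
      (unitOf (bd (gMat p.2) 1 i / bd (gMat p.2) 0 i) : ℂ) =
      den i 1 p / (bd (gMat p.1) 0 (i + 1) * bd (gMat p.2) 0 i) := by
    rw [coe_unitOf (div_ne_zero n1 d1'), coe_unitOf (div_ne_zero n2 d2), den]
    field_simp
  have hs0 := div_ne_zero n0 (mul_ne_zero d1' d2)
  have h0 := bd_zero_gm_ne_zero hl hln hk hkn hg i
  have h1 := bd_one_gm hl hln hk hkn hg i
  simp only [CrystalMaps.prod, crystal, φEntry_eq hl hln hg.1 n1, εEntry_eq hl hln hg.1 n1,
    φEntry_eq hk hkn hg.2 n2, Part.bind_eq_bind, Part.bind_some, hs, toUnit_eq hs0]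
  refine congrArg Part.some (Units.ext ?_)
  rw [Units.val_div_eq_div_val, Units.val_mul, coe_unitOf (div_ne_zero n1 d1),
    coe_unitOf (div_ne_zero n1 d1'), coe_unitOf hs0,
    coe_unitOf (div_ne_zero (h1 ▸ n0) h0), h1, bd_zero_gm hl hln hk hkn hg]
  field_simp

theorem ε_prod_eq {i : ZMod n} {p : XX n l × XX n k} (hp : DomF i p) :
    ((crystal n l).prod (crystal n k)).ε i p =
      Part.some (unitOf (bd (gm p) 1 i / bd (gm p) 0 (i + 1))) := by
  obtain ⟨hg, n1, n2, n0⟩ := hp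
  have d1' := bd_zero_gMat_ne_zero hl hln hg.1 (i + 1)
  have d2 := bd_zero_gMat_ne_zero hk hkn hg.2 i
  have d2' := bd_zero_gMat_ne_zero hk hkn hg.2 (i + 1)
  have hs : (unitOf (bd (gMat p.1) 1 i / bd (gMat p.1) 0 (i + 1)) : ℂ) +
      (unitOf (bd (gMat p.2) 1 i / bd (gMat p.2) 0 i) : ℂ) =
      den i 1 p / (bd (gMat p.1) 0 (i + 1) * bd (gMat p.2) 0 i) := by
    rw [coe_unitOf (div_ne_zero n1 d1'), coe_unitOf (div_ne_zero n2 d2), den]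
    field_simp
  have hs0 := div_ne_zero n0 (mul_ne_zero d1' d2)
  have h0 := bd_zero_gm_ne_zero hl hln hk hkn hg (i + 1)
  have h1 := bd_one_gm hl hln hk hkn hg i
  simp only [CrystalMaps.prod, crystal, εEntry_eq hl hln hg.1 n1, εEntry_eq hk hkn hg.2 n2,
    φEntry_eq hk hkn hg.2 n2, Part.bind_eq_bind, Part.bind_some, hs, toUnit_eq hs0]
  refine congrArg Part.some (Units.ext ?_)
  rw [Units.val_div_eq_div_val, Units.val_mul, coe_unitOf (div_ne_zero n2 d2),
    coe_unitOf (div_ne_zero n2 d2'), coe_unitOf hs0,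
    coe_unitOf (div_ne_zero (h1 ▸ n0) h0), h1, bd_zero_gm hl hln hk hkn hg]
  field_simp

theorem e_prod_eq {i : ZMod n} {c : ℂˣ} {p : XX n l × XX n k} (hp : DomF i p)
    (hd : den i c p ≠ 0) :
    ((crystal n l).prod (crystal n k)).e i (c, p) = Part.some (eP i c p) := by
  obtain ⟨hg, n1, n2, n0⟩ := hp
  have d1' := bd_zero_gMat_ne_zero hl hln hg.1 (i + 1)
  have d2 := bd_zero_gMat_ne_zero hk hkn hg.2 i
  have hc := c.ne_zero
  have hs : (unitOf (bd (gMat p.1) 1 i / bd (gMat p.1) 0 (i + 1)) : ℂ) +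
      (unitOf (bd (gMat p.2) 1 i / bd (gMat p.2) 0 i) : ℂ) =
      den i 1 p / (bd (gMat p.1) 0 (i + 1) * bd (gMat p.2) 0 i) := by
    rw [coe_unitOf (div_ne_zero n1 d1'), coe_unitOf (div_ne_zero n2 d2), den]
    field_simp
  have hs1 : (c : ℂ) * (unitOf (bd (gMat p.1) 1 i / bd (gMat p.1) 0 (i + 1)) : ℂ) +
      (unitOf (bd (gMat p.2) 1 i / bd (gMat p.2) 0 i) : ℂ) =
      den i c p / (bd (gMat p.1) 0 (i + 1) * bd (gMat p.2) 0 i) := by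
    rw [coe_unitOf (div_ne_zero n1 d1'), coe_unitOf (div_ne_zero n2 d2), den]
    field_simp
  have hs2 : (unitOf (bd (gMat p.1) 1 i / bd (gMat p.1) 0 (i + 1)) : ℂ) +
      (c : ℂ)⁻¹ * (unitOf (bd (gMat p.2) 1 i / bd (gMat p.2) 0 i) : ℂ) =
      den i c p / (c * (bd (gMat p.1) 0 (i + 1) * bd (gMat p.2) 0 i)) := by
    rw [coe_unitOf (div_ne_zero n1 d1'), coe_unitOf (div_ne_zero n2 d2), den]
    field_simp
  have hs0 := div_ne_zero n0 (mul_ne_zero d1' d2)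
  have hs10 := div_ne_zero hd (mul_ne_zero d1' d2)
  have hs20 := div_ne_zero hd (mul_ne_zero hc (mul_ne_zero d1' d2))
  have he1 := fun c => e_crystal_eq hl hln c hg.1 n1
  have he2 := fun c => e_crystal_eq hk hkn c hg.2 n2
  simp only [crystal] at he1 he2
  simp only [CrystalMaps.prod, crystal, εEntry_eq hl hln hg.1 n1,
    φEntry_eq hk hkn hg.2 n2, Part.bind_eq_bind, Part.bind_some, hs, hs1, hs2, toUnit_eq hs0,
    toUnit_eq hs10, toUnit_eq hs20]
  simp only [Part.bind_eq_bind, φEntry_eq hl hln hg.1 n1, φEntry_eq hk hkn hg.2 n2,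
    Part.bind_some] at he1 he2 ⊢
  rw [he1, Part.bind_some, he2, Part.bind_some]
  refine congrArg Part.some (Prod.ext ?_ ?_)
  · change eT i _ p.1 = eT i _ p.1
    rw [Units.val_div_eq_div_val, coe_unitOf hs0, coe_unitOf hs10]
    congr 1
    field_simp
  · change eT i _ p.2 = eT i _ p.2
    rw [Units.val_div_eq_div_val, coe_unitOf hs0, coe_unitOf hs20]
    congr 1
    field_simp

theorem range_gm {p : XX n l × XX n k} (hp : Gen₂ p) (hne : spec p.1 ≠ spec p.2) :
    LinearMap.range (ev (spec p.1) (gm p)).mulVecLin = p.1.1.1 ∧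
    LinearMap.range (ev (spec p.2) (gm p)).mulVecLin =
      p.2.1.1.map (ev (spec p.2) (gMat p.1)).mulVecLin := by
  constructor
  · rw [gm, map_mul, range_mul_of_isUnit (isUnit_ev_gMat hk hkn hp.2 hne), range_gMat hl hln hp.1]
  · rw [gm, map_mul, Matrix.mulVecLin_mul, LinearMap.range_comp, range_gMat hk hkn hp.2]

/-- A generic pair of points is determined by the ranges of the values of its matrix. -/
theorem eq_of_range_gm {p q : XX n l × XX n k} (hp : Gen₂ p) (hq : Gen₂ q)
    (h1 : p.1.2 = q.1.2) (h2 : p.2.2 = q.2.2) (hne : spec p.1 ≠ spec p.2)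
    (h : ∀ z, z ≠ 0 → LinearMap.range (ev z (gm p)).mulVecLin =
      LinearMap.range (ev z (gm q)).mulVecLin) : p = q := by
  have s1 := spec_congr h1
  have s2 := spec_congr h2
  obtain ⟨p1, p2⟩ := range_gm hl hln hk hkn hp hne
  obtain ⟨q1, q2⟩ := range_gm hl hln hk hkn hq (s1 ▸ s2 ▸ hne)
  have e1 : p.1 = q.1 := Prod.ext (Subtype.ext (by
    rw [← p1, ← q1, h _ (spec_ne_zero p.1), s1])) h1
  refine Prod.ext e1 (Prod.ext (Subtype.ext ?_) h2)
  -- The range at the second special value is the second subspace transported by the invertible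
  -- value of the first matrix.
  refine Submodule.map_injective_of_injective (f := (ev (spec p.2) (gMat p.1)).mulVecLin)
    (Matrix.mulVec_injective_of_isUnit (isUnit_ev_gMat hl hln hp.1 hne.symm)) ?_
  rw [← p2, h _ (spec_ne_zero p.2), s2, q2, ← s2, e1]

end Points

/-! ### Regularity of the constructions and nonemptiness of their domains. -/

section Regularity

variable {k l n : ℕ} [NeZero n] {V : Type} [AlgCoord V]

theorem zOpenPred_isGeneric : ZOpenPred fun N : Gr k n => IsGeneric N := by
  have := ZOpenPred.forall (ι := {j // j ∈ Finset.Icc (1 : ℤ) n})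
    (P := fun j (N : Gr k n) => pl N (Finset.Icc (j.1 - k) (j.1 - 1)) ≠ 0)
    fun j => zOpenPred_pl_ne_zero _
  intro N hN
  exact (this N fun j => hN j.1 j.2).mono fun M hM j hj => hM ⟨j, hj⟩

theorem reg_spec (x : XX n k) : Reg (spec : XX n k → ℂ) x :=
  (reg_const _ _).mul (regMap_snd x).unit

theorem reg_plRatio (hk : k ≤ n) {x : XX n k} (hx : IsGeneric x.1) (I : Finset ℤ) (j : ℤ) :
    Reg (fun y : XX n k => pl y.1 I / pl y.1 (Finset.Icc (j - k) (j - 1))) x :=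
  (reg_pl_div_pl I _ (hx.pl_ne_zero hk j)).comp (regMap_fst x)

theorem reg_coeff_gMat (hk : k ≤ n) {x : XX n k} (hx : IsGeneric x.1) (a b : Fin n) (p : ℕ) :
    Reg (fun y : XX n k => (gMat y a b).coeff p) x := by
  simp only [gMat, Matrix.of_apply, Polynomial.coeff_mul_C]
  refine Reg.mul ?_ (reg_plRatio hk hx _ _)
  split_ifs
  · exact reg_const _ _
  · simp only [Polynomial.coeff_C]
    split_ifs
    · exact (regMap_snd x).unit
    · exact reg_const _ _
  · exact reg_const _ _

theorem reg_bd_gMat (hk : k ≤ n) {x : XX n k} (hx : IsGeneric x.1) (m : ℤ) (i : ZMod n) :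
    Reg (fun y : XX n k => bd (gMat y) m i) x := by
  simp only [bd, unf]
  split_ifs
  · exact reg_coeff_gMat hk hx _ _ _
  · exact reg_const _ _

theorem reg_ev_gMat (hk : k ≤ n) {X : V → XX n k} {Z : V → ℂ} {v : V} (hX : RegMap X v)
    (hx : IsGeneric (X v).1) (hZ : Reg Z v) (a b : Fin n) :
    Reg (fun w => ev (Z w) (gMat (X w)) a b) v := by
  have h := fun I j => Reg.comp (reg_plRatio hk hx I j) hX
  simp only [ev_apply, gMat, Matrix.of_apply, Polynomial.eval_mul, Polynomial.eval_C]
  refine Reg.mul ?_ (h _ _)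
  split_ifs
  · simpa using reg_const 1 v
  · simpa using hX.snd.unit
  · simpa using hZ

theorem reg_matrix_mul {m m' m'' : ℕ} {A : V → Matrix (Fin m) (Fin m') ℂ}
    {B : V → Matrix (Fin m') (Fin m'') ℂ} {v : V} (hA : ∀ i j, Reg (fun w => A w i j) v)
    (hB : ∀ i j, Reg (fun w => B w i j) v) (i : Fin m) (j : Fin m'') :
    Reg (fun w => (A w * B w) i j) v := by
  simp only [Matrix.mul_apply]
  exact Reg.sum _ fun c _ => (hA _ _).mul (hB _ _)

theorem reg_loopX (i : ZMod n) {a z : V → ℂ} {v : V} (ha : Reg a v) (hz : Reg z v) (h0 : z v ≠ 0)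
    (r s : Fin n) : Reg (fun w => loopX i (a w) (z w) r s) v := by
  simp only [loopX, xMat, Matrix.add_apply, Matrix.single_apply]
  refine (reg_const _ _).add ?_
  split_ifs
  · exact ha.div hz h0
  · exact ha
  · exact reg_const _ _

theorem regMap_schutz (hk : 1 ≤ k) (hkn : k < n) {x : XX n k} (hx : IsGeneric x.1) :
    RegMap (schutz : XX n k → XX n k) x := by
  refine RegMap.prodMk (regMap_mkD (N₀ := fun y : XX n k => y.1)
    (B := fun y => firstCols k (ev (spec y) (fl (gMat y)))) (fun i j => ?_)
    (finrank_firstCols hkn (gMat_isMonicBand hk hkn hx).fl (spec_ne_zero x))) (regMap_snd x)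
  have h := reg_ev_gMat hkn.le (X := fun y => y) (Z := spec) (regMap_id x) hx (reg_spec x)
    (idx n (1 + (j : ℕ))).rev i.rev
  exact h

theorem regMap_eT (hn : 2 ≤ n) (hk : k ≤ n) (i : ZMod n) {X : V → XX n k} {c : V → ℂ} {v : V}
    (hX : RegMap X v) (hc : Reg c v) (hx : IsGeneric (X v).1) (h : bd (gMat (X v)) 1 i ≠ 0) :
    RegMap (fun w => eT i (c w) (X w)) v := by
  obtain ⟨B, hB, hB'⟩ := hX.fst.exists_local_matrix
  have hbd := fun m i => Reg.comp (G := fun x : XX n k => bd (gMat x) m i) (reg_bd_gMat hk hx m i) hX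
  have hfa : Reg (fun w => fa (gMat (X w)) i (c w)) v := by
    simp only [fa]
    exact ((hc.sub (reg_const 1 v)).mul (hbd 0 i)).div (hbd 1 i) h
  have hsp : Reg (fun w => spec (X w)) v := Reg.comp (G := spec) (reg_spec _) hX
  have hM := reg_matrix_mul (fun r s => reg_loopX i hfa hsp (spec_ne_zero _) r s) hB
  refine RegMap.prodMk (regMap_gr (F := fun w => (eT i (c w) (X w)).1) hM ?_) hX.snd
  filter_upwards [hB'] with w hw
  rw [coe_eT hn, hw, Matrix.mulVecLin_mul, LinearMap.range_comp]

/-- Nonempty Zariski open conditions. -/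
structure IsBig (P : V → Prop) : Prop where
  zOpenPred : ZOpenPred P
  nonempty : ∃ x, P x

theorem IsBig.and (hV : ZIrreducible V) {P Q : V → Prop} (hP : IsBig P) (hQ : IsBig Q) :
    IsBig fun x => P x ∧ Q x :=
  ⟨hP.zOpenPred.and fun x _ => hQ.zOpenPred x,
    hV.exists_and hP.zOpenPred hQ.zOpenPred hP.nonempty hQ.nonempty⟩

theorem IsBig.comp {W : Type} [AlgCoord W] {P : W → Prop} (hP : IsBig P) {F : V → W}
    (hF : ∀ v, RegMap F v) (hF' : Function.Surjective F) : IsBig fun v => P (F v) := by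
  refine ⟨fun v hv => hP.zOpenPred.comp (hF v) hv, ?_⟩
  obtain ⟨w, hw⟩ := hP.nonempty
  obtain ⟨v, rfl⟩ := hF' w
  exact ⟨v, hw⟩

/-- The preimage of a nonempty open condition under a rational map with a right inverse. -/
theorem IsBig.pull {W : Type} [AlgCoord W] (hW : ZIrreducible W) {P : V → Prop} {P' Q : W → Prop}
    (hP : ZOpenPred P) (hP' : IsBig P') (hQ : IsBig Q) {F : V → W} {F' : W → V}
    (hF : ∀ v, P v → RegMap F v) (h : ∀ w, P' w → P (F' w) ∧ F (F' w) = w) :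
    IsBig fun v => P v ∧ Q (F v) := by
  refine ⟨hP.and fun v hv hv' => hQ.zOpenPred.comp (hF v hv) hv', ?_⟩
  obtain ⟨w, h1, h2⟩ := (hP'.and hW hQ).nonempty
  obtain ⟨h3, h4⟩ := h w h1
  exact ⟨F' w, h3, by rwa [h4]⟩

theorem ratConnected_XX (hk : k ≤ n) : RatConnected (XX n k) :=
  (ratConnected_gr hk).prod ratConnected_units

variable (hl : 1 ≤ l) (hln : l < n) (hk : 1 ≤ k) (hkn : k < n)

section

include hln hkn

theorem zIrreducible_XX₂ : ZIrreducible (XX n l × XX n k) :=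
  ((ratConnected_XX hln.le).prod (ratConnected_XX hkn.le)).zIrreducible

theorem zOpenPred_gen₂ : ZOpenPred fun p : XX n l × XX n k => Gen₂ p := fun p hp =>
  (zOpenPred_isGeneric.comp (regMap_fst p).fst hp.1).and
    (zOpenPred_isGeneric.comp (regMap_snd p).fst hp.2)

theorem reg_den {P : V → XX n l × XX n k} {c : V → ℂ} {v : V} (hP : RegMap P v) (hc : Reg c v)
    (hp : Gen₂ (P v)) (i : ZMod n) : Reg (fun w => den i (c w) (P w)) v := by
  have h1 := fun m i => Reg.comp (G := fun x : XX n l => bd (gMat x) m i)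
    (F := fun w => (P w).1) (reg_bd_gMat hln.le hp.1 m i) hP.fst
  have h2 := fun m i => Reg.comp (G := fun x : XX n k => bd (gMat x) m i)
    (F := fun w => (P w).2) (reg_bd_gMat hkn.le hp.2 m i) hP.snd
  exact ((hc.mul (h1 1 i)).mul (h2 0 i)).add ((h1 0 (i + 1)).mul (h2 1 i))

theorem zOpenPred_domF (i : ZMod n) : ZOpenPred fun p : XX n l × XX n k => DomF i p := by
  intro p hp
  filter_upwards [zOpenPred_gen₂ hln hkn p hp.gen,
    ((reg_bd_gMat hln.le hp.gen.1 1 i).comp (regMap_fst p)).eventually_ne hp.ne₁,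
    ((reg_bd_gMat hkn.le hp.gen.2 1 i).comp (regMap_snd p)).eventually_ne hp.ne₂,
    (reg_den hln hkn (regMap_id p) (reg_const 1 p) hp.gen i).eventually_ne hp.ne] with q h1 h2 h3 h4
  exact ⟨h1, h2, h3, h4⟩

/-- The domain on which `e_i` is considered. -/
def DomE (i : ZMod n) (q : ℂˣ × XX n l × XX n k) : Prop := DomF i q.2 ∧ den i q.1 q.2 ≠ 0

include hl in
theorem regMap_eP {i : ZMod n} {q : ℂˣ × XX n l × XX n k} (hq : DomE i q) :
    RegMap (fun q : ℂˣ × XX n l × XX n k => eP i q.1 q.2) q := by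
  have hn : 2 ≤ n := by omega
  obtain ⟨⟨hg, n1, n2, n0⟩, hd⟩ := hq
  have d0 := reg_den hln hkn (regMap_snd q) (reg_const 1 q) hg i
  have d1 := reg_den hln hkn (regMap_snd q) (regMap_fst q).unit hg i
  exact (regMap_eT hn hln.le i (regMap_snd q).fst (d1.div d0 n0) hg.1 n1).prodMk
    (regMap_eT hn hkn.le i (regMap_snd q).snd ((d0.mul (regMap_fst q).unit).div d1 hd) hg.2 n2)

theorem zOpenPred_domE (i : ZMod n) : ZOpenPred fun q : ℂˣ × XX n l × XX n k => DomE i q := by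
  intro q hq
  filter_upwards [(zOpenPred_domF hln hkn i).comp (regMap_snd q) hq.1,
    (reg_den hln hkn (regMap_snd q) (regMap_fst q).unit hq.1.gen i).eventually_ne hq.2] with r h1 h2
  exact ⟨h1, h2⟩

theorem zOpenPred_spec_ne : ZOpenPred fun p : XX n l × XX n k => spec p.1 ≠ spec p.2 := by
  intro p hp
  exact ((((reg_spec _).comp (regMap_fst p)).sub ((reg_spec _).comp (regMap_snd p))).eventually_ne
    (sub_ne_zero.2 hp)).mono fun q hq => sub_ne_zero.1 hq

end

theorem eq_of_dvd_sub {a b m : ℤ} (ha : m ≤ a) (ha' : a < m + n) (hb : m ≤ b) (hb' : b < m + n)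
    (h : (n : ℤ) ∣ a - b) : a = b := by
  have := Int.eq_zero_of_abs_lt_dvd h (by rw [abs_lt]; constructor <;> omega)
  omega

theorem exists_isGeneric_and (hkn : k < n) (I : Finset ℤ) (hI : (I.image (idx n)).card = k) :
    ∃ N : Gr k n, IsGeneric N ∧ pl N I ≠ 0 := by
  have hV := (ratConnected_gr (n := n) hkn.le).zIrreducible
  refine hV.exists_and zOpenPred_isGeneric (zOpenPred_pl_ne_zero I) ?_ (exists_pl_ne_zero hI)
  obtain ⟨N, hN⟩ := hV.exists_forall (ι := {j // j ∈ Finset.Icc (1 : ℤ) n})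
    (P := fun j (N : Gr k n) => pl N (Finset.Icc (j.1 - k) (j.1 - 1)) ≠ 0)
    (fun j => zOpenPred_pl_ne_zero _) fun j => exists_pl_ne_zero (by
      rw [Finset.card_image_of_injOn fun a ha b hb hab => ?_, Int.card_Icc]
      · omega
      · rw [Finset.mem_coe, Finset.mem_Icc] at ha hb
        exact eq_of_dvd_sub (m := j.1 - k) (by omega) (by omega) (by omega) (by omega)
          (idx_eq_iff.1 hab))
  exact ⟨N, fun j hj => hN ⟨j, hj⟩⟩

theorem exists_isGeneric_bd_ne_zero (hk : 1 ≤ k) (hkn : k < n) (i : ZMod n) :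
    ∃ x : XX n k, IsGeneric x.1 ∧ bd (gMat x) 1 i ≠ 0 := by
  obtain ⟨N, h1, h2⟩ := exists_isGeneric_and (k := k) hkn
    (insert ((i.val : ℤ) + 1) (Finset.Icc (i.val - k + 1 : ℤ) (i.val - 1))) (by
      rw [Finset.card_image_of_injOn fun a ha b hb hab => ?_, Finset.card_insert_of_notMem,
        Int.card_Icc]
      · omega
      · rw [Finset.mem_Icc]; omega
      · rw [Finset.mem_coe, Finset.mem_insert, Finset.mem_Icc] at ha hb
        exact eq_of_dvd_sub (m := i.val - k + 1) (by omega) (by omega) (by omega) (by omega)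
          (idx_eq_iff.1 hab))
  refine ⟨(N, 1), h1, ?_⟩
  rw [bd_one_gMat hk hkn, plu]
  refine mul_ne_zero ?_ (div_ne_zero h2 (h1.pl_ne_zero hkn.le _))
  split_ifs <;> simp

section

include hl hln hk hkn

theorem isBig_domF (i : ZMod n) : IsBig fun p : XX n l × XX n k => DomF i p := by
  refine ⟨zOpenPred_domF hln hkn i, ?_⟩
  obtain ⟨x, hx, hx'⟩ := exists_isGeneric_bd_ne_zero hl hln i
  obtain ⟨y, hy, hy'⟩ := exists_isGeneric_bd_ne_zero hk hkn i
  by_cases h : den i 1 (x, y) = 0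
  -- If the sum vanishes, applying `e_i^2` to the second point doubles exactly one of its two
  -- nonzero summands.
  · obtain ⟨h1, h2⟩ := eT_spec hk hkn hy (two_ne_zero (α := ℂ)) hy'
    have h3 := h2.bd_one_self (by omega)
    refine ⟨(x, eT i 2 y), ⟨hx, h1⟩, hx', h3.trans_ne hy', ?_⟩
    rw [den] at h ⊢
    simp only at h ⊢
    rw [h3, h2.bd_zero_self (by omega) hy']
    intro h4
    have h5 := mul_ne_zero hx' (bd_zero_gMat_ne_zero hk hkn hy i)
    apply h5
    linear_combination h4 - h
  · exact ⟨(x, y), ⟨hx, hy⟩, hx', hy', h⟩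

theorem isBig_spec_ne : IsBig fun p : XX n l × XX n k => spec p.1 ≠ spec p.2 := by
  refine ⟨zOpenPred_spec_ne hln hkn, ?_⟩
  obtain ⟨x, -, -⟩ := exists_isGeneric_bd_ne_zero hl hln 0
  obtain ⟨y, -, -⟩ := exists_isGeneric_bd_ne_zero hk hkn 0
  by_cases h : spec x = spec y
  -- Changing the sign of the torus parameter changes the nonzero special value.
  · refine ⟨(x, (y.1, -y.2)), fun h' => ?_⟩
    have h0 := spec_ne_zero y
    rw [h] at h'
    simp only [spec, Units.val_neg] at h' h0
    apply h0
    linear_combination h' / 2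
  · exact ⟨(x, y), h⟩

end

end Regularity

/-! ### Composition law and Serre relations on products. -/

section ProductCrystal

variable {k l n : ℕ} [NeZero n] {V : Type} [AlgCoord V]

theorem RegMap.unit_mul {F G : V → ℂˣ} {v : V} (hF : RegMap F v) (hG : RegMap G v) :
    RegMap (fun w => F w * G w) v :=
  regMap_unit (F := fun w => F w * G w) (by
    simp only [Units.val_mul]
    exact hF.unit.mul hG.unit)

theorem reg_unitOf {F : V → ℂ} {v : V} (hF : Reg F v) (h : F v ≠ 0) :
    Reg (fun w => (unitOf (F w) : ℂ)) v :=
  hF.congr ((hF.eventually_ne h).mono fun _ hw => (coe_unitOf hw).symm)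

theorem domE_one {i : ZMod n} {p : XX n l × XX n k} (h : DomF i p) : DomE i ((1 : ℂˣ), p) :=
  ⟨h, h.ne⟩

/-- The torus components agree. -/
def SameParam (p q : XX n l × XX n k) : Prop := p.1.2 = q.1.2 ∧ p.2.2 = q.2.2

theorem sameParam_refl (p : XX n l × XX n k) : SameParam p p := ⟨rfl, rfl⟩

theorem SameParam.eP {p q : XX n l × XX n k} (h : SameParam p q) (i : ZMod n) (c : ℂ) :
    SameParam (eP i c p) q := ⟨(eT_snd _ _ _).trans h.1, (eT_snd _ _ _).trans h.2⟩

variable (hl : 1 ≤ l) (hln : l < n) (hk : 1 ≤ k) (hkn : k < n)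

include hl hln hk hkn

theorem regMap_eP_comp {i : ZMod n} {C : V → ℂˣ} {X : V → XX n l × XX n k} {v : V}
    (hC : RegMap C v) (hX : RegMap X v) (h : DomE i (C v, X v)) :
    RegMap (fun w => eP i (C w) (X w)) v :=
  RegMap.comp (G := fun q : ℂˣ × XX n l × XX n k => eP i q.1 q.2) (F := fun w => (C w, X w))
    (regMap_eP hl hln hkn h) (hC.prodMk hX)

theorem eventually_domE {i : ZMod n} {C : V → ℂˣ} {X : V → XX n l × XX n k} {v : V}
    (hC : RegMap C v) (hX : RegMap X v) (h : DomE i (C v, X v)) :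
    ∀ᶠ w in zNhds v, DomE i (C w, X w) :=
  (zOpenPred_domE hln hkn i).comp (F := fun w => (C w, X w)) (hC.prodMk hX) h

theorem e_prod_eq' {i : ZMod n} {c : ℂˣ} {p : XX n l × XX n k} (h : DomE i (c, p)) :
    ((crystal n l).prod (crystal n k)).e i (c, p) = Part.some (eP i c p) :=
  e_prod_eq hl hln hk hkn h.1 h.2

theorem eP_spec' {i : ZMod n} {c : ℂˣ} {p : XX n l × XX n k} (h : DomE i (c, p)) :
    DomF i (eP i c p) ∧ IsE i c (gm p) (gm (eP i c p)) :=
  eP_spec hl hln hk hkn h.1 c.ne_zero h.2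

theorem bd_one_gm_ne_zero {i : ZMod n} {p : XX n l × XX n k} (h : DomF i p) : bd (gm p) 1 i ≠ 0 :=
  (bd_one_gm hl hln hk hkn h.gen i).trans_ne h.ne

theorem eq_of_range_gm' {o p q : XX n l × XX n k} (hp : Gen₂ p) (hq : Gen₂ q)
    (hpo : SameParam p o) (hqo : SameParam q o) (hne : spec o.1 ≠ spec o.2)
    (h : ∀ z, z ≠ 0 → LinearMap.range (ev z (gm p)).mulVecLin =
      LinearMap.range (ev z (gm q)).mulVecLin) : p = q :=
  eq_of_range_gm hl hln hk hkn hp hq (hpo.1.trans hqo.1.symm) (hpo.2.trans hqo.2.symm)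
    (by rwa [spec_congr hpo.1, spec_congr hpo.2]) h

theorem isBig_gen₂ : IsBig fun p : XX n l × XX n k => Gen₂ p := by
  obtain ⟨p, hp⟩ := (isBig_domF hl hln hk hkn 0).nonempty
  exact ⟨zOpenPred_gen₂ hln hkn, p, hp.gen⟩

theorem isBig_domE (i : ZMod n) : IsBig fun q : ℂˣ × XX n l × XX n k => DomE i q := by
  obtain ⟨p, hp⟩ := (isBig_domF hl hln hk hkn i).nonempty
  exact ⟨zOpenPred_domE hln hkn i, _, domE_one hp⟩

theorem reg_bd_zero_gm {p : XX n l × XX n k} (hp : Gen₂ p) (i : ZMod n) :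
    Reg (fun p : XX n l × XX n k => bd (gm p) 0 i) p := by
  refine Reg.congr (((reg_bd_gMat hln.le hp.1 0 i).comp (regMap_fst p)).mul
    ((reg_bd_gMat hkn.le hp.2 0 i).comp (regMap_snd p))) ?_
  filter_upwards [zOpenPred_gen₂ hln hkn p hp] with q hq
  exact (bd_zero_gm hl hln hk hkn hq i).symm

theorem reg_bd_one_gm {p : XX n l × XX n k} (hp : Gen₂ p) (i : ZMod n) :
    Reg (fun p : XX n l × XX n k => bd (gm p) 1 i) p := by
  refine Reg.congr (reg_den hln hkn (regMap_id p) (reg_const 1 p) hp i) ?_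
  filter_upwards [zOpenPred_gen₂ hln hkn p hp] with q hq
  exact (bd_one_gm hl hln hk hkn hq i).symm

theorem zIrreducible_units_XX₂ : ZIrreducible (ℂˣ × XX n l × XX n k) :=
  (ratConnected_units.prod ((ratConnected_XX hln.le).prod (ratConnected_XX hkn.le))).zIrreducible

theorem zIrreducible_units₂_XX₂ : ZIrreducible (ℂˣ × ℂˣ × XX n l × XX n k) :=
  (ratConnected_units.prod (ratConnected_units.prod
    ((ratConnected_XX hln.le).prod (ratConnected_XX hkn.le)))).zIrreducible

/-- Both sides are generic pairs with the same torus parameters, and their matrices arise from one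
matrix with equal left unipotent factors. Equal ranges then give equal pairs; the Serre relations
below are handled in the same way. -/
theorem e_mul_prod (i : ZMod n) :
    RatEq (fun p : ℂˣ × ℂˣ × XX n l × XX n k =>
      (((crystal n l).prod (crystal n k)).e i (p.2.1, p.2.2)).bind
        fun x => ((crystal n l).prod (crystal n k)).e i (p.1, x))
      (fun p => ((crystal n l).prod (crystal n k)).e i (p.1 * p.2.1, p.2.2)) := by
  have hn : 2 ≤ n := by omega
  refine ratEq_of (zIrreducible_units₂_XX₂ hl hln hk hkn) (fun q =>
    DomE i (q.2.1, q.2.2) ∧ DomE i (q.1, eP i q.2.1 q.2.2) ∧ DomE i (q.1 * q.2.1, q.2.2) ∧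
      spec q.2.2.1 ≠ spec q.2.2.2) ?_ ?_ ?_
  · rintro q ⟨h1, h2, h3, h4⟩
    have r1 := regMap_fst q
    have r2 := (regMap_snd q).fst
    have r3 := (regMap_snd q).snd
    exact (eventually_domE hl hln hk hkn r2 r3 h1).and ((eventually_domE hl hln hk hkn r1
      (regMap_eP_comp hl hln hk hkn r2 r3 h1) h2).and ((eventually_domE hl hln hk hkn
      (r1.unit_mul r2) r3 h3).and ((zOpenPred_spec_ne hln hkn).comp r3 h4)))
  · obtain ⟨p, h1, h2⟩ := ((isBig_domF hl hln hk hkn i).and (zIrreducible_XX₂ hln hkn)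
      (isBig_spec_ne hl hln hk hkn)).nonempty
    -- With all parameters equal to `1` the operators fix `p`, so the conditions on intermediate
    -- points reduce to conditions on `p`.
    have h3 : eP i ((1 : ℂˣ) : ℂ) p = p := eP_one hn h1.ne
    refine ⟨(1, 1, p), domE_one h1, ?_, ?_, h2⟩
    · simp only [h3]
      exact domE_one h1
    · simp only [mul_one]
      exact domE_one h1
  · rintro ⟨c, d, p⟩ ⟨h1, h2, h3, h4⟩
    refine ⟨eP i (c * d : ℂˣ) p, ?_, e_prod_eq' hl hln hk hkn h3⟩
    obtain ⟨g1, e1⟩ := eP_spec' hl hln hk hkn h1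
    obtain ⟨g2, e2⟩ := eP_spec' hl hln hk hkn h2
    obtain ⟨g3, e3⟩ := eP_spec' hl hln hk hkn h3
    simp only [e_prod_eq' hl hln hk hkn h1, Part.bind_some, e_prod_eq' hl hln hk hkn h2]
    refine congrArg Part.some (eq_of_range_gm' hl hln hk hkn g2.gen g3.gen
      (((sameParam_refl p).eP _ _).eP _ _) ((sameParam_refl p).eP _ _) h4 fun z hz => ?_)
    rw [Units.val_mul] at e3 ⊢
    exact e1.mul hn (bd_one_gm_ne_zero hl hln hk hkn h1.1) e2 e3 hz

theorem serre_comm_prod {i j : ZMod n} (hij : i ≠ j) (hij₁ : i ≠ j + 1) (hij₂ : j ≠ i + 1) :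
    RatEq (fun p : ℂˣ × ℂˣ × XX n l × XX n k => do
        let y ← ((crystal n l).prod (crystal n k)).e j (p.2.1, p.2.2)
        ((crystal n l).prod (crystal n k)).e i (p.1, y))
      (fun p => do
        let y ← ((crystal n l).prod (crystal n k)).e i (p.1, p.2.2)
        ((crystal n l).prod (crystal n k)).e j (p.2.1, y)) := by
  have hn : 2 ≤ n := by omega
  refine ratEq_of (zIrreducible_units₂_XX₂ hl hln hk hkn) (fun q =>
    DomE j (q.2.1, q.2.2) ∧ DomE i (q.1, eP j q.2.1 q.2.2) ∧ DomE i (q.1, q.2.2) ∧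
      DomE j (q.2.1, eP i q.1 q.2.2) ∧ spec q.2.2.1 ≠ spec q.2.2.2) ?_ ?_ ?_
  · rintro q ⟨h1, h2, h3, h4, h5⟩
    have r1 := regMap_fst q
    have r2 := (regMap_snd q).fst
    have r3 := (regMap_snd q).snd
    exact (eventually_domE hl hln hk hkn r2 r3 h1).and ((eventually_domE hl hln hk hkn r1
      (regMap_eP_comp hl hln hk hkn r2 r3 h1) h2).and ((eventually_domE hl hln hk hkn r1 r3 h3).and
      ((eventually_domE hl hln hk hkn r2 (regMap_eP_comp hl hln hk hkn r1 r3 h3) h4).and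
      ((zOpenPred_spec_ne hln hkn).comp r3 h5))))
  · obtain ⟨p, ⟨h1, h1'⟩, h2⟩ := (((isBig_domF hl hln hk hkn i).and (zIrreducible_XX₂ hln hkn)
      (isBig_domF hl hln hk hkn j)).and (zIrreducible_XX₂ hln hkn)
      (isBig_spec_ne hl hln hk hkn)).nonempty
    have h3 : eP i ((1 : ℂˣ) : ℂ) p = p := eP_one hn h1.ne
    have h4 : eP j ((1 : ℂˣ) : ℂ) p = p := eP_one hn h1'.ne
    refine ⟨(1, 1, p), domE_one h1', ?_, domE_one h1, ?_, h2⟩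
    · simp only [h4]
      exact domE_one h1
    · simp only [h3]
      exact domE_one h1'
  · rintro ⟨c, d, p⟩ ⟨h1, h2, h3, h4, h5⟩
    refine ⟨eP i c (eP j d p), ?_, ?_⟩
    · simp only [e_prod_eq' hl hln hk hkn h1, Part.bind_eq_bind, Part.bind_some,
        e_prod_eq' hl hln hk hkn h2]
    · simp only [e_prod_eq' hl hln hk hkn h3, Part.bind_eq_bind, Part.bind_some,
        e_prod_eq' hl hln hk hkn h4]
      obtain ⟨g1, e1⟩ := eP_spec' hl hln hk hkn h1
      obtain ⟨g2, e2⟩ := eP_spec' hl hln hk hkn h2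
      obtain ⟨g3, e3⟩ := eP_spec' hl hln hk hkn h3
      obtain ⟨g4, e4⟩ := eP_spec' hl hln hk hkn h4
      exact congrArg Part.some (eq_of_range_gm' hl hln hk hkn g4.gen g2.gen
        (((sameParam_refl p).eP _ _).eP _ _) (((sameParam_refl p).eP _ _).eP _ _) h5 fun z hz =>
        (IsE.comm hn hij hij₁ hij₂ e1 e2 e3 e4 hz).symm)

theorem serre_braid_prod (hn : 3 ≤ n) {i j : ZMod n} (hij : i = j + 1 ∨ j = i + 1) :
    RatEq (fun p : ℂˣ × ℂˣ × XX n l × XX n k => do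
        let y ← ((crystal n l).prod (crystal n k)).e i (p.2.1, p.2.2)
        let z ← ((crystal n l).prod (crystal n k)).e j (p.1 * p.2.1, y)
        ((crystal n l).prod (crystal n k)).e i (p.1, z))
      (fun p => do
        let y ← ((crystal n l).prod (crystal n k)).e j (p.1, p.2.2)
        let z ← ((crystal n l).prod (crystal n k)).e i (p.1 * p.2.1, y)
        ((crystal n l).prod (crystal n k)).e j (p.2.1, z)) := by
  have hn2 : 2 ≤ n := by omega
  refine ratEq_of (zIrreducible_units₂_XX₂ hl hln hk hkn) (fun q =>
    DomE i (q.2.1, q.2.2) ∧ DomE j (q.1 * q.2.1, eP i q.2.1 q.2.2) ∧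
    DomE i (q.1, eP j (q.1 * q.2.1 : ℂˣ) (eP i q.2.1 q.2.2)) ∧
    DomE j (q.1, q.2.2) ∧ DomE i (q.1 * q.2.1, eP j q.1 q.2.2) ∧
    DomE j (q.2.1, eP i (q.1 * q.2.1 : ℂˣ) (eP j q.1 q.2.2)) ∧ spec q.2.2.1 ≠ spec q.2.2.2) ?_ ?_ ?_
  · rintro q ⟨h1, h2, h3, k1, k2, k3, h5⟩
    have r1 := regMap_fst q
    have r2 := (regMap_snd q).fst
    have r12 := r1.unit_mul r2
    have r3 := (regMap_snd q).snd
    have s1 := regMap_eP_comp hl hln hk hkn r2 r3 h1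
    have s2 := regMap_eP_comp hl hln hk hkn r12 s1 h2
    have t1 := regMap_eP_comp hl hln hk hkn r1 r3 k1
    have t2 := regMap_eP_comp hl hln hk hkn r12 t1 k2
    exact (eventually_domE hl hln hk hkn r2 r3 h1).and
      ((eventually_domE hl hln hk hkn r12 s1 h2).and
      ((eventually_domE hl hln hk hkn r1 s2 h3).and
      ((eventually_domE hl hln hk hkn r1 r3 k1).and
      ((eventually_domE hl hln hk hkn r12 t1 k2).and
      ((eventually_domE hl hln hk hkn r2 t2 k3).and
      ((zOpenPred_spec_ne hln hkn).comp r3 h5))))))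
  · obtain ⟨p, ⟨h1, h1'⟩, h2⟩ := (((isBig_domF hl hln hk hkn i).and (zIrreducible_XX₂ hln hkn)
      (isBig_domF hl hln hk hkn j)).and (zIrreducible_XX₂ hln hkn)
      (isBig_spec_ne hl hln hk hkn)).nonempty
    have h3 : eP i ((1 : ℂˣ) : ℂ) p = p := eP_one hn2 h1.ne
    have h4 : eP j ((1 : ℂˣ) : ℂ) p = p := eP_one hn2 h1'.ne
    refine ⟨(1, 1, p), domE_one h1, ?_, ?_, domE_one h1', ?_, ?_, h2⟩ <;>
      simp only [h3, h4, mul_one] <;> apply domE_one <;> assumption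
  · rintro ⟨c, d, p⟩ ⟨h1, h2, h3, k1, k2, k3, h5⟩
    refine ⟨eP i c (eP j (c * d : ℂˣ) (eP i d p)), ?_, ?_⟩
    · simp only [e_prod_eq' hl hln hk hkn h1, Part.bind_eq_bind, Part.bind_some,
        e_prod_eq' hl hln hk hkn h2, e_prod_eq' hl hln hk hkn h3]
    · simp only [e_prod_eq' hl hln hk hkn k1, Part.bind_eq_bind, Part.bind_some,
        e_prod_eq' hl hln hk hkn k2, e_prod_eq' hl hln hk hkn k3]
      obtain ⟨g1, e1⟩ := eP_spec' hl hln hk hkn h1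
      obtain ⟨g2, e2⟩ := eP_spec' hl hln hk hkn h2
      obtain ⟨g3, e3⟩ := eP_spec' hl hln hk hkn h3
      obtain ⟨g1', f1⟩ := eP_spec' hl hln hk hkn k1
      obtain ⟨g2', f2⟩ := eP_spec' hl hln hk hkn k2
      obtain ⟨g3', f3⟩ := eP_spec' hl hln hk hkn k3
      refine congrArg Part.some (eq_of_range_gm' hl hln hk hkn g3'.gen g3.gen
        ((((sameParam_refl p).eP _ _).eP _ _).eP _ _) ((((sameParam_refl p).eP _ _).eP _ _).eP _ _)
        h5 fun z hz => ?_)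
      rw [Units.val_mul] at e2 e3 f2 f3 ⊢
      rcases hij with hij | hij
      -- The relation is symmetric under the simultaneous exchange of `i` with `j` and of `c` with
      -- `d`.
      · rw [mul_comm] at e2 e3 f2 f3 ⊢
        exact IsE.braid hn hij d.ne_zero c.ne_zero f1 f2 f3 e1 e2 e3
          (bd_one_gm_ne_zero hl hln hk hkn k1.1) (bd_one_gm_ne_zero hl hln hk hkn h1.1)
          (bd_one_gm_ne_zero hl hln hk hkn k2.1) (bd_one_gm_ne_zero hl hln hk hkn h2.1) hz
      exact (IsE.braid hn hij c.ne_zero d.ne_zero e1 e2 e3 f1 f2 f3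
        (bd_one_gm_ne_zero hl hln hk hkn h1.1) (bd_one_gm_ne_zero hl hln hk hkn k1.1)
        (bd_one_gm_ne_zero hl hln hk hkn h2.1) (bd_one_gm_ne_zero hl hln hk hkn k2.1) hz).symm

end ProductCrystal

/-! ### The geometric crystal axioms for products. -/

section IsGeomCrystal

variable {k l n : ℕ} [NeZero n]

variable (hl : 1 ≤ l) (hln : l < n) (hk : 1 ≤ k) (hkn : k < n)

include hl hln hk hkn

theorem isRationalMap_γ : IsRationalMap ((crystal n l).prod (crystal n k)).γ :=
  isRationalMap_of (zIrreducible_XX₂ hln hkn) (fun p i => unitOf (bd (gm p) 0 i)) Gen₂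
    (zOpenPred_gen₂ hln hkn) (isBig_gen₂ hl hln hk hkn).nonempty
    (fun _ hp => regMap_pi fun i => reg_unitOf (reg_bd_zero_gm hl hln hk hkn hp i)
      (bd_zero_gm_ne_zero hl hln hk hkn hp i))
    fun _ hp => γ_prod_eq hl hln hk hkn hp

theorem isRationalMap_φ (i : ZMod n) :
    IsRationalMap (((crystal n l).prod (crystal n k)).φ i) := by
  refine isRationalMap_of (zIrreducible_XX₂ hln hkn)
    (fun p => unitOf (bd (gm p) 1 i / bd (gm p) 0 i)) (DomF i) (zOpenPred_domF hln hkn i)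
    (isBig_domF hl hln hk hkn i).nonempty (fun p hp => ?_) fun _ hp => φ_prod_eq hl hln hk hkn hp
  have h0 := bd_zero_gm_ne_zero hl hln hk hkn hp.gen i
  exact regMap_unit (reg_unitOf ((reg_bd_one_gm hl hln hk hkn hp.gen i).div
    (reg_bd_zero_gm hl hln hk hkn hp.gen i) h0)
    (div_ne_zero (bd_one_gm_ne_zero hl hln hk hkn hp) h0))

theorem isRationalMap_ε (i : ZMod n) :
    IsRationalMap (((crystal n l).prod (crystal n k)).ε i) := by
  refine isRationalMap_of (zIrreducible_XX₂ hln hkn)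
    (fun p => unitOf (bd (gm p) 1 i / bd (gm p) 0 (i + 1))) (DomF i) (zOpenPred_domF hln hkn i)
    (isBig_domF hl hln hk hkn i).nonempty (fun p hp => ?_) fun _ hp => ε_prod_eq hl hln hk hkn hp
  have h0 := bd_zero_gm_ne_zero hl hln hk hkn hp.gen (i + 1)
  exact regMap_unit (reg_unitOf ((reg_bd_one_gm hl hln hk hkn hp.gen i).div
    (reg_bd_zero_gm hl hln hk hkn hp.gen (i + 1)) h0)
    (div_ne_zero (bd_one_gm_ne_zero hl hln hk hkn hp) h0))

theorem isRationalMap_e (i : ZMod n) :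
    IsRationalMap (((crystal n l).prod (crystal n k)).e i) :=
  isRationalMap_of (zIrreducible_units_XX₂ hl hln hk hkn) (fun q => eP i q.1 q.2) (DomE i)
    (zOpenPred_domE hln hkn i) (isBig_domE hl hln hk hkn i).nonempty
    (fun _ hq => regMap_eP hl hln hkn hq) fun _ hq => e_prod_eq' hl hln hk hkn hq

theorem e_one_prod (i : ZMod n) :
    RatEq (fun x : XX n l × XX n k => ((crystal n l).prod (crystal n k)).e i (1, x))
      (PFun.id _) :=
  ratEq_of (zIrreducible_XX₂ hln hkn) (DomF i) (zOpenPred_domF hln hkn i)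
    (isBig_domF hl hln hk hkn i).nonempty fun p hp =>
    ⟨p, (e_prod_eq' hl hln hk hkn (domE_one hp)).trans
      (congrArg Part.some (eP_one (by omega) hp.ne)), rfl⟩

theorem coroot_apply (hn : 2 ≤ n) (i j : ZMod n) (c : ℂˣ) : coroot i c j =
    if j = i then c else if j = i + 1 then c⁻¹ else 1 := by
  have h1 : i ≠ i + 1 := by simpa using zmod_one_ne_zero hn
  rw [coroot, Pi.mul_apply]
  by_cases hj : j = i
  · subst hj
    rw [Pi.mulSingle_eq_same, Pi.mulSingle_eq_of_ne h1, mul_one, if_pos rfl]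
  · rw [Pi.mulSingle_eq_of_ne hj, if_neg hj, one_mul]
    by_cases hj' : j = i + 1
    · subst hj'
      rw [Pi.mulSingle_eq_same, if_pos rfl]
    · rw [Pi.mulSingle_eq_of_ne hj', if_neg hj']

theorem γ_e_prod (i : ZMod n) :
    RatEq (((crystal n l).prod (crystal n k)).γ.comp (((crystal n l).prod (crystal n k)).e i))
      (fun p => (((crystal n l).prod (crystal n k)).γ p.2).map fun z => coroot i p.1 * z) := by
  have hn : 2 ≤ n := by omega
  refine ratEq_of (zIrreducible_units_XX₂ hl hln hk hkn) (DomE i) (zOpenPred_domE hln hkn i)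
    (isBig_domE hl hln hk hkn i).nonempty ?_
  rintro ⟨c, p⟩ hp
  obtain ⟨g, e⟩ := eP_spec' hl hln hk hkn hp
  have h1 := bd_one_gm_ne_zero hl hln hk hkn hp.1
  have h0 := bd_zero_gm_ne_zero hl hln hk hkn hp.1.gen
  refine ⟨_, (comp_eq (e_prod_eq' hl hln hk hkn hp)).trans (γ_prod_eq hl hln hk hkn g.gen), ?_⟩
  simp only [γ_prod_eq hl hln hk hkn hp.1.gen, Part.map_some]
  refine congrArg Part.some (funext fun j => Units.ext ?_)
  rw [Pi.mul_apply, Units.val_mul, coroot_apply hl hln hk hkn hn, coe_unitOf (h0 j),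
    coe_unitOf (bd_zero_gm_ne_zero hl hln hk hkn g.gen j)]
  by_cases hj : j = i
  · subst hj
    rw [if_pos rfl, e.bd_zero_self hn h1]
  · rw [if_neg hj]
    by_cases hj' : j = i + 1
    · subst hj'
      rw [if_pos rfl, e.bd_zero_succ hn h1, Units.val_inv_eq_inv_val]
    · rw [if_neg hj', e.bd_zero_of_ne hj hj', Units.val_one, one_mul]

theorem φ_e_prod (i : ZMod n) :
    RatEq ((((crystal n l).prod (crystal n k)).φ i).comp (((crystal n l).prod (crystal n k)).e i))
      (fun p => (((crystal n l).prod (crystal n k)).φ i p.2).map fun a => p.1⁻¹ * a) := by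
  have hn : 2 ≤ n := by omega
  refine ratEq_of (zIrreducible_units_XX₂ hl hln hk hkn) (DomE i) (zOpenPred_domE hln hkn i)
    (isBig_domE hl hln hk hkn i).nonempty ?_
  rintro ⟨c, p⟩ hp
  obtain ⟨g, e⟩ := eP_spec' hl hln hk hkn hp
  have h1 := bd_one_gm_ne_zero hl hln hk hkn hp.1
  have h1' := bd_one_gm_ne_zero hl hln hk hkn g
  have h0 := bd_zero_gm_ne_zero hl hln hk hkn hp.1.gen i
  have h0' := bd_zero_gm_ne_zero hl hln hk hkn g.gen i
  refine ⟨_, (comp_eq (e_prod_eq' hl hln hk hkn hp)).trans (φ_prod_eq hl hln hk hkn g), ?_⟩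
  simp only [φ_prod_eq hl hln hk hkn hp.1, Part.map_some]
  refine congrArg Part.some (Units.ext ?_)
  rw [Units.val_mul, coe_unitOf (div_ne_zero h1 h0), coe_unitOf (div_ne_zero h1' h0'),
    e.bd_zero_self hn h1, e.bd_one_self hn, Units.val_inv_eq_inv_val]
  field_simp

theorem ε_e_prod (i : ZMod n) :
    RatEq ((((crystal n l).prod (crystal n k)).ε i).comp (((crystal n l).prod (crystal n k)).e i))
      (fun p => (((crystal n l).prod (crystal n k)).ε i p.2).map fun a => p.1 * a) := by
  have hn : 2 ≤ n := by omega
  refine ratEq_of (zIrreducible_units_XX₂ hl hln hk hkn) (DomE i) (zOpenPred_domE hln hkn i)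
    (isBig_domE hl hln hk hkn i).nonempty ?_
  rintro ⟨c, p⟩ hp
  obtain ⟨g, e⟩ := eP_spec' hl hln hk hkn hp
  have h1 := bd_one_gm_ne_zero hl hln hk hkn hp.1
  have h1' := bd_one_gm_ne_zero hl hln hk hkn g
  have h0 := bd_zero_gm_ne_zero hl hln hk hkn hp.1.gen (i + 1)
  have h0' := bd_zero_gm_ne_zero hl hln hk hkn g.gen (i + 1)
  refine ⟨_, (comp_eq (e_prod_eq' hl hln hk hkn hp)).trans (ε_prod_eq hl hln hk hkn g), ?_⟩
  simp only [ε_prod_eq hl hln hk hkn hp.1, Part.map_some]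
  refine congrArg Part.some (Units.ext ?_)
  rw [Units.val_mul, coe_unitOf (div_ne_zero h1 h0), coe_unitOf (div_ne_zero h1' h0'),
    e.bd_zero_succ hn h1, e.bd_one_self hn]
  field_simp

theorem ε_div_φ_prod (i : ZMod n) :
    RatEq (fun x => do
      let a ← ((crystal n l).prod (crystal n k)).ε i x
      let b ← ((crystal n l).prod (crystal n k)).φ i x
      return a / b)
    (fun x => (((crystal n l).prod (crystal n k)).γ x).map fun z => z i / z (i + 1)) := by
  refine ratEq_of (zIrreducible_XX₂ hln hkn) (DomF i) (zOpenPred_domF hln hkn i)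
    (isBig_domF hl hln hk hkn i).nonempty fun p hp =>
    ⟨unitOf (bd (gm p) 0 i) / unitOf (bd (gm p) 0 (i + 1)), ?_, ?_⟩
  have h1 := bd_one_gm_ne_zero hl hln hk hkn hp
  have h0 := bd_zero_gm_ne_zero hl hln hk hkn hp.gen i
  have h0' := bd_zero_gm_ne_zero hl hln hk hkn hp.gen (i + 1)
  · simp only [ε_prod_eq hl hln hk hkn hp, φ_prod_eq hl hln hk hkn hp, Part.bind_eq_bind,
      Part.bind_some]
    refine congrArg Part.some (Units.ext ?_)
    rw [Units.val_div_eq_div_val, Units.val_div_eq_div_val, coe_unitOf (div_ne_zero h1 h0),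
      coe_unitOf (div_ne_zero h1 h0'), coe_unitOf h0, coe_unitOf h0']
    field_simp
  · rw [γ_prod_eq hl hln hk hkn hp.gen, Part.map_some]

theorem isGeomCrystal_prod : IsGeomCrystal ((crystal n l).prod (crystal n k)) where
  irreducible := zIrreducible_XX₂ hln hkn
  rational_γ := isRationalMap_γ hl hln hk hkn
  rational_φ := isRationalMap_φ hl hln hk hkn
  rational_ε := isRationalMap_ε hl hln hk hkn
  rational_e := isRationalMap_e hl hln hk hkn
  e_one := e_one_prod hl hln hk hkn
  e_mul := e_mul_prod hl hln hk hkn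
  γ_e := γ_e_prod hl hln hk hkn
  φ_e := φ_e_prod hl hln hk hkn
  ε_e := ε_e_prod hl hln hk hkn
  ε_div_φ := ε_div_φ_prod hl hln hk hkn
  serre_comm := fun _ _ _ => serre_comm_prod hl hln hk hkn
  serre_braid := fun hn _ _ => serre_braid_prod hl hln hk hkn hn

end IsGeomCrystal

/-! ### The geometric `R`-matrix: domain, isomorphism property and symmetries. -/

section RMatrix

variable {k l m n : ℕ} [NeZero n]

/-- The domain on which the geometric `R`-matrix is considered. -/
structure DomR (p : XX n l × XX n k) : Prop where
  gen : Gen₂ p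
  ne : spec p.1 ≠ spec p.2
  gen' : IsGeneric (psi p).1

/-- The geometric `R`-matrix, without regard to its domain of definition. -/
def RR (p : XX n l × XX n k) : XX n k × XX n l := (psi p, psiS p)

/-- The geometric `R`-matrix on the first two of three factors. -/
def RR₁ (p : XX n l × XX n k × XX n m) : XX n k × XX n l × XX n m :=
  ((RR (p.1, p.2.1)).1, (RR (p.1, p.2.1)).2, p.2.2)

/-- The geometric `R`-matrix on the last two of three factors. -/
def RR₂ (p : XX n l × XX n k × XX n m) : XX n l × XX n m × XX n k := (p.1, RR p.2)

/-- The condition `DomR` on the first two of three factors. -/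
def DomR₁ (p : XX n l × XX n k × XX n m) : Prop := DomR (p.1, p.2.1)

/-- The condition `DomR` on the last two of three factors. -/
def DomR₂ (p : XX n l × XX n k × XX n m) : Prop := DomR p.2

variable (hl : 1 ≤ l) (hln : l < n) (hk : 1 ≤ k) (hkn : k < n)

section

include hl hln hk hkn

theorem DomR.refactor {p : XX n l × XX n k} (h : DomR p) :
    Refactor p.1 p.2 (RR p).1 (RR p).2 := by
  obtain ⟨x', hx'⟩ := exists_refactor_of_psi hl hln hk hkn h.gen.1 h.gen.2 h.ne h.gen'
  have h1 : psiS p = x' := hx'.psiS_eq hl hln hk hkn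
  change Refactor p.1 p.2 (psi p) (psiS p)
  rw [h1]
  exact hx'

theorem Refactor.domR {x : XX n l} {y y' : XX n k} {x' : XX n l} (h : Refactor x y y' x') :
    DomR (x, y) ∧ RR (x, y) = (y', x') := by
  have h1 := h.psi_eq hl hln hk hkn
  refine ⟨⟨⟨h.gen₁, h.gen₂⟩, h.ne, ?_⟩, Prod.ext h1 (h.psiS_eq hl hln hk hkn)⟩
  rw [h1]
  exact h.gen₁'

/-- A refactorization read backwards is a refactorization, hence `R` is an involution. -/
theorem DomR.RR {p : XX n l × XX n k} (h : DomR p) : DomR (RR p) ∧ GeomR.RR (GeomR.RR p) = p :=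
  (h.refactor hl hln hk hkn).symm.domR hk hkn hl hln

theorem DomR.R_eq {p : XX n l × XX n k} (h : DomR p) : R p = Part.some (GeomR.RR p) :=
  (h.refactor hl hln hk hkn).R_eq hl hln hk hkn

theorem DomR.gm_RR {p : XX n l × XX n k} (h : DomR p) : gm (GeomR.RR p) = gm p :=
  (h.refactor hl hln hk hkn).eq.symm

theorem regMap_psi {p : XX n l × XX n k} (hp : Gen₂ p) (hne : spec p.1 ≠ spec p.2) :
    RegMap (psi : XX n l × XX n k → XX n k) p := by
  have h2 : Reg (fun q : XX n l × XX n k => spec q.2) p :=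
    Reg.comp (G := spec) (reg_spec p.2) (regMap_snd p)
  have e1 := reg_ev_gMat hln.le (regMap_fst p) hp.1 h2
  have e2 := reg_ev_gMat hkn.le (regMap_snd p) hp.2 h2
  have e3 := reg_matrix_mul e1 e2
  refine RegMap.prodMk (regMap_mkD (N₀ := fun q : XX n l × XX n k => q.2.1)
    (B := fun q => firstCols k (ev (spec q.2) (gMat q.1 * gMat q.2))) (fun i j => ?_)
    (finrank_psi hl hln hk hkn hp.1 hp.2 hne)) (regMap_snd p).snd
  simp only [map_mul]
  exact e3 i (idx n (1 + (j : ℕ)))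

theorem regMap_psi_schutz {T : Type} [AlgCoord T] {f : T → XX n k} {g : T → XX n l} {p : T}
    (hf : IsGeneric (f p).1) (hg : IsGeneric (g p).1) (hne : spec (f p) ≠ spec (g p))
    (h1 : RegMap f p) (h2 : RegMap g p) : RegMap (fun q => psi (f q, g q)) p := by
  have hg : Gen₂ (f p, g p) := ⟨hf, hg⟩
  have hne' : spec (f p, g p).1 ≠ spec (f p, g p).2 := hne
  exact RegMap.comp (G := psi) (F := fun q => (f q, g q))
    (regMap_psi hk hkn hl hln hg hne') (h1.prodMk h2)

theorem regMap_psiS {p : XX n l × XX n k} (h : DomR p) :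
    RegMap (psiS : XX n l × XX n k → XX n l) p := by
  have hs := (h.refactor hl hln hk hkn).schutz hl hln hk hkn
  have h1 : RegMap (fun q : XX n l × XX n k => schutz q.2) p :=
    RegMap.comp (G := schutz) (regMap_schutz hk hkn h.gen.2) (regMap_snd p)
  have h2 : RegMap (fun q : XX n l × XX n k => schutz q.1) p :=
    RegMap.comp (G := schutz) (regMap_schutz hl hln h.gen.1) (regMap_fst p)
  have h4 := hs.gen₁'
  rw [← hs.psi_eq hk hkn hl hln] at h4
  exact RegMap.comp (G := schutz) (regMap_schutz hl hln h4)
    (regMap_psi_schutz hl hln hk hkn hs.gen₁ hs.gen₂ hs.ne h1 h2)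

theorem regMap_RR {p : XX n l × XX n k} (h : DomR p) :
    RegMap (GeomR.RR : XX n l × XX n k → XX n k × XX n l) p := by
  exact RegMap.prodMk (F := psi) (G := psiS) (regMap_psi hl hln hk hkn h.gen h.ne)
    (regMap_psiS hl hln hk hkn h)

theorem zOpenPred_domR : ZOpenPred fun p : XX n l × XX n k => DomR p := by
  intro p hp
  filter_upwards [zOpenPred_gen₂ hln hkn p hp.gen, zOpenPred_spec_ne hln hkn p hp.ne,
    zOpenPred_isGeneric.comp (regMap_psi hl hln hk hkn hp.gen hp.ne).fst hp.gen'] with q h1 h2 h3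
  exact ⟨h1, h2, h3⟩

/-- For fixed `x` and a fixed parameter of `y`, the map `Ψ` acts on generic subspaces by an
invertible matrix. By irreducibility some generic subspace has generic image. -/
theorem isBig_domR : IsBig fun p : XX n l × XX n k => DomR p := by
  refine ⟨zOpenPred_domR hl hln hk hkn, ?_⟩
  obtain ⟨⟨x, y⟩, ⟨hx, hy⟩, hne⟩ := ((isBig_gen₂ hl hln hk hkn).and (zIrreducible_XX₂ hln hkn)
    (isBig_spec_ne hl hln hk hkn)).nonempty
  have hu := isUnit_ev_gMat hl hln hx hne.symm
  have hu' : IsUnit (ev (spec y) (gMat x))⁻¹ := by rwa [Matrix.isUnit_nonsing_inv_iff]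
  let F : Gr k n → Gr k n := fun N => ⟨N.1.map (ev (spec y) (gMat x)).mulVecLin, by
    rw [finrank_map_of_isUnit hu, N.2]⟩
  have hF : ∀ N, RegMap F N := by
    intro N
    obtain ⟨B, hB, hB'⟩ := exists_local_matrix N
    refine regMap_gr (B := fun N => ev (spec y) (gMat x) * B N)
      (reg_matrix_mul (fun i j => reg_const _ _) hB) ?_
    filter_upwards [hB'] with M hM
    rw [Matrix.mulVecLin_mul, LinearMap.range_comp, ← hM]
  have hsurj : ∀ N, ∃ M, F M = N := fun N => by
    refine ⟨⟨N.1.map (ev (spec y) (gMat x))⁻¹.mulVecLin, by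
      rw [finrank_map_of_isUnit hu', N.2]⟩, Subtype.ext ?_⟩
    change Submodule.map _ (Submodule.map _ _) = _
    rw [← Submodule.map_comp, ← Matrix.mulVecLin_mul, Matrix.mul_nonsing_inv _
      ((Matrix.isUnit_iff_isUnit_det _).1 hu), Matrix.mulVecLin_one, Submodule.map_id]
  have hb : IsBig fun N : Gr k n => IsGeneric N := ⟨zOpenPred_isGeneric, _, hy⟩
  obtain ⟨N, h1, h2⟩ := (hb.and (ratConnected_gr hkn.le).zIrreducible (hb.comp hF hsurj)).nonempty
  have hne' : spec x ≠ spec ((N, y.2) : XX n k) := hne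
  refine ⟨(x, (N, y.2)), ⟨hx, h1⟩, hne', ?_⟩
  have h3 : (psi (x, (N, y.2))).1 = F N := Subtype.ext (psi_fst hl hln hk hkn hx h1 hne')
  rw [h3]
  exact h2

/-- Conditions on the image of `R` can be met because `R` in the opposite direction is a right
inverse. -/
theorem isBig_domR_and {Q : XX n k × XX n l → Prop} (hQ : IsBig Q) :
    IsBig fun p : XX n l × XX n k => DomR p ∧ Q (GeomR.RR p) :=
  IsBig.pull (zIrreducible_XX₂ hkn hln) (zOpenPred_domR hl hln hk hkn)
    (isBig_domR hk hkn hl hln) hQ (fun _ hp => regMap_RR hl hln hk hkn hp)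
    fun _ hq => hq.RR hk hkn hl hln

/-- The unipotents that represent `e_i^c` depend only on the product matrix, which `p` and its image
under `R` share; the moved products therefore coincide. -/
theorem Refactor.eP {i : ZMod n} {c : ℂˣ} {p : XX n l × XX n k} (h : DomR p)
    (h1 : DomE i (c, p)) (h2 : DomE i (c, GeomR.RR p)) :
    Refactor (eP i c p).1 (eP i c p).2 (eP i c (GeomR.RR p)).1 (eP i c (GeomR.RR p)).2 := by
  obtain ⟨g1, e1⟩ := eP_spec' hl hln hk hkn h1
  obtain ⟨g2, e2⟩ := eP_spec' hk hkn hl hln h2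
  have hR := h.refactor hl hln hk hkn
  have s1 := (sameParam_refl p).eP i c
  have s2 := (sameParam_refl (GeomR.RR p)).eP i c
  refine ⟨g1.gen.1, g1.gen.2, g2.gen.1, g2.gen.2, s2.2.trans (hR.snd₁.trans s1.1.symm),
    s2.1.trans (hR.snd₂.trans s1.2.symm), ?_, ?_⟩
  · rw [spec_congr s1.1, spec_congr s1.2]
    exact h.ne
  · rw [h.gm_RR hl hln hk hkn] at e2
    exact e1.move.eq e2.move

/-- All of `γ, φ, ε` are read off from the product matrix, which `R` preserves; compatibility with
`e_i` is `Refactor.eP`. -/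
theorem isCrystalMorphism_R : IsCrystalMorphism ((crystal n l).prod (crystal n k))
    ((crystal n k).prod (crystal n l)) (R : XX n l × XX n k →. XX n k × XX n l) where
  rational := isRationalMap_of (zIrreducible_XX₂ hln hkn) GeomR.RR DomR
    (zOpenPred_domR hl hln hk hkn) (isBig_domR hl hln hk hkn).nonempty
    (fun _ hp => regMap_RR hl hln hk hkn hp) fun _ hp => hp.R_eq hl hln hk hkn
  γ_comp := ratEq_of (zIrreducible_XX₂ hln hkn) DomR
    (zOpenPred_domR hl hln hk hkn) (isBig_domR hl hln hk hkn).nonempty fun p hp =>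
      ⟨_, (comp_eq (hp.R_eq hl hln hk hkn)).trans
        (γ_prod_eq hk hkn hl hln (hp.RR hl hln hk hkn).1.gen), by
        rw [γ_prod_eq hl hln hk hkn hp.gen, hp.gm_RR hl hln hk hkn]⟩
  φ_comp := fun i => by
    have hb := (isBig_domR_and hl hln hk hkn (isBig_domF hk hkn hl hln i)).and
      (zIrreducible_XX₂ hln hkn) (isBig_domF hl hln hk hkn i)
    exact ratEq_of (zIrreducible_XX₂ hln hkn) _ hb.zOpenPred hb.nonempty fun p hp =>
      ⟨_, (comp_eq (hp.1.1.R_eq hl hln hk hkn)).trans (φ_prod_eq hk hkn hl hln hp.1.2), by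
        rw [φ_prod_eq hl hln hk hkn hp.2, hp.1.1.gm_RR hl hln hk hkn]⟩
  ε_comp := fun i => by
    have hb := (isBig_domR_and hl hln hk hkn (isBig_domF hk hkn hl hln i)).and
      (zIrreducible_XX₂ hln hkn) (isBig_domF hl hln hk hkn i)
    exact ratEq_of (zIrreducible_XX₂ hln hkn) _ hb.zOpenPred hb.nonempty fun p hp =>
      ⟨_, (comp_eq (hp.1.1.R_eq hl hln hk hkn)).trans (ε_prod_eq hk hkn hl hln hp.1.2), by
        rw [ε_prod_eq hl hln hk hkn hp.2, hp.1.1.gm_RR hl hln hk hkn]⟩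
  e_comm := fun i => by
    have hb := (isBig_domR_and hl hln hk hkn (isBig_domF hk hkn hl hln i)).and
      (zIrreducible_XX₂ hln hkn) (isBig_domF hl hln hk hkn i)
    refine ratEq_of (zIrreducible_units_XX₂ hl hln hk hkn) (fun q => DomR q.2 ∧
      DomE i (q.1, q.2) ∧ DomE i (q.1, GeomR.RR q.2)) ?_ ?_ ?_
    · rintro q ⟨h1, h2, h3⟩
      have r1 := regMap_fst q
      have r2 := regMap_snd q
      have r3 : RegMap (fun q : ℂˣ × XX n l × XX n k => GeomR.RR q.2) q :=
        RegMap.comp (G := GeomR.RR) (regMap_RR hl hln hk hkn h1) r2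
      exact ((zOpenPred_domR hl hln hk hkn).comp r2 h1).and
        ((eventually_domE hl hln hk hkn r1 r2 h2).and (eventually_domE hk hkn hl hln r1 r3 h3))
    · obtain ⟨p, ⟨h1, h2⟩, h3⟩ := hb.nonempty
      exact ⟨(1, p), h1, domE_one h3, domE_one h2⟩
    · rintro ⟨c, p⟩ ⟨h1, h2, h3⟩
      refine ⟨eP i c (GeomR.RR p), ?_, ?_⟩
      · simp only [h1.R_eq hl hln hk hkn, Part.bind_some]
        exact e_prod_eq' hk hkn hl hln h3
      · rw [comp_eq (e_prod_eq' hl hln hk hkn h2)]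
        exact (Refactor.eP hl hln hk hkn h1 h2 h3).R_eq hl hln hk hkn

theorem R_comp_R : RatEq ((R : XX n k × XX n l →. XX n l × XX n k).comp R) (PFun.id _) :=
  ratEq_of (zIrreducible_XX₂ hln hkn) DomR (zOpenPred_domR hl hln hk hkn)
    (isBig_domR hl hln hk hkn).nonempty fun p hp => ⟨p, by
      rw [comp_eq (hp.R_eq hl hln hk hkn), (hp.RR hl hln hk hkn).1.R_eq hk hkn hl hln,
        (hp.RR hl hln hk hkn).2], rfl⟩

theorem isCrystalIso_R : IsCrystalIso ((crystal n l).prod (crystal n k))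
    ((crystal n k).prod (crystal n l)) (R : XX n l × XX n k →. XX n k × XX n l) :=
  ⟨isGeomCrystal_prod hl hln hk hkn, isGeomCrystal_prod hk hkn hl hln,
    isCrystalMorphism_R hl hln hk hkn, R, isCrystalMorphism_R hk hkn hl hln,
    R_comp_R hl hln hk hkn, R_comp_R hk hkn hl hln⟩

theorem R_comp_PR₂ : RatEq (R.comp (PR₂ : XX n l × XX n k →. XX n l × XX n k)) (PR₂.comp R) :=
  ratEq_of (zIrreducible_XX₂ hln hkn) DomR (zOpenPred_domR hl hln hk hkn)
    (isBig_domR hl hln hk hkn).nonempty fun _ hp =>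
      ⟨_, (comp_eq (PR₂_eq _ _)).trans
        (((hp.refactor hl hln hk hkn).pr hl hln hk hkn).R_eq hl hln hk hkn),
        (comp_eq (hp.R_eq hl hln hk hkn)).trans (PR₂_eq _ _)⟩

theorem R_comp_S₂ : RatEq (R.comp (S₂ : XX n l × XX n k →. XX n k × XX n l)) (S₂.comp R) :=
  ratEq_of (zIrreducible_XX₂ hln hkn) DomR (zOpenPred_domR hl hln hk hkn)
    (isBig_domR hl hln hk hkn).nonempty fun _ hp =>
      ⟨_, (comp_eq (S₂_eq hl hln hk hkn hp.gen.1 hp.gen.2)).trans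
        (((hp.refactor hl hln hk hkn).schutz hl hln hk hkn).R_eq hk hkn hl hln),
        (comp_eq (hp.R_eq hl hln hk hkn)).trans (S₂_eq hk hkn hl hln
          (hp.refactor hl hln hk hkn).gen₁' (hp.refactor hl hln hk hkn).gen₂')⟩

theorem D₂_eq {x : XX n l} {y : XX n k} (hx : IsGeneric x.1) (hy : IsGeneric y.1) :
    D₂ (x, y) = Part.some (schutz (dualPt y), schutz (dualPt x)) :=
  (comp_eq (prodMap_eq (dual_eq x) (dual_eq y))).trans (S₂_eq (by omega) (by omega) (by omega)
    (by omega) (dualPt_isGeneric hln hx) (dualPt_isGeneric hkn hy))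

theorem R_comp_D₂ : RatEq (R.comp (D₂ : XX n l × XX n k →. XX n (n - k) × XX n (n - l)))
    (D₂.comp R) :=
  ratEq_of (zIrreducible_XX₂ hln hkn) DomR (zOpenPred_domR hl hln hk hkn)
    (isBig_domR hl hln hk hkn).nonempty fun p hp =>
      ⟨_, (comp_eq (D₂_eq hl hln hk hkn hp.gen.1 hp.gen.2)).trans
        ((((hp.refactor hl hln hk hkn).dual hl hln hk hkn).schutz (by omega) (by omega)
          (by omega) (by omega)).R_eq (by omega) (by omega) (by omega) (by omega)),
        (comp_eq (hp.R_eq hl hln hk hkn)).trans (D₂_eq hk hkn hl hln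
          (hp.refactor hl hln hk hkn).gen₁' (hp.refactor hl hln hk hkn).gen₂')⟩

end

/-! ### The Yang–Baxter relation. -/

section YangBaxter

variable (hm : 1 ≤ m) (hmn : m < n)

theorem zIrreducible_XX₃ (hln : l < n) (hkn : k < n) (hmn : m < n) :
    ZIrreducible (XX n l × XX n k × XX n m) :=
  ((ratConnected_XX hln.le).prod
    ((ratConnected_XX hkn.le).prod (ratConnected_XX hmn.le))).zIrreducible

include hl hln hk hkn

theorem DomR₁.R₁_eq {p : XX n l × XX n k × XX n m} (h : DomR₁ p) : R₁ p = Part.some (RR₁ p) := by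
  rw [R₁, DomR.R_eq hl hln hk hkn h, Part.map_some]
  rfl

theorem DomR₁.RR₁ {p : XX n l × XX n k × XX n m} (h : DomR₁ p) :
    DomR₁ (RR₁ p) ∧ GeomR.RR₁ (GeomR.RR₁ p) = p := by
  obtain ⟨h1, h2⟩ := DomR.RR hl hln hk hkn h
  have e1 : (GeomR.RR (GeomR.RR (p.1, p.2.1))).1 = p.1 := congrArg Prod.fst h2
  have e2 : (GeomR.RR (GeomR.RR (p.1, p.2.1))).2 = p.2.1 := congrArg Prod.snd h2
  exact ⟨h1, Prod.ext e1 (Prod.ext e2 rfl)⟩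

theorem regMap_RR₁ {p : XX n l × XX n k × XX n m} (h : DomR₁ p) :
    RegMap (GeomR.RR₁ : XX n l × XX n k × XX n m → _) p := by
  have h1 : RegMap (fun q : XX n l × XX n k × XX n m => RR (q.1, q.2.1)) p :=
    RegMap.comp (G := RR) (F := fun q : XX n l × XX n k × XX n m => (q.1, q.2.1))
      (regMap_RR hl hln hk hkn h) ((regMap_fst p).prodMk (regMap_snd p).fst)
  exact h1.fst.prodMk (h1.snd.prodMk (regMap_snd p).snd)

omit hl hln in
include hm hmn in
theorem DomR₂.R₂_eq {p : XX n l × XX n k × XX n m} (h : DomR₂ p) : R₂ p = Part.some (RR₂ p) := by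
  rw [R₂, DomR.R_eq hk hkn hm hmn h, Part.map_some]
  rfl

omit hl hln in
include hm hmn in
theorem DomR₂.RR₂ {p : XX n l × XX n k × XX n m} (h : DomR₂ p) :
    DomR₂ (RR₂ p) ∧ GeomR.RR₂ (GeomR.RR₂ p) = p := by
  obtain ⟨h1, h2⟩ := DomR.RR hk hkn hm hmn h
  exact ⟨h1, Prod.ext rfl h2⟩

omit hl hln in
include hm hmn in
theorem regMap_RR₂ {p : XX n l × XX n k × XX n m} (h : DomR₂ p) :
    RegMap (GeomR.RR₂ : XX n l × XX n k × XX n m → _) p :=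
  (regMap_fst p).prodMk (RegMap.comp (G := RR) (regMap_RR hk hkn hm hmn h) (regMap_snd p))

include hm hmn

theorem isBig_domR₁ : IsBig fun p : XX n l × XX n k × XX n m => DomR₁ p := by
  obtain ⟨z, -⟩ := exists_isGeneric_bd_ne_zero hm hmn 0
  exact (isBig_domR hl hln hk hkn).comp (F := fun q : XX n l × XX n k × XX n m => (q.1, q.2.1))
    (fun p => (regMap_fst p).prodMk (regMap_snd p).fst) fun p => ⟨(p.1, p.2, z), rfl⟩

theorem isBig_domR₂ : IsBig fun p : XX n l × XX n k × XX n m => DomR₂ p := by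
  obtain ⟨x, -⟩ := exists_isGeneric_bd_ne_zero hl hln 0
  exact (isBig_domR hk hkn hm hmn).comp (F := fun q : XX n l × XX n k × XX n m => q.2)
    regMap_snd fun p => ⟨(x, p), rfl⟩

theorem isBig_domR₁_and {Q : XX n k × XX n l × XX n m → Prop} (hQ : IsBig Q) :
    IsBig fun p : XX n l × XX n k × XX n m => DomR₁ p ∧ Q (RR₁ p) :=
  IsBig.pull (zIrreducible_XX₃ hkn hln hmn) (isBig_domR₁ hl hln hk hkn hm hmn).zOpenPred
    (isBig_domR₁ hk hkn hl hln hm hmn) hQ (fun _ hp => regMap_RR₁ hl hln hk hkn hp)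
    fun _ hq => hq.RR₁ hk hkn hl hln

theorem isBig_domR₂_and {Q : XX n l × XX n m × XX n k → Prop} (hQ : IsBig Q) :
    IsBig fun p : XX n l × XX n k × XX n m => DomR₂ p ∧ Q (RR₂ p) :=
  IsBig.pull (zIrreducible_XX₃ hln hmn hkn) (isBig_domR₂ hl hln hk hkn hm hmn).zOpenPred
    (isBig_domR₂ hl hln hm hmn hk hkn) hQ (fun _ hp => regMap_RR₂ hk hkn hm hmn hp)
    fun _ hq => hq.RR₂ hm hmn hk hkn

/-- A generic triple of points is determined by the product of its matrices. -/
theorem eq_of_mul_eq {p q : XX n l × XX n k × XX n m} (hp : IsGeneric p.1.1) (hp' : Gen₂ p.2)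
    (hq : IsGeneric q.1.1) (hq' : Gen₂ q.2) (h1 : p.1.2 = q.1.2) (h2 : p.2.1.2 = q.2.1.2)
    (h3 : p.2.2.2 = q.2.2.2) (n1 : spec p.1 ≠ spec p.2.1) (n2 : spec p.1 ≠ spec p.2.2)
    (n3 : spec p.2.1 ≠ spec p.2.2) (h : gMat p.1 * gm p.2 = gMat q.1 * gm q.2) : p = q := by
  -- At the special value of the first point the other two matrices are invertible, so the range of
  -- the triple product recovers the first point.
  have key : ∀ r : XX n l × XX n k × XX n m, IsGeneric r.1.1 → Gen₂ r.2 →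
      spec r.1 ≠ spec r.2.1 → spec r.1 ≠ spec r.2.2 →
      LinearMap.range (ev (spec r.1) (gMat r.1 * gm r.2)).mulVecLin = r.1.1.1 := by
    intro r hr hr' m1 m2
    rw [map_mul, range_mul_of_isUnit, range_gMat hl hln hr]
    rw [gm, map_mul]
    exact (isUnit_ev_gMat hk hkn hr'.1 m1).mul (isUnit_ev_gMat hm hmn hr'.2 m2)
  have s1 := spec_congr h1
  have s2 := spec_congr h2
  have s3 := spec_congr h3
  have e1 : p.1 = q.1 := Prod.ext (Subtype.ext (by
    rw [← key p hp hp' n1 n2, ← key q hq hq' (s1 ▸ s2 ▸ n1) (s1 ▸ s3 ▸ n2), h, s1])) h1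
  refine Prod.ext e1 (eq_of_range_gm hk hkn hm hmn hp' hq' h2 h3 n3 fun z _ => ?_)
  have e2 : gm p.2 = gm q.2 := by
    -- The common first factor is removed by its cofactor, leaving a product of two.
    have h4 := congrArg (fun M => cofactor p.1 * M) h
    simp only [← e1] at h4
    rw [← mul_assoc, ← mul_assoc, cofactor_mul hl hln hp, smul_mul_assoc, smul_mul_assoc, one_mul,
      one_mul] at h4
    exact smul_left_cancel_folded h4
  rw [e2]

/-- Both chains of exchanges rewrite `g(x) g(y) g(z)` as a product of three matrices whose
parameters come in the order of `z`, `y`, `x`, and such a factorization is unique. -/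
theorem Refactor.yangBaxter {x x₁ x₂ x₁' x₂' : XX n l} {y y₁ y₂ y₁' y₂' : XX n k}
    {z z₁ z₂ z₁' z₂' : XX n m} (a₁ : Refactor x y y₁ x₁) (a₂ : Refactor x₁ z z₁ x₂)
    (a₃ : Refactor y₁ z₁ z₂ y₂) (b₁ : Refactor y z z₁' y₁') (b₂ : Refactor x z₁' z₂' x₁')
    (b₃ : Refactor x₁' y₁' y₂' x₂') : (z₂, y₂, x₂) = (z₂', y₂', x₂') := by
  have ha : gMat z₂ * gm (y₂, x₂) = gMat x * (gMat y * gMat z) := by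
    rw [gm, ← mul_assoc, ← a₃.eq, mul_assoc, ← a₂.eq, ← mul_assoc, ← a₁.eq, mul_assoc]
  have hb : gMat z₂' * gm (y₂', x₂') = gMat x * (gMat y * gMat z) := by
    rw [gm, ← b₃.eq, ← mul_assoc, ← b₂.eq, mul_assoc, ← b₁.eq]
  have x₂e := a₂.snd₁.trans a₁.snd₁
  have x₂e' := b₃.snd₁.trans b₂.snd₁
  have y₂e := a₃.snd₁.trans a₁.snd₂
  have y₂e' := b₃.snd₂.trans b₁.snd₁
  have z₂e := a₃.snd₂.trans a₂.snd₂
  have z₂e' := b₂.snd₂.trans b₁.snd₂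
  have n₁ : spec z₂ ≠ spec y₂ := by
    rw [spec_congr a₃.snd₁, spec_congr a₃.snd₂]
    exact a₃.ne.symm
  have n₂ : spec z₂ ≠ spec x₂ := by
    rw [spec_congr a₂.snd₁, spec_congr z₂e]
    exact a₂.ne.symm
  have n₃ : spec y₂ ≠ spec x₂ := by
    rw [spec_congr x₂e, spec_congr y₂e]
    exact a₁.ne.symm
  exact eq_of_mul_eq hm hmn hk hkn hl hln (p := (z₂, y₂, x₂)) (q := (z₂', y₂', x₂')) a₃.gen₁'
    ⟨a₃.gen₂', a₂.gen₂'⟩ b₂.gen₁' ⟨b₃.gen₁', b₃.gen₂'⟩ (z₂e.trans z₂e'.symm)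
    (y₂e.trans y₂e'.symm) (x₂e.trans x₂e'.symm) n₁ n₂ n₃ (ha.trans hb.symm)

theorem yangBaxter_RR {p : XX n l × XX n k × XX n m}
    (h1 : DomR₁ p) (h2 : DomR₂ (RR₁ p)) (h3 : DomR₁ (RR₂ (RR₁ p)))
    (k1 : DomR₂ p) (k2 : DomR₁ (RR₂ p)) (k3 : DomR₂ (RR₁ (RR₂ p))) :
    RR₁ (RR₂ (RR₁ p)) = RR₂ (RR₁ (RR₂ p)) := by
  have a1 := DomR.refactor hl hln hk hkn h1
  have a2 := DomR.refactor hl hln hm hmn h2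
  have a3 := DomR.refactor hk hkn hm hmn h3
  have b1 := DomR.refactor hk hkn hm hmn k1
  have b2 := DomR.refactor hl hln hm hmn k2
  have b3 := DomR.refactor hl hln hk hkn k3
  exact a1.yangBaxter hl hln hk hkn hm hmn a2 a3 b1 b2 b3

theorem yangBaxter_R : RatEq
    (R₁.comp (R₂.comp R₁) : XX n l × XX n k × XX n m →. XX n m × XX n k × XX n l)
    (R₂.comp (R₁.comp R₂)) := by
  -- The domains of the three successive steps on each side are pulled back one after another; the
  -- two resulting conditions meet by irreducibility.
  have hb := (isBig_domR₁_and hl hln hk hkn hm hmn (isBig_domR₂_and hk hkn hl hln hm hmn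
    (isBig_domR₁ hk hkn hm hmn hl hln))).and (zIrreducible_XX₃ hln hkn hmn)
    (isBig_domR₂_and hl hln hk hkn hm hmn (isBig_domR₁_and hl hln hm hmn hk hkn
    (isBig_domR₂ hm hmn hl hln hk hkn)))
  refine ratEq_of (zIrreducible_XX₃ hln hkn hmn) _ hb.zOpenPred hb.nonempty ?_
  rintro p ⟨⟨h1, h2, h3⟩, ⟨k1, k2, k3⟩⟩
  refine ⟨RR₁ (RR₂ (RR₁ p)), ?_, ?_⟩
  · rw [comp_eq ((comp_eq (h1.R₁_eq hl hln hk hkn)).trans (h2.R₂_eq hl hln hm hmn)),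
      h3.R₁_eq hk hkn hm hmn]
  · rw [yangBaxter_RR hl hln hk hkn hm hmn h1 h2 h3 k1 k2 k3,
      comp_eq ((comp_eq (k1.R₂_eq hk hkn hm hmn)).trans (k2.R₁_eq hl hln hm hmn)),
      k3.R₂_eq hl hln hk hkn]

end YangBaxter

end RMatrix

end GeomR
end

theorem mainTheorem3 (n : ℕ) [NeZero n] (hn : 2 ≤ n) :
    (∀ k₁ ∈ Finset.Icc 1 (n - 1), ∀ k₂ ∈ Finset.Icc 1 (n - 1),
      IsCrystalIso ((crystal n k₁).prod (crystal n k₂)) ((crystal n k₂).prod (crystal n k₁))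
        (R : XX n k₁ × XX n k₂ →. XX n k₂ × XX n k₁)) ∧
    (∀ k₁ ∈ Finset.Icc 1 (n - 1), ∀ k₂ ∈ Finset.Icc 1 (n - 1),
      RatEq (R.comp (PR₂ : XX n k₁ × XX n k₂ →. XX n k₁ × XX n k₂)) (PR₂.comp R) ∧
      RatEq (R.comp (S₂ : XX n k₁ × XX n k₂ →. XX n k₂ × XX n k₁)) (S₂.comp R) ∧
      RatEq (R.comp (D₂ : XX n k₁ × XX n k₂ →. XX n (n - k₂) × XX n (n - k₁))) (D₂.comp R)) ∧
    (∀ k₁ ∈ Finset.Icc 1 (n - 1), ∀ k₂ ∈ Finset.Icc 1 (n - 1), ∀ k₃ ∈ Finset.Icc 1 (n - 1),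
      RatEq (R₁.comp (R₂.comp R₁) : XX n k₁ × XX n k₂ × XX n k₃ →. XX n k₃ × XX n k₂ × XX n k₁)
        (R₂.comp (R₁.comp R₂))) := by
  have hb : ∀ {k : ℕ}, k ∈ Finset.Icc 1 (n - 1) → 1 ≤ k ∧ k < n := fun h => by
    rw [Finset.mem_Icc] at h
    omega
  refine ⟨fun k₁ h₁ k₂ h₂ => ?_, fun k₁ h₁ k₂ h₂ => ?_, fun k₁ h₁ k₂ h₂ k₃ h₃ => ?_⟩
  · exact isCrystalIso_R (hb h₁).1 (hb h₁).2 (hb h₂).1 (hb h₂).2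
  · exact ⟨R_comp_PR₂ (hb h₁).1 (hb h₁).2 (hb h₂).1 (hb h₂).2,
      R_comp_S₂ (hb h₁).1 (hb h₁).2 (hb h₂).1 (hb h₂).2,
      R_comp_D₂ (hb h₁).1 (hb h₁).2 (hb h₂).1 (hb h₂).2⟩
  · exact yangBaxter_R (hb h₁).1 (hb h₁).2 (hb h₂).1 (hb h₂).2 (hb h₃).1 (hb h₃).2
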